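/- **Setting.** Let $n\ge 2$ and write $r=|x|$, $\langle r\rangle=\sqrt{1+r^2}$. Let $\mathfrak g=g_{jk}(x)\,dx^jdx^k$ be a ($C^2$) Riemannian metric on $\mathbb R^n$ which is asymptotically Euclidean: $\mathfrak g=\mathfrak g_1+\mathfrak g_2$ with $$\mathfrak g_1=K^2(r)\,dr^2+r^2d\omega^2,\qquad K>0,\qquad |\partial_r^k(K-1)|\lesssim\langle r\rangle^{-k-\rho}\ (k=0,1,2),$$ $$\mathfrak g_2=g_{2,jk}(x)\,dx^jdx^k,\qquad |\nabla^\beta g_{2,jk}|\lesssim\langle r\rangle^{-\rho-1-|\beta|}\ (|\beta|\le 2),$$ for some $\rho>0$, where $K\in C^2([0,\infty))$ and $g_{2,jk}\in C^2(\mathbb R^n)$. Let $\Delta_{\mathfrak g}$ be the Laplace–Beltrami operator and $dv_{\mathfrak g}$ the Riemannian volume. Assume **(H)** there are $\lambda,c>0$ and a nontrivial entire solution $\phi$ of $\Delta_{\mathfrak g}\phi=\lambda^2\phi$ with $$0\le\phi(x)\le c\,\langle\lambda r\rangle^{-\frac{n-1}{2}}e^{\lambda\int_0^rK(\tau)d\tau}.$$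 Let $p,q>1$, $c_1,c_2\ge 0$, and let $b\in L^1(\mathbb R_+)$ be real-valued, with no sign condition. Let $0\le u_0,u_1\in C_0^\infty(\mathbb R^n)$, $(u_0,u_1)\ne(0,0)$, be supported in $\{|x|\le R_0\}$, $R_0>0$, and let $R_1\ge\int_0^{R_0}K(\tau)d\tau$. Consider $$\partial_t^2u-\Delta_{\mathfrak g}u+b(t)u_t=c_1|u_t|^p+c_2|u|^q,\qquad u(0,x)=\varepsilon u_0(x),\quad u_t(0,x)=\varepsilon u_1(x).\tag{1}$$ A weak solution on $[0,T)$, $0<T\le\infty$, is a function $u$ with $u\in C^2([0,T);\mathcal D'(\mathbb R^n))$, $u_t\in L^p_{loc}([0,T)\times\mathbb R^n)$, $|u|^q\in C([0,T);\mathcal D'(\mathbb R^n))$ which satisfies (1) in the sense of distributions, functions being paired with test functions by means of $dv_{\mathfrak g}$. Put $$p_G(n)=1+\frac{2}{n-1},\qquad p_S(n)=\text{the positive root of }(n-1)q^2-(n+1)q-2=0 .$$ **Theorem 1.1.** There exist constants $\varepsilon_0>0$ and $C_0>0$ (depending on all the data above, but not on $\varepsilon$, $T_\varepsilon$ or $u$)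 such that for every $\varepsilon\in(0,\varepsilon_0)$ and every weak solution $u$ of (1) on $[0,T_\varepsilon)$, $0<T_\varepsilon\le\infty$, with finite speed of propagation $$\operatorname{supp}u\subset\Big\{(t,x):\int_0^{|x|}K(\tau)d\tau\le t+R_1\Big\},$$ the following upper bounds hold (in particular, $T_\varepsilon<\infty$ in each of these cases): 1. if $c_1>0$ and $1<p\le p_G(n)$, then $$T_\varepsilon\le G_\varepsilon:=\begin{cases}C_0\,\varepsilon^{-\frac{2(p-1)}{2-(n-1)(p-1)}},&1<p<p_G(n),\\ \exp\big(C_0\,\varepsilon^{-(p-1)}\big),&p=p_G(n);\end{cases}$$ 2. if $c_1c_2>0$ and $(q-1)((n-1)p-2)<4$, then $$T_\varepsilon\le Z_\varepsilon:=C_0\,\varepsilon^{-\frac{2p(q-1)}{2q+2-(n-1)p(q-1)}};$$ 3. if $c_2>0$ and $1<q<p_S(n)$, then $$T_\varepsilon\le S_\varepsilon:=C_0\,\varepsilon^{\frac{2q(q-1)}{(n-1)q^2-(n+1)q-2}};$$ 4. if $c_2>0$, $n=2$, $1<q<2$ and $u_1\ne 0$, then $$T_\varepsilon\le S^1_\varepsilon:=C_0\,\varepsilon^{-\frac{q-1}{3-q}}.$$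 -/

import Mathlib

open MeasureTheory
open scoped ContDiff

namespace BlowUpAE

noncomputable section

/-- The space `ℝⁿ` with its Euclidean norm; `‖x‖` is the radial coordinate `r`. -/
abbrev E (n : ℕ) : Type := EuclideanSpace ℝ (Fin n)

/-- The Japanese bracket `⟨r⟩ = √(1 + r²)`. -/
def bracket (r : ℝ) : ℝ := Real.sqrt (1 + r ^ 2)

/-- The radial arc length `∫₀ʳ K(τ) dτ`. -/
def arcLength (K : ℝ → ℝ) (r : ℝ) : ℝ := ∫ τ in (0 : ℝ)..r, K τ

/-- `g = (g_{jk})` is the coordinate matrix of a (twice continuously differentiable) Riemannian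
metric on `ℝⁿ` that is asymptotically Euclidean: `g = g₁ + g₂` with
`g₁ = K²(r) dr² + r² dω²`, `|∂ᵣᵏ (K - 1)| ≲ ⟨r⟩^{-k-ρ}` and `|∇^β g₂| ≲ ⟨r⟩^{-ρ-1-|β|}` for
`k, |β| ≤ 2`, for some `ρ > 0`. -/
structure IsAsymptoticallyEuclidean {n : ℕ} (K : ℝ → ℝ)
    (g : E n → Matrix (Fin n) (Fin n) ℝ) : Prop where
  posDef : ∀ x, (g x).PosDef
  contDiff : ∀ j k, ContDiff ℝ 2 (fun x => g x j k)
  radial_pos : ∀ r : ℝ, 0 ≤ r → 0 < K r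
  radial_contDiff : ContDiffOn ℝ 2 K (Set.Ici 0)
  decomposition : ∃ ρ : ℝ, 0 < ρ ∧
    (∀ k : ℕ, k ≤ 2 → ∃ C : ℝ, ∀ r : ℝ, 0 ≤ r →
      |iteratedDerivWithin k (fun s => K s - 1) (Set.Ici 0) r| ≤ C * bracket r ^ (-(k : ℝ) - ρ)) ∧
    ∃ g₂ : E n → Matrix (Fin n) (Fin n) ℝ,
      (∀ j k, ContDiff ℝ 2 (fun x => g₂ x j k)) ∧
      (∀ m : ℕ, m ≤ 2 → ∃ C : ℝ, ∀ j k, ∀ x : E n,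
        ‖iteratedFDeriv ℝ m (fun y => g₂ y j k) x‖ ≤ C * bracket ‖x‖ ^ (-ρ - 1 - (m : ℝ))) ∧
      -- `dr = (x / r) · dx` and `r² dω² = |dx|² - dr²`
      (∀ x : E n, x ≠ 0 → ∀ j k, g x j k =
        K ‖x‖ ^ 2 * (x j / ‖x‖ * (x k / ‖x‖))
          + ((if j = k then 1 else 0) - x j / ‖x‖ * (x k / ‖x‖)) + g₂ x j k)

/-- The partial derivative `∂_j f`. -/
def partialDeriv {n : ℕ} (j : Fin n) (f : E n → ℝ) (x : E n) : ℝ :=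
  fderiv ℝ f x (EuclideanSpace.single j 1)

/-- The density `√(det g)` of the Riemannian volume `dv_g` with respect to `dx`. -/
def volDensity {n : ℕ} (g : E n → Matrix (Fin n) (Fin n) ℝ) (x : E n) : ℝ :=
  Real.sqrt (g x).det

/-- The Laplace–Beltrami operator
`Δ_g f = (det g)^{-1/2} ∑ⱼ ∂ⱼ ((det g)^{1/2} ∑ₖ g^{jk} ∂ₖ f)`, with `(g^{jk})` the inverse of
`(g_{jk})`. -/
def laplaceBeltrami {n : ℕ} (g : E n → Matrix (Fin n) (Fin n) ℝ) (f : E n → ℝ) (x : E n) : ℝ :=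
  (volDensity g x)⁻¹ * ∑ j, partialDeriv j
    (fun y => volDensity g y * ∑ k, (g y)⁻¹ j k * partialDeriv k f y) x

/-- Hypothesis (H): for some `λ, c > 0` the equation `Δ_g φ = λ² φ` has a nontrivial entire
solution with `0 ≤ φ(x) ≤ c ⟨λ r⟩^{-(n-1)/2} exp (λ ∫₀ʳ K)`. -/
def HypothesisH {n : ℕ} (K : ℝ → ℝ) (g : E n → Matrix (Fin n) (Fin n) ℝ) : Prop :=
  ∃ (lam c : ℝ) (φ : E n → ℝ), 0 < lam ∧ 0 < c ∧ ContDiff ℝ 2 φ ∧ φ ≠ 0 ∧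
    (∀ x, laplaceBeltrami g φ x = lam ^ 2 * φ x) ∧
    ∀ x, 0 ≤ φ x ∧
      φ x ≤ c * bracket (lam * ‖x‖) ^ (-(((n : ℝ) - 1) / 2)) * Real.exp (lam * arcLength K ‖x‖)

/-- Test functions `ψ ∈ C₀^∞(ℝⁿ)`. -/
def IsTest {n : ℕ} (ψ : E n → ℝ) : Prop := ContDiff ℝ ∞ ψ ∧ HasCompactSupport ψ

/-- The pairing `⟨f, ψ⟩ = ∫ f ψ dv_g`. -/
def pairing {n : ℕ} (g : E n → Matrix (Fin n) (Fin n) ℝ) (f ψ : E n → ℝ) : ℝ :=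
  ∫ x, f x * ψ x * volDensity g x

/-- The time interval `[0, T)`, where `T ∈ (0, ∞]`. -/
def timeInterval (T : EReal) : Set ℝ := {t : ℝ | 0 ≤ t ∧ (t : EReal) < T}

/-- `u` is a weak solution on `[0, T) × ℝⁿ` of
`u_tt - Δ_g u + b(t) u_t = c₁ |u_t|ᵖ + c₂ |u|^q`, `u(0) = f₀`, `u_t(0) = f₁`,
in the class `u ∈ C²([0, T); 𝒟')`, `u_t ∈ L^p_loc([0, T) × ℝⁿ)`, `|u|^q ∈ C([0, T); 𝒟')`.
The function `v` is the representative of `u_t` in `L^p_loc`. Regularity in time of a curve in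
`𝒟'(ℝⁿ)` is regularity of all its pairings with test functions. -/
structure IsWeakSolution {n : ℕ} (g : E n → Matrix (Fin n) (Fin n) ℝ) (b : ℝ → ℝ)
    (c₁ c₂ p q : ℝ) (f₀ f₁ : E n → ℝ) (T : EReal) (u v : ℝ → E n → ℝ) : Prop where
  pos : 0 < T
  meas : ∀ t ∈ timeInterval T, AEStronglyMeasurable (u t) volume
  powLocInt : ∀ t ∈ timeInterval T, LocallyIntegrable (fun x => |u t x| ^ q) volume
  contDiff : ∀ ψ, IsTest ψ → ContDiffOn ℝ 2 (fun t => pairing g (u t) ψ) (timeInterval T)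
  powCont : ∀ ψ, IsTest ψ →
    ContinuousOn (fun t => pairing g (fun x => |u t x| ^ q) ψ) (timeInterval T)
  memLp : ∀ t ∈ timeInterval T, ∀ R : ℝ, MemLp (fun z : ℝ × E n => v z.1 z.2) (ENNReal.ofReal p)
    (volume.restrict (Set.Icc 0 t ×ˢ Metric.closedBall 0 R))
  timeDeriv : ∀ ψ, IsTest ψ → ∀ᵐ t : ℝ, t ∈ timeInterval T →
    derivWithin (fun s => pairing g (u s) ψ) (timeInterval T) t = pairing g (v t) ψ
  equation : ∀ ψ, IsTest ψ → ∀ᵐ t : ℝ, t ∈ timeInterval T →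
    iteratedDerivWithin 2 (fun s => pairing g (u s) ψ) (timeInterval T) t
        - pairing g (u t) (laplaceBeltrami g ψ)
        + b t * derivWithin (fun s => pairing g (u s) ψ) (timeInterval T) t
      = c₁ * pairing g (fun x => |v t x| ^ p) ψ + c₂ * pairing g (fun x => |u t x| ^ q) ψ
  initialValue : u 0 =ᵐ[volume] f₀
  initialVelocity : ∀ ψ, IsTest ψ →
    derivWithin (fun s => pairing g (u s) ψ) (timeInterval T) 0 = pairing g f₁ ψ

/-- Finite speed of propagation: `supp u ⊂ {(t, x) : ∫₀ʳ K ≤ t + R₁}`. -/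
def FiniteSpeed {n : ℕ} (K : ℝ → ℝ) (R₁ : ℝ) (T : EReal) (u : ℝ → E n → ℝ) : Prop :=
  ∀ t ∈ timeInterval T, ∀ᵐ x : E n, t + R₁ < arcLength K ‖x‖ → u t x = 0

/-- The Glassey exponent `p_G(n) = 1 + 2 / (n - 1)`. -/
def glasseyExponent (n : ℕ) : ℝ := 1 + 2 / ((n : ℝ) - 1)

/-- The Strauss exponent `p_S(n)`, the positive root of `(n - 1) q² - (n + 1) q - 2 = 0`. -/
def straussExponent (n : ℕ) : ℝ :=
  ((n : ℝ) + 1 + Real.sqrt (((n : ℝ) + 1) ^ 2 + 8 * ((n : ℝ) - 1))) / (2 * ((n : ℝ) - 1))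

theorem straussExponent_iff {n : ℕ} (hn : 2 ≤ n) (x : ℝ) :
    x = straussExponent n ↔
      0 < x ∧ ((n : ℝ) - 1) * x ^ 2 - ((n : ℝ) + 1) * x - 2 = 0 := by
  have h2 : (2 : ℝ) ≤ n := by exact_mod_cast hn
  have ha : (0 : ℝ) < (n : ℝ) - 1 := by linarith
  set s := Real.sqrt (((n : ℝ) + 1) ^ 2 + 8 * ((n : ℝ) - 1)) with hs
  have hs0 : 0 ≤ s := Real.sqrt_nonneg _
  have hsq : s ^ 2 = ((n : ℝ) + 1) ^ 2 + 8 * ((n : ℝ) - 1) := Real.sq_sqrt (by positivity)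
  have hlt : (n : ℝ) + 1 < s := by nlinarith
  have key : x = straussExponent n ↔ 2 * ((n : ℝ) - 1) * x = (n : ℝ) + 1 + s := by
    unfold straussExponent
    rw [← hs, eq_div_iff (by positivity), mul_comm]
  rw [key]
  constructor
  · intro h
    refine ⟨by nlinarith, ?_⟩
    have h' : (2 * ((n : ℝ) - 1) * x - ((n : ℝ) + 1)) ^ 2 = s ^ 2 := by rw [h]; ring
    have : ((n : ℝ) - 1) * (((n : ℝ) - 1) * x ^ 2 - ((n : ℝ) + 1) * x - 2) = 0 := by
      nlinarith
    exact (mul_eq_zero.mp this).resolve_left ha.ne'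
  · rintro ⟨hx, h⟩
    have h' : (2 * ((n : ℝ) - 1) * x - ((n : ℝ) + 1) - s)
        * (2 * ((n : ℝ) - 1) * x - ((n : ℝ) + 1) + s) = 0 := by
      have : 4 * ((n : ℝ) - 1) * (((n : ℝ) - 1) * x ^ 2 - ((n : ℝ) + 1) * x - 2) = 0 := by
        rw [h]; ring
      nlinarith
    rcases mul_eq_zero.mp h' with h1 | h1
    · linarith
    · have : 0 < 2 * ((n : ℝ) - 1) * x := by positivity
      linarith

end

end BlowUpAE

open BlowUpAE

namespace BlowUpAE

noncomputable section

open Set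

/-! ### Absolutely continuous functions on an interval -/

/-! Let φ be the eigenfunction in (H), with eigenvalue λ². Pairing the equation with φ and with the
constant 1 reduces it to two scalar problems. H = ⟨u, φ⟩ solves H'' + bH' = λ²H + N, and F = ⟨u, 1⟩
solves F'' + bF' = M, where N and M are the pairings of the nonlinearity with φ and 1. Finite speed
of propagation confines u to a cone. On its time slices ∫ φ^s dv_g ≲ t^((n-1)(1-s/2)) e^(sλt),
because φ^s is concentrated in a shell of bounded width at the edge. Hölder's inequality then bounds
N and M from below by powers of |H'|, |H| and |F| (`exists_reducedSystem`); the rest is about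
ordinary differential inequalities.

The damping has no sign, but exp(∫b) stays between two positive constants. Hence H and H' remain
nonnegative (`nonneg_fst`, `nonneg_snd`), the growing mode H' + λH is bounded below by a multiple of
e^(λt) J(t) with J(t) = H'(0) + λH(0) + ∫₀ᵗ e^(-λs) N(s) ds (`lower_bound_sum`), and after a fixed
time H' carries a quarter of that mode (`exists_velocity_bound`). The strong maximum principle makes
φ positive everywhere, so H'(0) + λH(0) is ε times a positive number.

Case 1: Hölder gives J' ≳ t^(-(n-1)(p-1)/2) J^p. Integrating, ∫ t^(-(n-1)(p-1)/2) dt ≲ ε^(1-p),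
which is a power bound below the Glassey exponent and a logarithmic one at it.

Cases 2 to 4: Hölder gives M ≳ t^(-n(q-1)) F^q, and there is an a priori growth F ≳ X t^a. From
|H'|^p one gets X = ε^p, a = (n-1)(1-p/2) + 2; from |H|^q the same with q for p; and from F'(0) > 0
alone X = ε, a = 1. The blow-up criterion `DampedODE.exists_blowup_bound` on [S/2, S] turns this
into X^(q-1) S^(2+(a-n)(q-1)) ≲ 1, whose exponents are those of the theorem.

Two points of regularity shape the argument. The forcing is only integrable in time, so every
comparison is made for absolutely continuous functions with derivatives almost everywhere. And φ is
only C², so the tested equation is first put in integrated form and then extended from smooth test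
functions by mollification (`testedIdentity_of_contDiff`). -/

theorem ac_comp {f F : ℝ → ℝ} {a b : ℝ} {U : Set ℝ}
    (hf : AbsolutelyContinuousOnInterval f a b) (hF : ContDiffOn ℝ 1 F U)
    (hU : ∀ t ∈ uIcc a b, f t ∈ U) :
    AbsolutelyContinuousOnInterval (fun t => F (f t)) a b := by
  have himg : f '' uIcc a b ⊆ U := by
    rintro _ ⟨t, ht, rfl⟩; exact hU t ht
  have hcomp : IsCompact (f '' uIcc a b) := isCompact_uIcc.image_of_continuousOn hf.continuousOn
  have hconv : Convex ℝ (f '' uIcc a b) :=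
    ((isPreconnected_uIcc.image f hf.continuousOn).ordConnected).convex
  obtain ⟨L, hL⟩ := (hF.mono himg).exists_lipschitzOnWith (by decide) hconv hcomp
  rw [absolutelyContinuousOnInterval_iff] at hf ⊢
  intro ε hε
  obtain ⟨δ, hδ, h⟩ := hf (ε / (L + 1)) (by positivity)
  refine ⟨δ, hδ, fun I hI hlt => ?_⟩
  have h1 := h I hI hlt
  have hsum : ∑ i ∈ Finset.range I.1, dist (F (f (I.2 i).1)) (F (f (I.2 i).2)) ≤
      ∑ i ∈ Finset.range I.1, L * dist (f (I.2 i).1) (f (I.2 i).2) := by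
    refine Finset.sum_le_sum fun i hi => ?_
    have := hI.1 i hi
    exact hL.dist_le_mul _ ⟨_, this.1, rfl⟩ _ ⟨_, this.2, rfl⟩
  rw [← Finset.mul_sum] at hsum
  have hL0 : (0 : ℝ) ≤ L := L.2
  have h2 : (L : ℝ) * ∑ i ∈ Finset.range I.1, dist (f (I.2 i).1) (f (I.2 i).2) ≤
      L * (ε / (L + 1)) := mul_le_mul_of_nonneg_left h1.le hL0
  have h3 : (L : ℝ) * (ε / (L + 1)) < ε := by
    rw [mul_div_assoc', div_lt_iff₀ (by positivity)]; nlinarith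
  linarith

/-- Replaces the mean value theorem throughout: the sign of the derivative is known only for almost
every time, and absolute continuity is what still makes the function the integral of its derivative.
-/
theorem ac_le_of_deriv_nonneg {f f' : ℝ → ℝ} {a b : ℝ} (hab : a ≤ b)
    (hf : AbsolutelyContinuousOnInterval f a b)
    (hd : ∀ᵐ t, t ∈ Icc a b → HasDerivAt f (f' t) t)
    (h0 : ∀ᵐ t, t ∈ Icc a b → 0 ≤ f' t) : f a ≤ f b := by
  have h := hf.integral_deriv_eq_sub
  have : 0 ≤ ∫ x in a..b, deriv f x := by
    rw [intervalIntegral.integral_of_le hab]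
    refine setIntegral_nonneg_of_ae_restrict ?_
    rw [Filter.EventuallyLE, ae_restrict_iff' measurableSet_Ioc]
    filter_upwards [hd, h0] with t h1 h2 ht
    rw [(h1 (Ioc_subset_Icc_self ht)).deriv]
    exact h2 (Ioc_subset_Icc_self ht)
  linarith

theorem ac_monotoneOn {f f' : ℝ → ℝ} {a b : ℝ}
    (hf : AbsolutelyContinuousOnInterval f a b)
    (hd : ∀ᵐ t, t ∈ Icc a b → HasDerivAt f (f' t) t)
    (h0 : ∀ᵐ t, t ∈ Icc a b → 0 ≤ f' t) : MonotoneOn f (Icc a b) := by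
  intro x hx y hy hxy
  have hsub : Icc x y ⊆ Icc a b := Icc_subset_Icc hx.1 hy.2
  refine ac_le_of_deriv_nonneg (f' := f') hxy (hf.mono ?_) ?_ ?_
  · rwa [uIcc_of_le hxy, uIcc_of_le (hx.1.trans (hxy.trans hy.2))]
  · filter_upwards [hd] with t h ht using h (hsub ht)
  · filter_upwards [h0] with t h ht using h (hsub ht)

theorem ae_hasDerivAt_primitive {f : ℝ → ℝ} {a b : ℝ} (hab : a ≤ b)
    (hf : IntervalIntegrable f volume a b) :
    ∀ᵐ t, t ∈ Icc a b → HasDerivAt (fun t => ∫ s in a..t, f s) (f t) t := by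
  have := hf.ae_hasDerivAt_integral
  rw [uIcc_of_le hab] at this
  filter_upwards [this] with t h ht
  exact h ht a ⟨le_rfl, hab⟩

theorem ac_primitive {f : ℝ → ℝ} {a b : ℝ}
    (hf : IntervalIntegrable f volume a b) :
    AbsolutelyContinuousOnInterval (fun t => ∫ s in a..t, f s) a b :=
  hf.absolutelyContinuousOnInterval_intervalIntegral (by simp)

theorem ac_of_contDiff {f : ℝ → ℝ} (hf : ContDiff ℝ 1 f) (a b : ℝ) :
    AbsolutelyContinuousOnInterval f a b :=
  hf.contDiffOn.absolutelyContinuousOnInterval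

/-! ### The integrating factor of the damping -/

/-- The integrating factor `exp (∫₀ᵗ b)`. -/
def damp (b : ℝ → ℝ) (t : ℝ) : ℝ := Real.exp (∫ s in (0 : ℝ)..t, b s)

/-- The total mass `∫₀^∞ |b|` of the damping. -/
def dampMass (b : ℝ → ℝ) : ℝ := ∫ s in Ioi (0 : ℝ), |b s|

theorem damp_pos (b : ℝ → ℝ) (t : ℝ) : 0 < damp b t := Real.exp_pos _

theorem damp_zero (b : ℝ → ℝ) : damp b 0 = 1 := by simp [damp]

variable {b : ℝ → ℝ}

theorem intervalIntegrable_of_Ioi (hb : IntegrableOn b (Ioi 0)) {s t : ℝ} (hs : 0 ≤ s)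
    (ht : 0 ≤ t) : IntervalIntegrable b volume s t := by
  rw [intervalIntegrable_iff]
  refine hb.mono_set fun x hx => ?_
  rcases le_total s t with h | h
  · rw [uIoc_of_le h] at hx; exact hs.trans_lt hx.1
  · rw [uIoc_of_ge h] at hx; exact ht.trans_lt hx.1

theorem abs_integral_le_dampMass (hb : IntegrableOn b (Ioi 0)) {t : ℝ} (ht : 0 ≤ t) :
    |∫ s in (0 : ℝ)..t, b s| ≤ dampMass b := by
  calc |∫ s in (0 : ℝ)..t, b s| ≤ ∫ s in (0 : ℝ)..t, |b s| :=
        intervalIntegral.abs_integral_le_integral_abs ht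
    _ = ∫ s in Ioc 0 t, |b s| := intervalIntegral.integral_of_le ht
    _ ≤ dampMass b := setIntegral_mono_set hb.abs
        (Filter.Eventually.of_forall fun _ => abs_nonneg _)
        (Filter.Eventually.of_forall Ioc_subset_Ioi_self)

theorem damp_le (hb : IntegrableOn b (Ioi 0)) {t : ℝ} (ht : 0 ≤ t) :
    damp b t ≤ Real.exp (dampMass b) :=
  Real.exp_le_exp.2 ((le_abs_self _).trans (abs_integral_le_dampMass hb ht))

theorem le_damp (hb : IntegrableOn b (Ioi 0)) {t : ℝ} (ht : 0 ≤ t) :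
    Real.exp (-dampMass b) ≤ damp b t :=
  Real.exp_le_exp.2 (neg_le_of_abs_le (abs_integral_le_dampMass hb ht))

theorem ac_damp (hb : IntegrableOn b (Ioi 0)) {S : ℝ} (hS : 0 ≤ S) :
    AbsolutelyContinuousOnInterval (damp b) 0 S :=
  ac_comp (f := fun t => ∫ s in (0 : ℝ)..t, b s) (F := Real.exp)
    (ac_primitive (intervalIntegrable_of_Ioi hb le_rfl hS))
    (Real.contDiff_exp.contDiffOn (s := univ)) (fun _ _ => mem_univ _)

theorem ae_hasDerivAt_damp (hb : IntegrableOn b (Ioi 0)) {S : ℝ} (hS : 0 ≤ S) :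
    ∀ᵐ t, t ∈ Icc 0 S → HasDerivAt (damp b) (damp b t * b t) t := by
  filter_upwards [ae_hasDerivAt_primitive hS (intervalIntegrable_of_Ioi hb le_rfl hS)] with t h ht
  exact (h ht).exp

/-! ### Damped linear ordinary differential inequalities -/

/-- `H` and `D` are absolutely continuous on `[0, S]` and solve `H' = D`, `D' = μ H - b D + N` with
a nonnegative source `N`. -/
structure DampedODE (b : ℝ → ℝ) (μ : ℝ) (N H D : ℝ → ℝ) (S : ℝ) : Prop where
  ac_fst : AbsolutelyContinuousOnInterval H 0 S
  ac_snd : AbsolutelyContinuousOnInterval D 0 S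
  deriv_fst : ∀ᵐ t, t ∈ Icc 0 S → HasDerivAt H (D t) t
  deriv_snd : ∀ᵐ t, t ∈ Icc 0 S → HasDerivAt D (μ * H t - b t * D t + N t) t
  source_nonneg : ∀ᵐ t, t ∈ Icc 0 S → 0 ≤ N t

namespace DampedODE

variable {μ S : ℝ} {N H D : ℝ → ℝ}

theorem mono (h : DampedODE b μ N H D S) {S' : ℝ} (h0 : 0 ≤ S') (hS : S' ≤ S) :
    DampedODE b μ N H D S' := by
  have hsub : Icc 0 S' ⊆ Icc 0 S := Icc_subset_Icc le_rfl hS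
  have hsub' : uIcc 0 S' ⊆ uIcc 0 S := by
    rwa [uIcc_of_le h0, uIcc_of_le (h0.trans hS)]
  refine ⟨h.ac_fst.mono hsub', h.ac_snd.mono hsub', ?_, ?_, ?_⟩
  · filter_upwards [h.deriv_fst] with t h ht using h (hsub ht)
  · filter_upwards [h.deriv_snd] with t h ht using h (hsub ht)
  · filter_upwards [h.source_nonneg] with t h ht using h (hsub ht)

theorem intervalIntegrable_source (h : DampedODE b μ N H D S) (hb : IntegrableOn b (Ioi 0))
    (hS : 0 ≤ S) : IntervalIntegrable N volume 0 S := by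
  have h1 := h.ac_snd.intervalIntegrable_deriv
  have h2 : IntervalIntegrable (fun t => μ * H t) volume 0 S :=
    (h.ac_fst.continuousOn.intervalIntegrable).const_mul μ
  have h3 : IntervalIntegrable (fun t => b t * D t) volume 0 S :=
    (intervalIntegrable_of_Ioi hb le_rfl hS).mul_continuousOn h.ac_snd.continuousOn
  refine ((h1.sub h2).add h3).congr_ae ?_
  rw [Filter.EventuallyEq, ae_restrict_iff' measurableSet_uIoc, uIoc_of_le hS]
  filter_upwards [h.deriv_snd] with t ht hts
  change deriv D t - μ * H t + b t * D t = N t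
  rw [(ht (Ioc_subset_Icc_self hts)).deriv]; ring

/-- The weighted velocity `exp (∫ b) D`. -/
theorem deriv_weighted (h : DampedODE b μ N H D S) (hb : IntegrableOn b (Ioi 0)) (hS : 0 ≤ S) :
    ∀ᵐ t, t ∈ Icc 0 S →
      HasDerivAt (fun t => damp b t * D t) (damp b t * (μ * H t + N t)) t := by
  filter_upwards [h.deriv_snd, ae_hasDerivAt_damp hb hS] with t h1 h2 ht
  exact ((h2 ht).mul (h1 ht)).congr_deriv (by ring)

theorem ac_weighted (h : DampedODE b μ N H D S) (hb : IntegrableOn b (Ioi 0)) (hS : 0 ≤ S) :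
    AbsolutelyContinuousOnInterval (fun t => damp b t * D t) 0 S :=
  (ac_damp hb hS).fun_mul h.ac_snd

/-- A Gronwall argument for the negative part of H. With Z the integral of that negative part, the
weighted velocity, then the velocity, then H are bounded below by negative multiples of Z, because
the source only helps. So Z' ≤ C Z with Z(0) = 0, and Z vanishes. -/
theorem nonneg_fst (h : DampedODE b μ N H D S) (hb : IntegrableOn b (Ioi 0)) (hμ : 0 ≤ μ)
    (hS : 0 ≤ S) (hH0 : 0 ≤ H 0) (hD0 : 0 ≤ D 0) : ∀ t ∈ Icc 0 S, 0 ≤ H t := by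
  set M := Real.exp (dampMass b) with hM
  have hM0 : 0 < M := Real.exp_pos _
  have hMinv : Real.exp (-dampMass b) = M⁻¹ := by rw [Real.exp_neg]
  set n : ℝ → ℝ := fun t => max (-H t) 0 with hn
  have hn0 : ∀ t, 0 ≤ n t := fun t => le_max_right _ _
  have hnH : ∀ t, -H t ≤ n t := fun t => le_max_left _ _
  have hHc : ContinuousOn H (Icc 0 S) := by
    have := h.ac_fst.continuousOn; rwa [uIcc_of_le hS] at this
  have hnc : ContinuousOn n (Icc 0 S) := (hHc.neg).sup continuousOn_const
  have hni : IntervalIntegrable n volume 0 S := by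
    apply ContinuousOn.intervalIntegrable; rwa [uIcc_of_le hS]
  set Z : ℝ → ℝ := fun t => ∫ s in (0 : ℝ)..t, n s with hZ
  have hZac : AbsolutelyContinuousOnInterval Z 0 S := ac_primitive hni
  have hZd : ∀ᵐ t, t ∈ Icc 0 S → HasDerivAt Z (n t) t := ae_hasDerivAt_primitive hS hni
  have hZmono : MonotoneOn Z (Icc 0 S) :=
    ac_monotoneOn hZac hZd (Filter.Eventually.of_forall fun t _ => hn0 t)
  have hZ0 : Z 0 = 0 := by simp [hZ]
  have hZnn : ∀ t ∈ Icc 0 S, 0 ≤ Z t := fun t ht => by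
    rw [← hZ0]; exact hZmono ⟨le_rfl, hS⟩ ht ht.1
  have hP : ∀ t ∈ Icc 0 S, -(M * μ) * Z t ≤ damp b t * D t := by
    have hmono : MonotoneOn (fun t => damp b t * D t + (M * μ) * Z t) (Icc 0 S) := by
      refine ac_monotoneOn (f' := fun t => damp b t * (μ * H t + N t) + (M * μ) * n t)
        ((h.ac_weighted hb hS).fun_add (hZac.const_mul _)) ?_ ?_
      · filter_upwards [h.deriv_weighted hb hS, hZd] with t h1 h2 ht
        exact (h1 ht).add ((h2 ht).const_mul _)
      · filter_upwards [h.source_nonneg] with t h1 ht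
        have e1 : damp b t * n t ≤ M * n t :=
          mul_le_mul_of_nonneg_right (damp_le hb ht.1) (hn0 t)
        have e2 : damp b t * (-H t) ≤ damp b t * n t :=
          mul_le_mul_of_nonneg_left (hnH t) (damp_pos b t).le
        have e3 : 0 ≤ damp b t * N t := mul_nonneg (damp_pos b t).le (h1 ht)
        have e4 := mul_le_mul_of_nonneg_left (e2.trans e1) hμ
        nlinarith
    intro t ht
    have := hmono ⟨le_rfl, hS⟩ ht ht.1
    simp only [hZ0, damp_zero] at this
    linarith
  have hDlow : ∀ t ∈ Icc 0 S, -(M * M * μ) * Z t ≤ D t := by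
    intro t ht
    have h1 := hP t ht
    have h2 := le_damp hb ht.1
    have h3 := hZnn t ht
    by_contra hc
    push Not at hc
    have hdpos := damp_pos b t
    rw [hMinv] at h2
    have h4 : 1 ≤ M * damp b t := by
      rw [← mul_inv_cancel₀ hM0.ne']; exact mul_le_mul_of_nonneg_left h2 hM0.le
    have h5 : damp b t * D t < damp b t * (-(M * M * μ) * Z t) :=
      mul_lt_mul_of_pos_left hc hdpos
    have h6 : 0 ≤ M * μ * Z t := by positivity
    nlinarith [mul_le_mul_of_nonneg_right h4 h6]
  have hHlow : ∀ t ∈ Icc 0 S, -(M * M * μ * S) * Z t ≤ H t := by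
    intro t ht
    have hmono : MonotoneOn (fun s => H s + (M * M * μ * Z t) * s) (Icc 0 t) := by
      have h' := h.mono ht.1 ht.2
      refine ac_monotoneOn (f' := fun s => D s + (M * M * μ * Z t) * 1)
        (h'.ac_fst.fun_add ((ac_of_contDiff contDiff_id _ _).const_mul _)) ?_ ?_
      · filter_upwards [h'.deriv_fst] with s h1 hs
        exact (h1 hs).add ((hasDerivAt_id s).const_mul _)
      · refine Filter.Eventually.of_forall fun s hs => ?_
        have hs' : s ∈ Icc 0 S := ⟨hs.1, hs.2.trans ht.2⟩
        have e1 := hDlow s hs'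
        have e2 : M * M * μ * Z s ≤ M * M * μ * Z t :=
          mul_le_mul_of_nonneg_left (hZmono hs' ht hs.2) (by positivity)
        linarith
    have e := hmono ⟨le_rfl, ht.1⟩ ⟨ht.1, le_rfl⟩ ht.1
    simp only [mul_zero, add_zero] at e
    have e3 : M * M * μ * Z t * t ≤ M * M * μ * Z t * S :=
      mul_le_mul_of_nonneg_left ht.2 (mul_nonneg (by positivity) (hZnn t ht))
    nlinarith
  set C := M * M * μ * S with hC
  have hC0 : 0 ≤ C := by positivity
  have hnZ : ∀ t ∈ Icc 0 S, n t ≤ C * Z t := by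
    intro t ht
    refine max_le ?_ (mul_nonneg hC0 (hZnn t ht))
    linarith [hHlow t ht]
  have hexp : ContDiff ℝ 1 (fun t : ℝ => -Real.exp (-C * t)) := by fun_prop
  -- Gronwall in monotone form: e^(-Ct) Z is nonincreasing and starts at 0.
  have hgr : MonotoneOn (fun t => (-Real.exp (-C * t)) * Z t) (Icc 0 S) := by
    refine ac_monotoneOn
      (f' := fun t => (-(Real.exp (-C * t) * (-C * 1))) * Z t + (-Real.exp (-C * t)) * n t)
      ((ac_of_contDiff hexp _ _).fun_mul hZac) ?_ ?_
    · filter_upwards [hZd] with t h2 ht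
      exact ((((hasDerivAt_id t).const_mul (-C)).exp).neg).mul (h2 ht)
    · refine Filter.Eventually.of_forall fun t ht => ?_
      have := mul_le_mul_of_nonneg_left (hnZ t ht) (Real.exp_pos (-C * t)).le
      nlinarith
  intro t ht
  have e := hgr ⟨le_rfl, hS⟩ ht ht.1
  simp only [hZ0, mul_zero] at e
  have hZt : Z t = 0 := by
    have := Real.exp_pos (-C * t)
    have h2 := hZnn t ht
    nlinarith
  have := hnZ t ht
  rw [hZt, mul_zero] at this
  linarith [hnH t]

/-- Once H is nonnegative, the weighted velocity exp(∫b) D has a nonnegative derivative. -/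
theorem nonneg_snd (h : DampedODE b μ N H D S) (hb : IntegrableOn b (Ioi 0)) (hμ : 0 ≤ μ)
    (hS : 0 ≤ S) (hH0 : 0 ≤ H 0) (hD0 : 0 ≤ D 0) : ∀ t ∈ Icc 0 S, 0 ≤ D t := by
  have hH := h.nonneg_fst hb hμ hS hH0 hD0
  have hmono : MonotoneOn (fun t => damp b t * D t) (Icc 0 S) := by
    refine ac_monotoneOn (h.ac_weighted hb hS) (h.deriv_weighted hb hS) ?_
    filter_upwards [h.source_nonneg] with t h1 ht
    exact mul_nonneg (damp_pos b t).le (add_nonneg (mul_nonneg hμ (hH t ht)) (h1 ht))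
  intro t ht
  have e := hmono ⟨le_rfl, hS⟩ ht ht.1
  simp only [damp_zero, one_mul] at e
  exact (mul_nonneg_iff_of_pos_left (damp_pos b t)).1 (hD0.trans e)

theorem monotoneOn_fst (h : DampedODE b μ N H D S) (hb : IntegrableOn b (Ioi 0)) (hμ : 0 ≤ μ)
    (hS : 0 ≤ S) (hH0 : 0 ≤ H 0) (hD0 : 0 ≤ D 0) : MonotoneOn H (Icc 0 S) :=
  ac_monotoneOn h.ac_fst h.deriv_fst
    (Filter.Eventually.of_forall fun t ht => h.nonneg_snd hb hμ hS hH0 hD0 t ht)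

end DampedODE

end

end BlowUpAE

namespace BlowUpAE

noncomputable section

open Set

variable {b : ℝ → ℝ}

/-! ### Exponential growth along a positive eigenvalue -/

/-- This quantity measures how much of the decaying mode e^(-lt) the damping can still excite at
time t. Dominated convergence, with majorant |b|, shows that it dies out. -/
theorem tendsto_exp_weighted_damping (hb : IntegrableOn b (Ioi 0)) {l : ℝ} (hl : 0 < l) :
    Filter.Tendsto (fun t => Real.exp (-(2 * l) * t) +
      ∫ s in (0 : ℝ)..t, Real.exp (-(2 * l) * (t - s)) * |b s|) Filter.atTop (nhds 0) := by
  have hexp : Filter.Tendsto (fun t : ℝ => Real.exp (-(2 * l) * t)) Filter.atTop (nhds 0) :=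
    Real.tendsto_exp_atBot.comp
      (Filter.tendsto_id.const_mul_atTop_of_neg (by linarith))
  have hint : Filter.Tendsto (fun t : ℝ => ∫ s in Ioi (0 : ℝ),
      (Iic t).indicator (fun s => Real.exp (-(2 * l) * (t - s)) * |b s|) s) Filter.atTop
      (nhds (∫ _ in Ioi (0 : ℝ), (0 : ℝ))) := by
    refine tendsto_integral_filter_of_dominated_convergence (fun s => |b s|) ?_ ?_ hb.abs ?_
    · refine Filter.Eventually.of_forall fun t => ?_
      refine AEStronglyMeasurable.indicator ?_ measurableSet_Iic
      exact (Continuous.aestronglyMeasurable (by fun_prop)).mul hb.abs.aestronglyMeasurable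
    · refine Filter.Eventually.of_forall fun t => Filter.Eventually.of_forall fun s => ?_
      by_cases hs : s ∈ Iic t
      · rw [indicator_of_mem hs, Real.norm_eq_abs, abs_of_nonneg (by positivity)]
        have : Real.exp (-(2 * l) * (t - s)) ≤ 1 := by
          rw [Real.exp_le_one_iff]
          have : 0 ≤ t - s := sub_nonneg.2 hs
          nlinarith
        exact mul_le_of_le_one_left (abs_nonneg _) this
      · rw [indicator_of_notMem hs]; simp
    · refine Filter.Eventually.of_forall fun s => ?_
      have h1 : Filter.Tendsto (fun t : ℝ => Real.exp (2 * l * s) * |b s| * Real.exp (-(2 * l) * t))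
          Filter.atTop (nhds (Real.exp (2 * l * s) * |b s| * 0)) := hexp.const_mul _
      rw [mul_zero] at h1
      refine h1.congr' ?_
      filter_upwards [Filter.eventually_ge_atTop s] with t ht
      rw [indicator_of_mem (show s ∈ Iic t from ht),
        show -(2 * l) * (t - s) = 2 * l * s + -(2 * l) * t by ring, Real.exp_add]
      ring
  simp only [integral_zero] at hint
  have := hexp.add hint
  rw [add_zero] at this
  refine this.congr' ?_
  filter_upwards [Filter.eventually_ge_atTop 0] with t ht
  rw [intervalIntegral.integral_of_le ht, setIntegral_indicator measurableSet_Iic,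
    Ioi_inter_Iic]

namespace DampedODE

variable {S l : ℝ} {N H D : ℝ → ℝ}

/-- The growing mode W = D + lH satisfies (e^(-lt) W)' = e^(-lt) (N - bD). Since D and lH are
nonnegative, |bD| ≤ |b| W, so the factor exp(∫|b|) absorbs the damping whatever its sign. -/
theorem monotoneOn_exp_weighted (h : DampedODE b (l ^ 2) N H D S) (hb : IntegrableOn b (Ioi 0))
    (hl : 0 < l) (hS : 0 ≤ S) (hH0 : 0 ≤ H 0) (hD0 : 0 ≤ D 0) :
    MonotoneOn (fun t => damp (fun s => |b s|) t * (Real.exp (-l * t) * (D t + l * H t)) -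
      ∫ s in (0 : ℝ)..t, Real.exp (-l * s) * N s) (Icc 0 S) := by
  have hba : IntegrableOn (fun s => |b s|) (Ioi 0) := hb.abs
  have hH := h.nonneg_fst hb (sq_nonneg l) hS hH0 hD0
  have hD := h.nonneg_snd hb (sq_nonneg l) hS hH0 hD0
  have hexp : ContDiff ℝ 1 (fun t : ℝ => Real.exp (-l * t)) := by fun_prop
  have hNi : IntervalIntegrable (fun s => Real.exp (-l * s) * N s) volume 0 S :=
    (h.intervalIntegrable_source hb hS).continuousOn_mul hexp.continuous.continuousOn
  refine ac_monotoneOn (f' := fun t =>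
    (damp (fun s => |b s|) t * |b t|) * (Real.exp (-l * t) * (D t + l * H t)) +
      damp (fun s => |b s|) t * ((Real.exp (-l * t) * (-l * 1)) * (D t + l * H t) +
        Real.exp (-l * t) * ((l ^ 2 * H t - b t * D t + N t) + l * D t)) -
      Real.exp (-l * t) * N t)
    (((ac_damp hba hS).fun_mul ((ac_of_contDiff hexp _ _).fun_mul
      (h.ac_snd.fun_add (h.ac_fst.const_mul l)))).fun_sub (ac_primitive hNi)) ?_ ?_
  · filter_upwards [h.deriv_fst, h.deriv_snd, ae_hasDerivAt_damp hba hS,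
      ae_hasDerivAt_primitive hS hNi] with t h1 h2 h3 h4 ht
    exact ((h3 ht).mul ((((hasDerivAt_id t).const_mul (-l)).exp).mul
      ((h2 ht).add ((h1 ht).const_mul l)))).sub (h4 ht)
  · filter_upwards [h.source_nonneg] with t h1 ht
    have hN := h1 ht
    have e1 : 1 ≤ damp (fun s => |b s|) t := by
      refine Real.one_le_exp (intervalIntegral.integral_nonneg ht.1 fun _ _ => abs_nonneg _)
    have e2 : 0 ≤ |b t| * (D t + l * H t) - b t * D t := by
      have a1 := hH t ht
      have a2 := hD t ht
      have a3 := le_abs_self (b t)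
      have a4 : 0 ≤ |b t| * (l * H t) := by positivity
      nlinarith [mul_le_mul_of_nonneg_right a3 a2]
    have e3 := Real.exp_pos (-l * t)
    have e4 : 0 ≤ damp (fun s => |b s|) t * Real.exp (-l * t) *
        (|b t| * (D t + l * H t) - b t * D t) := by
      have := damp_pos (fun s => |b s|) t
      positivity
    have e5 : 0 ≤ (damp (fun s => |b s|) t - 1) * (Real.exp (-l * t) * N t) :=
      mul_nonneg (by linarith) (by positivity)
    nlinarith

theorem lower_bound_sum (h : DampedODE b (l ^ 2) N H D S) (hb : IntegrableOn b (Ioi 0))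
    (hl : 0 < l) (hS : 0 ≤ S) (hH0 : 0 ≤ H 0) (hD0 : 0 ≤ D 0) {t : ℝ} (ht : t ∈ Icc 0 S) :
    D 0 + l * H 0 + ∫ s in (0 : ℝ)..t, Real.exp (-l * s) * N s ≤
      Real.exp (dampMass b) * (Real.exp (-l * t) * (D t + l * H t)) := by
  have hba : IntegrableOn (fun s => |b s|) (Ioi 0) := hb.abs
  have hH := h.nonneg_fst hb (sq_nonneg l) hS hH0 hD0
  have hD := h.nonneg_snd hb (sq_nonneg l) hS hH0 hD0
  have e := h.monotoneOn_exp_weighted hb hl hS hH0 hD0 ⟨le_rfl, hS⟩ ht ht.1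
  simp only [damp_zero, mul_zero, Real.exp_zero, one_mul, intervalIntegral.integral_same,
    sub_zero] at e
  have e2 : damp (fun s => |b s|) t ≤ Real.exp (dampMass b) := by
    have := damp_le hba ht.1
    simpa [dampMass] using this
  have e3 : 0 ≤ Real.exp (-l * t) * (D t + l * H t) := by
    have := hH t ht; have := hD t ht; positivity
  have := mul_le_mul_of_nonneg_right e2 e3
  linarith

/-- Bounds the growing mode at an earlier time by its later value, with the full exponential gain.
It is used to treat the damping term in the decaying mode as a perturbation. -/
theorem sum_le_sum (h : DampedODE b (l ^ 2) N H D S) (hb : IntegrableOn b (Ioi 0))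
    (hl : 0 < l) (hS : 0 ≤ S) (hH0 : 0 ≤ H 0) (hD0 : 0 ≤ D 0) {s t : ℝ} (hs : 0 ≤ s)
    (hst : s ≤ t) (ht : t ≤ S) :
    D s + l * H s ≤ Real.exp (dampMass b) * (Real.exp (-l * (t - s)) * (D t + l * H t)) := by
  have hba : IntegrableOn (fun s => |b s|) (Ioi 0) := hb.abs
  have hsI : s ∈ Icc 0 S := ⟨hs, hst.trans ht⟩
  have htI : t ∈ Icc 0 S := ⟨hs.trans hst, ht⟩
  have hH := h.nonneg_fst hb (sq_nonneg l) hS hH0 hD0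
  have hD := h.nonneg_snd hb (sq_nonneg l) hS hH0 hD0
  have e := h.monotoneOn_exp_weighted hb hl hS hH0 hD0 hsI htI hst
  simp only at e
  have hNi : IntervalIntegrable (fun s => Real.exp (-l * s) * N s) volume 0 S :=
    (h.intervalIntegrable_source hb hS).continuousOn_mul (by fun_prop)
  have eN : (∫ s in (0 : ℝ)..s, Real.exp (-l * s) * N s) ≤
      ∫ s in (0 : ℝ)..t, Real.exp (-l * s) * N s := by
    have := ac_monotoneOn (ac_primitive hNi) (ae_hasDerivAt_primitive hS hNi)
      (by filter_upwards [h.source_nonneg] with r hr hrI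
          exact mul_nonneg (Real.exp_pos _).le (hr hrI))
    exact this hsI htI hst
  have e1 : 1 ≤ damp (fun s => |b s|) s :=
    Real.one_le_exp (intervalIntegral.integral_nonneg hs fun _ _ => abs_nonneg _)
  have e2 : damp (fun s => |b s|) t ≤ Real.exp (dampMass b) := by
    have := damp_le hba htI.1
    simpa [dampMass] using this
  have w1 : 0 ≤ D s + l * H s := by have := hH s hsI; have := hD s hsI; positivity
  have w2 : 0 ≤ D t + l * H t := by have := hH t htI; have := hD t htI; positivity
  have e3 := mul_le_mul_of_nonneg_right e1 (mul_nonneg (Real.exp_pos (-l * s)).le w1)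
  have e4 := mul_le_mul_of_nonneg_right e2 (mul_nonneg (Real.exp_pos (-l * t)).le w2)
  have e5 : Real.exp (-l * s) * (D s + l * H s) ≤
      Real.exp (dampMass b) * (Real.exp (-l * t) * (D t + l * H t)) := by linarith
  have e6 := mul_le_mul_of_nonneg_left e5 (Real.exp_pos (l * s)).le
  rw [← mul_assoc, ← Real.exp_add, show l * s + -l * s = 0 by ring, Real.exp_zero, one_mul] at e6
  refine e6.trans (le_of_eq ?_)
  rw [show -l * (t - s) = l * s + -l * t by ring, Real.exp_add]
  ring

/-- After a time that depends only on the damping and the eigenvalue, the velocity carries a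
fixed proportion of the growing mode. -/
theorem exists_velocity_bound (hb : IntegrableOn b (Ioi 0)) (hl : 0 < l) :
    ∃ t₀ : ℝ, 1 ≤ t₀ ∧ ∀ (S : ℝ) (N H D : ℝ → ℝ), DampedODE b (l ^ 2) N H D S → 0 ≤ H 0 →
      0 ≤ D 0 → ∀ t, t₀ ≤ t → t ≤ S → (D t + l * H t) / 4 ≤ D t := by
  -- The threshold is chosen so that exp(∫|b|) times the excited decaying mode is at most 1/2; it
  -- depends on b and l only, not on the solution.
  have hsm := (tendsto_exp_weighted_damping hb hl).eventually
    (gt_mem_nhds (show (0 : ℝ) < Real.exp (-dampMass b) / 2 by positivity))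
  obtain ⟨t₁, ht₁⟩ := Filter.eventually_atTop.1 hsm
  refine ⟨max t₁ 1, le_max_right _ _, fun S N H D h hH0 hD0 t htt htS => ?_⟩
  have ht0 : 0 ≤ t := zero_le_one.trans ((le_max_right _ _).trans htt)
  have hS : 0 ≤ S := ht0.trans htS
  have hsmall := ht₁ t ((le_max_left _ _).trans htt)
  have hba : IntegrableOn (fun s => |b s|) (Ioi 0) := hb.abs
  have h' := h.mono ht0 htS
  have hH := h.nonneg_fst hb (sq_nonneg l) hS hH0 hD0
  have hD := h.nonneg_snd hb (sq_nonneg l) hS hH0 hD0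
  have htI : t ∈ Icc 0 S := ⟨ht0, htS⟩
  have hexp : ContDiff ℝ 1 (fun t : ℝ => Real.exp (l * t)) := by fun_prop
  have hbi : IntervalIntegrable (fun s => |b s|) volume 0 t :=
    intervalIntegrable_of_Ioi hba le_rfl ht0
  have hi : IntervalIntegrable (fun s => |b s| * (Real.exp (l * s) * D s)) volume 0 t :=
    hbi.mul_continuousOn (hexp.continuous.continuousOn.mul h'.ac_snd.continuousOn)
  -- The decaying mode: (e^(lt) (D - lH))' = e^(lt) (N - bD) ≥ -|b| e^(lt) D.
  have hmono : MonotoneOn (fun t => Real.exp (l * t) * (D t - l * H t) +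
      ∫ s in (0 : ℝ)..t, |b s| * (Real.exp (l * s) * D s)) (Icc 0 t) := by
    refine ac_monotoneOn (f' := fun t => (Real.exp (l * t) * (l * 1)) * (D t - l * H t) +
        Real.exp (l * t) * ((l ^ 2 * H t - b t * D t + N t) - l * D t) +
        |b t| * (Real.exp (l * t) * D t))
      (((ac_of_contDiff hexp _ _).fun_mul
        (h'.ac_snd.fun_sub (h'.ac_fst.const_mul l))).fun_add (ac_primitive hi)) ?_ ?_
    · filter_upwards [h'.deriv_fst, h'.deriv_snd, ae_hasDerivAt_primitive ht0 hi] with s h1 h2 h3 hs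
      exact ((((hasDerivAt_id s).const_mul l).exp).mul
        ((h2 hs).sub ((h1 hs).const_mul l))).add (h3 hs)
    · filter_upwards [h'.source_nonneg] with s h1 hs
      have hN := h1 hs
      have hDs := hD s ⟨hs.1, hs.2.trans htS⟩
      have e3 := Real.exp_pos (l * s)
      have e4 : 0 ≤ Real.exp (l * s) * ((|b s| - b s) * D s + N s) :=
        mul_nonneg e3.le (add_nonneg (mul_nonneg (sub_nonneg.2 (le_abs_self _)) hDs) hN)
      nlinarith
  have e := hmono ⟨le_rfl, ht0⟩ ⟨ht0, le_rfl⟩ ht0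
  simp only [mul_zero, Real.exp_zero, one_mul, intervalIntegral.integral_same, add_zero] at e
  set W := D t + l * H t with hW
  have hW0 : 0 ≤ W := by have := hH t htI; have := hD t htI; positivity
  set M := Real.exp (dampMass b) with hM
  have hinit : l * H 0 - D 0 ≤ M * (Real.exp (-l * t) * W) := by
    have := h.sum_le_sum hb hl hS hH0 hD0 le_rfl ht0 htS
    rw [sub_zero] at this
    linarith
  have hint : (∫ s in (0 : ℝ)..t, |b s| * (Real.exp (l * s) * D s)) ≤
      (M * W * Real.exp (l * t)) * ∫ s in (0 : ℝ)..t, Real.exp (-(2 * l) * (t - s)) * |b s| := by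
    rw [← intervalIntegral.integral_const_mul]
    refine intervalIntegral.integral_mono_on ht0 hi
      ((hbi.continuousOn_mul (by fun_prop)).const_mul _) fun s hs => ?_
    have hsI : s ∈ Icc 0 S := ⟨hs.1, hs.2.trans htS⟩
    have e1 := h.sum_le_sum hb hl hS hH0 hD0 hs.1 hs.2 htS
    have e2 : D s ≤ M * (Real.exp (-l * (t - s)) * W) := by
      have := hH s hsI
      nlinarith
    calc |b s| * (Real.exp (l * s) * D s)
        ≤ |b s| * (Real.exp (l * s) * (M * (Real.exp (-l * (t - s)) * W))) := by gcongr
      _ = M * W * (Real.exp (l * s) * Real.exp (-l * (t - s))) * |b s| := by ring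
      _ = M * W * (Real.exp (l * t) * Real.exp (-(2 * l) * (t - s))) * |b s| := by
          rw [← Real.exp_add, ← Real.exp_add]; ring_nf
      _ = _ := by ring
  set R := ∫ s in (0 : ℝ)..t, Real.exp (-(2 * l) * (t - s)) * |b s| with hR
  have key : Real.exp (l * t) * (D t - l * H t) ≥
      -(M * W * Real.exp (l * t)) * (Real.exp (-(2 * l) * t) + R) := by
    have : Real.exp (-l * t) = Real.exp (l * t) * Real.exp (-(2 * l) * t) := by
      rw [← Real.exp_add]; ring_nf
    rw [this] at hinit
    nlinarith
  have hMs : M * (Real.exp (-(2 * l) * t) + R) ≤ 1 / 2 := by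
    have : M * (Real.exp (-dampMass b) / 2) = 1 / 2 := by
      rw [hM, mul_div_assoc', ← Real.exp_add]; simp
    rw [← this]
    exact mul_le_mul_of_nonneg_left hsmall.le (Real.exp_pos _).le
  -- Adding D - lH ≥ -W/2 to D + lH = W gives 2D ≥ W/2, hence the factor 1/4.
  have key2 : -(1 / 2) * W ≤ D t - l * H t := by
    have h1 : W * (M * (Real.exp (-(2 * l) * t) + R)) ≤ W * (1 / 2) :=
      mul_le_mul_of_nonneg_left hMs hW0
    have h2 : Real.exp (l * t) * (-(1 / 2) * W) ≤ Real.exp (l * t) * (D t - l * H t) := by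
      have := mul_le_mul_of_nonneg_left h1 (Real.exp_pos (l * t)).le
      nlinarith
    exact le_of_mul_le_mul_left h2 (Real.exp_pos _)
  linarith

theorem source_integral_nonneg (h : DampedODE b (l ^ 2) N H D S) {t : ℝ} (ht : t ∈ Icc 0 S) :
    0 ≤ ∫ s in (0 : ℝ)..t, Real.exp (-l * s) * N s := by
  rw [intervalIntegral.integral_of_le ht.1]
  refine setIntegral_nonneg_of_ae_restrict ?_
  rw [Filter.EventuallyLE, ae_restrict_iff' measurableSet_Ioc]
  filter_upwards [h.source_nonneg] with s hs hst
  exact mul_nonneg (Real.exp_pos _).le (hs ⟨hst.1.le, hst.2.trans ht.2⟩)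

/-- Here (e^(lt) H)' = e^(lt) (D + lH) is at least a multiple of e^(2lt); integrating from 0 and
dropping H(0) gives the bound. Unlike for the velocity, no waiting time depending on b is needed: t
≥ 1 only keeps e^(2lt) - 1 comparable with e^(2lt). -/
theorem exponential_growth_fst (h : DampedODE b (l ^ 2) N H D S) (hb : IntegrableOn b (Ioi 0))
    (hl : 0 < l) (hS : 0 ≤ S) (hH0 : 0 ≤ H 0) (hD0 : 0 ≤ D 0) {t : ℝ} (h1t : 1 ≤ t)
    (htS : t ≤ S) :
    (1 - Real.exp (-(2 * l))) / (2 * l) * Real.exp (-dampMass b) * (D 0 + l * H 0) *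
      Real.exp (l * t) ≤ H t := by
  have ht0 : 0 ≤ t := zero_le_one.trans h1t
  have h' := h.mono ht0 htS
  -- The denominator 2l comes from integrating e^(2lt).
  set A := Real.exp (-dampMass b) * (D 0 + l * H 0) / (2 * l) with hA
  have hA0 : 0 ≤ A := by positivity
  have hexp : ContDiff ℝ 1 (fun t : ℝ => Real.exp (l * t)) := by fun_prop
  have hexp2 : ContDiff ℝ 1 (fun t : ℝ => Real.exp (2 * l * t)) := by fun_prop
  have hmono : MonotoneOn (fun t => Real.exp (l * t) * H t - A * Real.exp (2 * l * t))
      (Icc 0 t) := by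
    refine ac_monotoneOn (f' := fun t => (Real.exp (l * t) * (l * 1)) * H t +
        Real.exp (l * t) * D t - A * (Real.exp (2 * l * t) * (2 * l * 1)))
      (((ac_of_contDiff hexp _ _).fun_mul h'.ac_fst).fun_sub
        ((ac_of_contDiff hexp2 _ _).const_mul A)) ?_ ?_
    · filter_upwards [h'.deriv_fst] with s h1 hs
      exact ((((hasDerivAt_id s).const_mul l).exp).mul (h1 hs)).sub
        ((((hasDerivAt_id s).const_mul (2 * l)).exp).const_mul A)
    · refine Filter.Eventually.of_forall fun s hs => ?_
      have e1 := h.lower_bound_sum hb hl hS hH0 hD0 (t := s) ⟨hs.1, hs.2.trans htS⟩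
      have e2 := h.source_integral_nonneg (t := s) ⟨hs.1, hs.2.trans htS⟩
      have e3 : D 0 + l * H 0 ≤ Real.exp (dampMass b) * (Real.exp (-l * s) * (D s + l * H s)) := by
        linarith
      have e4 := mul_le_mul_of_nonneg_left e3
        (mul_pos (Real.exp_pos (-dampMass b)) (Real.exp_pos (2 * l * s))).le
      have e5 : Real.exp (-dampMass b) * Real.exp (2 * l * s) *
          (Real.exp (dampMass b) * (Real.exp (-l * s) * (D s + l * H s))) =
          Real.exp (l * s) * (D s + l * H s) := by
        have a1 : Real.exp (-dampMass b) * Real.exp (dampMass b) = 1 := by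
          rw [← Real.exp_add]; simp
        have a2 : Real.exp (2 * l * s) * Real.exp (-l * s) = Real.exp (l * s) := by
          rw [← Real.exp_add]; ring_nf
        calc _ = (Real.exp (-dampMass b) * Real.exp (dampMass b)) *
              (Real.exp (2 * l * s) * Real.exp (-l * s)) * (D s + l * H s) := by ring
          _ = _ := by rw [a1, a2, one_mul]
      rw [e5] at e4
      have e6 : A * (Real.exp (2 * l * s) * (2 * l * 1)) =
          Real.exp (-dampMass b) * Real.exp (2 * l * s) * (D 0 + l * H 0) := by
        rw [hA]; field_simp
      rw [e6]; linarith
  have e := hmono ⟨le_rfl, ht0⟩ ⟨ht0, le_rfl⟩ ht0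
  simp only [mul_zero, Real.exp_zero, one_mul, mul_one] at e
  have e1 : A * (1 - Real.exp (-(2 * l))) * Real.exp (2 * l * t) ≤ Real.exp (l * t) * H t := by
    have a1 : 1 ≤ Real.exp (-(2 * l)) * Real.exp (2 * l * t) := by
      rw [← Real.exp_add]
      exact Real.one_le_exp (by nlinarith)
    nlinarith [mul_le_mul_of_nonneg_left a1 hA0]
  have e2 : Real.exp (2 * l * t) = Real.exp (l * t) * Real.exp (l * t) := by
    rw [← Real.exp_add]; ring_nf
  rw [e2] at e1
  have e3 : Real.exp (l * t) * (A * (1 - Real.exp (-(2 * l))) * Real.exp (l * t)) ≤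
      Real.exp (l * t) * H t := by linarith
  have e4 := le_of_mul_le_mul_left e3 (Real.exp_pos _)
  refine (le_of_eq ?_).trans e4
  rw [hA]; ring

end DampedODE

/-! ### Blow-up of ordinary differential inequalities -/

/-- Separation of variables: J^(1-p) decreases at rate at least (p - 1) κ and stays positive. -/
theorem integral_le_of_superlinear {J J' κ : ℝ → ℝ} {a S p : ℝ} (hp : 1 < p) (haS : a ≤ S)
    (hJ : AbsolutelyContinuousOnInterval J a S) (hJa : 0 < J a) (hJm : ∀ t ∈ Icc a S, J a ≤ J t)
    (hd : ∀ᵐ t, t ∈ Icc a S → HasDerivAt J (J' t) t) (hκ : ContinuousOn κ (Icc a S))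
    (hle : ∀ᵐ t, t ∈ Icc a S → κ t * J t ^ p ≤ J' t) :
    (p - 1) * ∫ s in a..S, κ s ≤ J a ^ (1 - p) := by
  have hκi : IntervalIntegrable κ volume a S := by
    apply ContinuousOn.intervalIntegrable; rwa [uIcc_of_le haS]
  have hpow : AbsolutelyContinuousOnInterval (fun t => J t ^ (1 - p)) a S := by
    refine ac_comp (F := fun x => x ^ (1 - p)) (U := Ioi 0) hJ ?_ ?_
    · intro x hx
      exact (Real.contDiffAt_rpow_const_of_ne (ne_of_gt hx)).contDiffWithinAt
    · intro t ht
      rw [uIcc_of_le haS] at ht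
      exact hJa.trans_le (hJm t ht)
  have hmono : MonotoneOn (fun t => -(J t ^ (1 - p)) + -((p - 1) * ∫ s in a..t, κ s))
      (Icc a S) := by
    refine ac_monotoneOn (f' := fun t => -(J' t * (1 - p) * J t ^ (1 - p - 1)) +
      -((p - 1) * κ t)) (hpow.fun_neg.fun_add ((ac_primitive hκi).const_mul (p - 1)).fun_neg) ?_ ?_
    · filter_upwards [hd, ae_hasDerivAt_primitive haS hκi] with t h1 h2 ht
      exact (((h1 ht).rpow_const (Or.inl (hJa.trans_le (hJm t ht)).ne')).neg).add
        ((h2 ht).const_mul _).neg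
    · filter_upwards [hle] with t h1 ht
      have hpos := hJa.trans_le (hJm t ht)
      have e1 := mul_le_mul_of_nonneg_right (h1 ht) (Real.rpow_pos_of_pos hpos (1 - p - 1)).le
      rw [mul_assoc, ← Real.rpow_add hpos, show p + (1 - p - 1) = 0 by ring, Real.rpow_zero,
        mul_one] at e1
      nlinarith
  have e := hmono ⟨le_rfl, haS⟩ ⟨haS, le_rfl⟩ haS
  simp only [intervalIntegral.integral_same, mul_zero, neg_zero, add_zero] at e
  have := Real.rpow_pos_of_pos (hJa.trans_le (hJm S ⟨haS, le_rfl⟩)) (1 - p)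
  linarith

end

end BlowUpAE

/-! ### Polynomial growth and finite-time blow-up when the eigenvalue is zero -/

namespace BlowUpAE

noncomputable section

open Set

variable {b : ℝ → ℝ}

/-- On [t/2, t] a power is comparable with its value at t, whatever the sign of the exponent; this
avoids integrating powers explicitly. -/
theorem rpow_le_rpow_of_half_le (e : ℝ) {s t : ℝ} (ht : 0 < t) (h1 : t / 2 ≤ s) (h2 : s ≤ t) :
    min 1 (2 ^ (-e)) * t ^ e ≤ s ^ e := by
  have hs : 0 < s := by linarith
  rcases le_total 0 e with he | he
  · calc min 1 ((2 : ℝ) ^ (-e)) * t ^ e ≤ 2 ^ (-e) * t ^ e := by gcongr; exact min_le_right _ _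
      _ = (t / 2) ^ e := by
          rw [Real.div_rpow ht.le (by norm_num), Real.rpow_neg (by norm_num)]; ring
      _ ≤ s ^ e := Real.rpow_le_rpow (by linarith) h1 he
  · calc min 1 ((2 : ℝ) ^ (-e)) * t ^ e ≤ 1 * t ^ e := by gcongr; exact min_le_left _ _
      _ = t ^ e := one_mul _
      _ ≤ s ^ e := Real.rpow_le_rpow_of_nonpos hs h2 he

namespace DampedODE

variable {S : ℝ} {N F D : ℝ → ℝ}

theorem weighted_velocity_increment (h : DampedODE b 0 N F D S) (hb : IntegrableOn b (Ioi 0))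
    (hS : 0 ≤ S) {s t a : ℝ} (hs : 0 ≤ s) (hst : s ≤ t) (htS : t ≤ S)
    (hN : ∀ᵐ r, r ∈ Icc s t → a ≤ N r) (ha : 0 ≤ a) :
    damp b s * D s + Real.exp (-dampMass b) * a * (t - s) ≤ damp b t * D t := by
  have hsub : Icc s t ⊆ Icc 0 S := Icc_subset_Icc hs htS
  have hmono : MonotoneOn (fun r => damp b r * D r - (Real.exp (-dampMass b) * a) * r)
      (Icc s t) := by
    refine ac_monotoneOn (f' := fun r => damp b r * (0 * F r + N r) -
      (Real.exp (-dampMass b) * a) * 1) (((h.ac_weighted hb hS).mono ?_).fun_sub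
        ((ac_of_contDiff contDiff_id _ _).const_mul _)) ?_ ?_
    · rwa [uIcc_of_le hst, uIcc_of_le hS]
    · filter_upwards [h.deriv_weighted hb hS] with r h1 hr
      exact (h1 (hsub hr)).sub ((hasDerivAt_id r).const_mul _)
    · filter_upwards [hN] with r h1 hr
      have e1 := le_damp hb (hsub hr).1
      have e2 := h1 hr
      have e3 : Real.exp (-dampMass b) * a ≤ damp b r * N r := by
        have := (damp_pos b r).le
        gcongr
      linarith
  have e := hmono ⟨le_rfl, hst⟩ ⟨hst, le_rfl⟩ hst
  simp only at e
  linarith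

theorem velocity_ge (hb : IntegrableOn b (Ioi 0)) {t a : ℝ} (ht : 0 ≤ t) (ha : 0 ≤ a)
    (h : a ≤ damp b t * D t) : Real.exp (-dampMass b) * a ≤ D t := by
  have h1 := damp_le hb ht
  have h2 := damp_pos b t
  have h0 : 0 ≤ D t := (mul_nonneg_iff_of_pos_left h2).1 (ha.trans h)
  have h3 : a ≤ Real.exp (dampMass b) * D t := h.trans (by gcongr)
  have h4 := mul_le_mul_of_nonneg_left h3 (Real.exp_pos (-dampMass b)).le
  rwa [← mul_assoc, ← Real.exp_add, neg_add_cancel, Real.exp_zero, one_mul] at h4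

theorem fst_increment (h : DampedODE b μ N F D S) {s t a : ℝ} (hs : 0 ≤ s) (hst : s ≤ t)
    (htS : t ≤ S) (hD : ∀ r ∈ Icc s t, a ≤ D r) : F s + a * (t - s) ≤ F t := by
  have hsub : Icc s t ⊆ Icc 0 S := Icc_subset_Icc hs htS
  have hmono : MonotoneOn (fun r => F r - a * r) (Icc s t) := by
    refine ac_monotoneOn (f' := fun r => D r - a * 1) ((h.ac_fst.mono ?_).fun_sub
        ((ac_of_contDiff contDiff_id _ _).const_mul _)) ?_ ?_
    · rwa [uIcc_of_le hst, uIcc_of_le (hs.trans (hst.trans htS))]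
    · filter_upwards [h.deriv_fst] with r h1 hr
      exact (h1 (hsub hr)).sub ((hasDerivAt_id r).const_mul _)
    · refine Filter.Eventually.of_forall fun r hr => ?_
      linarith [hD r hr]
  have e := hmono ⟨le_rfl, hst⟩ ⟨hst, le_rfl⟩ hst
  simp only at e
  linarith

theorem linear_growth (h : DampedODE b 0 N F D S) (hb : IntegrableOn b (Ioi 0))
    (hS : 0 ≤ S) (hF0 : 0 ≤ F 0) (hD0 : 0 ≤ D 0) {t : ℝ} (ht : t ∈ Icc 0 S) :
    Real.exp (-dampMass b) * D 0 * t ≤ F t := by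
  have := h.fst_increment (s := 0) (t := t) (a := Real.exp (-dampMass b) * D 0) le_rfl ht.1 ht.2
    (fun r hr => ?_)
  · rw [sub_zero] at this; linarith
  · refine velocity_ge hb hr.1 hD0 ?_
    have := h.weighted_velocity_increment hb hS (a := 0) le_rfl hr.1 (hr.2.trans ht.2)
      (by filter_upwards [h.source_nonneg] with r' h1 hr'
          exact h1 ⟨hr'.1, hr'.2.trans (hr.2.trans ht.2)⟩) le_rfl
    simpa [damp_zero] using this

/-- Integrates the source twice, each time only over the last half of the interval and dropping the
nonnegative value at the midpoint. No case distinction on e is then needed, even where the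
antiderivative of the power would be a logarithm. Two halvings account for the factor 4 in front of
t₁. -/
theorem exists_power_growth (hb : IntegrableOn b (Ioi 0)) (e : ℝ) :
    ∃ c : ℝ, 0 < c ∧ ∀ (S : ℝ) (N F D : ℝ → ℝ), DampedODE b 0 N F D S → 0 ≤ F 0 → 0 ≤ D 0 →
      ∀ A t₁ : ℝ, 0 ≤ A → 0 < t₁ → (∀ᵐ t, t ∈ Icc t₁ S → A * t ^ e ≤ N t) →
      ∀ t, 4 * t₁ ≤ t → t ≤ S → c * A * t ^ (e + 2) ≤ F t := by
  set k : ℝ → ℝ := fun e => min 1 (2 ^ (-e)) with hk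
  have hkpos : ∀ e, 0 < k e := fun e => lt_min one_pos (by positivity)
  set M := Real.exp (-dampMass b) with hM
  have hM0 : 0 < M := Real.exp_pos _
  refine ⟨M * (M * k e * k (e + 1)) / 4, by have := hkpos e; have := hkpos (e + 1); positivity,
    fun S N F D h hF0 hD0 A t₁ hA ht₁ hN t h4t htS => ?_⟩
  have ht : 0 < t := by linarith
  have hS : 0 ≤ S := ht.le.trans htS
  have hD := h.nonneg_snd hb le_rfl hS hF0 hD0
  have hF := h.nonneg_fst hb le_rfl hS hF0 hD0
  have hvel : ∀ r, 2 * t₁ ≤ r → r ≤ S → M * (M * k e * A / 2 * r ^ (e + 1)) ≤ D r := by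
    intro r hr hrS
    have hr0 : 0 < r := by linarith
    have hke := hkpos e
    refine velocity_ge hb hr0.le (by positivity) ?_
    have hN' : ∀ᵐ s, s ∈ Icc (r / 2) r → A * (k e * r ^ e) ≤ N s := by
      filter_upwards [hN] with s h1 hs
      refine (mul_le_mul_of_nonneg_left ?_ hA).trans
        (h1 ⟨by linarith [hs.1], hs.2.trans hrS⟩)
      exact rpow_le_rpow_of_half_le e hr0 hs.1 hs.2
    have := h.weighted_velocity_increment hb hS (by linarith) (by linarith) hrS hN'
      (by positivity)
    have h2 : 0 ≤ damp b (r / 2) * D (r / 2) :=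
      mul_nonneg (damp_pos b _).le (hD _ ⟨by linarith, by linarith⟩)
    rw [Real.rpow_add_one hr0.ne']
    rw [← hM] at this
    nlinarith
  have hke1 := hkpos (e + 1)
  have hke := hkpos e
  have := h.fst_increment (s := t / 2) (t := t)
    (a := M * (M * k e * A / 2 * (k (e + 1) * t ^ (e + 1)))) (by linarith) (by linarith) htS
    (fun r hr => ?_)
  · have h3 := hF (t / 2) ⟨by linarith, by linarith⟩
    rw [show e + 2 = e + 1 + 1 by ring, Real.rpow_add_one ht.ne']
    nlinarith
  · refine le_trans ?_ (hvel r (by linarith [hr.1]) (hr.2.trans htS))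
    have := rpow_le_rpow_of_half_le (e + 1) ht hr.1 hr.2
    gcongr

/-- For F'' ≥ B F^q without damping, an energy identity gives F' ≳ F^((q+1)/2). With damping this is
replaced by a first order comparison: P = exp(∫b) F' - k F^((q+1)/2) satisfies P' + γP ≥ 0 with γ =
κ F^((q-1)/2), so exp(∫γ) P is nondecreasing. Once ∫γ ≥ 1 the initial deficit of P has been halved
and F' ≥ c k F^((q+1)/2) holds, which is a superlinear inequality with exponent (q+1)/2 > 1. -/
theorem exists_blowup_bound (hb : IntegrableOn b (Ioi 0)) {q : ℝ} (hq : 1 < q) :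
    ∃ C : ℝ, 0 < C ∧ ∀ (S : ℝ) (N F D : ℝ → ℝ), DampedODE b 0 N F D S → 0 ≤ F 0 → 0 ≤ D 0 →
      ∀ B t₀ : ℝ, 0 < B → 0 ≤ t₀ → t₀ ≤ S → 0 < F t₀ →
      (∀ᵐ t, t ∈ Icc t₀ S → B * F t ^ q ≤ N t) → (S - t₀) ^ 2 * B * F t₀ ^ (q - 1) ≤ C := by
  set M := Real.exp (dampMass b) with hM
  have hM0 : 0 < M := Real.exp_pos _
  have hMi : Real.exp (-dampMass b) = M⁻¹ := by rw [Real.exp_neg]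
  refine ⟨max (8 / (q + 1)) ((8 * M / (q - 1)) ^ 2 * (M ^ 2 * (q + 1) / 2)),
    lt_max_of_lt_left (by positivity),
    fun S N F D h hF0 hD0 B t₀ hB ht₀ htS hFt hN => ?_⟩
  have hS : 0 ≤ S := ht₀.trans htS
  have hD := h.nonneg_snd hb le_rfl hS hF0 hD0
  have hFmono := h.monotoneOn_fst hb le_rfl hS hF0 hD0
  have hsub : Icc t₀ S ⊆ Icc 0 S := Icc_subset_Icc ht₀ le_rfl
  have hsubu : uIcc t₀ S ⊆ uIcc 0 S := by rwa [uIcc_of_le htS, uIcc_of_le hS]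
  have hFge : ∀ t ∈ Icc t₀ S, F t₀ ≤ F t := fun t ht => hFmono ⟨ht₀, htS⟩ (hsub ht) ht.1
  have hFpos : ∀ t ∈ Icc t₀ S, 0 < F t := fun t ht => hFt.trans_le (hFge t ht)
  have hFc : ContinuousOn F (Icc t₀ S) := by
    have := (h.ac_fst.mono hsubu).continuousOn; rwa [uIcc_of_le htS] at this
  -- The constants k and κ are fixed by two requirements: κ = kM(q+1)/2 lets γ exp(∫b) D absorb the
  -- derivative of k F^((q+1)/2), and κk = B/M matches the source.
  set k := Real.sqrt (2 * B / (M ^ 2 * (q + 1))) with hk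
  have hk0 : 0 < k := Real.sqrt_pos.2 (by positivity)
  have hk2 : k ^ 2 = 2 * B / (M ^ 2 * (q + 1)) := Real.sq_sqrt (by positivity)
  set κ := k * M * (q + 1) / 2 with hκ
  have hκ0 : 0 < κ := by positivity
  set γ : ℝ → ℝ := fun t => κ * F t ^ ((q - 1) / 2) with hγ
  have hγc : ContinuousOn γ (Icc t₀ S) :=
    continuousOn_const.mul (hFc.rpow_const fun t ht => Or.inl (hFpos t ht).ne')
  have hγi : IntervalIntegrable γ volume t₀ S := by
    apply ContinuousOn.intervalIntegrable; rwa [uIcc_of_le htS]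
  set Γ : ℝ → ℝ := fun t => ∫ s in t₀..t, γ s with hΓ
  have hΓac : AbsolutelyContinuousOnInterval (fun t => Real.exp (Γ t)) t₀ S :=
    ac_comp (f := Γ) (F := Real.exp) (ac_primitive hγi)
      (Real.contDiff_exp.contDiffOn (s := univ)) (fun _ _ => mem_univ _)
  have hpow : AbsolutelyContinuousOnInterval (fun t => F t ^ ((q + 1) / 2)) t₀ S := by
    refine ac_comp (F := fun x => x ^ ((q + 1) / 2)) (U := Ioi 0) (h.ac_fst.mono hsubu) ?_ ?_
    · intro x hx
      exact (Real.contDiffAt_rpow_const_of_ne (ne_of_gt hx)).contDiffWithinAt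
    · intro t ht
      rw [uIcc_of_le htS] at ht
      exact hFpos t ht
  have hmono : MonotoneOn (fun t => Real.exp (Γ t) * (damp b t * D t - k * F t ^ ((q + 1) / 2)))
      (Icc t₀ S) := by
    refine ac_monotoneOn (f' := fun t =>
      (Real.exp (Γ t) * γ t) * (damp b t * D t - k * F t ^ ((q + 1) / 2)) +
      Real.exp (Γ t) * (damp b t * (0 * F t + N t) -
        k * (D t * ((q + 1) / 2) * F t ^ ((q + 1) / 2 - 1))))
      (hΓac.fun_mul (((h.ac_weighted hb hS).mono hsubu).fun_sub (hpow.const_mul k))) ?_ ?_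
    · filter_upwards [h.deriv_weighted hb hS, h.deriv_fst, ae_hasDerivAt_primitive htS hγi]
        with t h1 h2 h3 ht
      exact ((h3 ht).exp).mul ((h1 (hsub ht)).sub
        (((h2 (hsub ht)).rpow_const (Or.inl (hFpos t ht).ne')).const_mul k))
    · filter_upwards [hN] with t h1 ht
      have hF := hFpos t ht
      have e0 := Real.exp_pos (Γ t)
      have e1 : M⁻¹ * (B * F t ^ q) ≤ damp b t * N t := by
        rw [← hMi]
        have := le_damp hb (hsub ht).1
        have := (damp_pos b t).le
        have := h1 ht
        gcongr
      have e2 : D t ≤ M * (damp b t * D t) := by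
        have a1 := le_damp hb (hsub ht).1
        rw [hMi] at a1
        have a2 : 1 ≤ M * damp b t := by
          rw [← mul_inv_cancel₀ hM0.ne']; exact mul_le_mul_of_nonneg_left a1 hM0.le
        have := mul_le_mul_of_nonneg_right a2 (hD t (hsub ht))
        linarith
      have e3 : F t ^ ((q + 1) / 2 - 1) = F t ^ ((q - 1) / 2) := by congr 1; ring
      have e4 : F t ^ q = F t ^ ((q - 1) / 2) * F t ^ ((q + 1) / 2) := by
        rw [← Real.rpow_add hF]; congr 1; ring
      set X := F t ^ ((q - 1) / 2) with hX
      have hX0 : 0 < X := Real.rpow_pos_of_pos hF _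
      set Y := F t ^ ((q + 1) / 2) with hY
      have e5 : M⁻¹ * B = κ * k := by
        have : κ * k = k ^ 2 * (M * (q + 1) / 2) := by rw [hκ]; ring
        rw [this, hk2]; field_simp
      have e6 : k * (D t * ((q + 1) / 2) * X) ≤ κ * X * (damp b t * D t) := by
        have := mul_le_mul_of_nonneg_left e2 (show 0 ≤ k * ((q + 1) / 2) * X by positivity)
        rw [hκ]; linarith
      have e7 : M⁻¹ * (B * F t ^ q) = κ * X * (k * Y) := by
        rw [e4, ← mul_assoc, e5]; ring
      rw [e3]
      have e8 : 0 ≤ γ t * (damp b t * D t - k * Y) + (damp b t * (0 * F t + N t) -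
          k * (D t * ((q + 1) / 2) * X)) := by
        have : γ t = κ * X := rfl
        rw [this]
        rw [e7] at e1
        linarith
      have := mul_nonneg e0.le e8
      linarith
  set f₀ := F t₀ ^ ((q - 1) / 2) with hf₀
  have hf₀0 : 0 < f₀ := Real.rpow_pos_of_pos hFt _
  have hf₀2 : f₀ ^ 2 = F t₀ ^ (q - 1) := by
    rw [hf₀, ← Real.rpow_natCast, ← Real.rpow_mul hFt.le]; congr 1; push_cast; ring
  rw [← hf₀2]
  -- Either half the interval is too short for ∫γ to be sure to reach 1, which is already the
  -- claimed bound, or ∫γ ≥ 1 from the midpoint on and the superlinear inequality bounds the second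
  -- half.
  rcases le_total (κ * f₀ * ((S - t₀) / 2)) 1 with hcase | hcase
  · refine le_max_of_le_left ?_
    have e1 : (κ * f₀ * ((S - t₀) / 2)) ^ 2 ≤ 1 := by
      have : 0 ≤ κ * f₀ * ((S - t₀) / 2) := by
        have := sub_nonneg.2 htS; positivity
      nlinarith
    have e2 : κ ^ 2 = B * (q + 1) / 2 := by
      have : κ ^ 2 = k ^ 2 * (M * (q + 1) / 2) ^ 2 := by rw [hκ]; ring
      rw [this, hk2]; field_simp
    have e3 : (κ * f₀ * ((S - t₀) / 2)) ^ 2 = κ ^ 2 * f₀ ^ 2 * (S - t₀) ^ 2 / 4 := by ring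
    rw [e3, e2] at e1
    rw [le_div_iff₀ (by positivity)]
    linarith
  · refine le_max_of_le_right ?_
    set tm := (t₀ + S) / 2 with htm
    have htm1 : t₀ ≤ tm := by linarith
    have htm2 : tm ≤ S := by linarith
    have hsub' : Icc tm S ⊆ Icc t₀ S := Icc_subset_Icc htm1 le_rfl
    have hvel : ∀ t ∈ Icc tm S, k / (2 * M) * F t ^ ((q + 1) / 2) ≤ D t := by
      intro t ht
      have htI := hsub' ht
      have e := hmono ⟨le_rfl, htS⟩ htI htI.1
      simp only [hΓ, intervalIntegral.integral_same, Real.exp_zero, one_mul] at e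
      have hΓt : 1 ≤ Γ t := by
        have a1 : ∫ s in t₀..t, κ * f₀ ≤ Γ t := by
          refine intervalIntegral.integral_mono_on htI.1 (by simp) (hγi.mono_set ?_) ?_
          · rw [uIcc_of_le htI.1, uIcc_of_le htS]; exact Icc_subset_Icc le_rfl htI.2
          · intro s hs
            have := hFge s ⟨hs.1, hs.2.trans htI.2⟩
            exact mul_le_mul_of_nonneg_left
              (Real.rpow_le_rpow hFt.le this (by linarith)) hκ0.le
        rw [intervalIntegral.integral_const, smul_eq_mul] at a1
        have a2 : (S - t₀) / 2 ≤ t - t₀ := by linarith [ht.1]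
        have := mul_le_mul_of_nonneg_left a2 (mul_pos hκ0 hf₀0).le
        linarith
      have hΓ2 : 2 ≤ Real.exp (Γ t) := by
        have := Real.add_one_le_exp (Γ t); linarith
      have hle : F t₀ ^ ((q + 1) / 2) ≤ F t ^ ((q + 1) / 2) :=
        Real.rpow_le_rpow hFt.le (hFge t htI) (by linarith)
      have hdD : 0 ≤ damp b t₀ * D t₀ := mul_nonneg (damp_pos b _).le (hD _ ⟨ht₀, htS⟩)
      have hFq : 0 ≤ F t₀ ^ ((q + 1) / 2) := (Real.rpow_pos_of_pos hFt _).le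
      -- Monotonicity gives exp(Γ) P ≥ -k F(t₀)^((q+1)/2) ≥ -k F(t)^((q+1)/2); as exp(Γ) ≥ 2, at
      -- most half of k F^((q+1)/2) is lost.
      have e2 : k / 2 * F t ^ ((q + 1) / 2) ≤ damp b t * D t := by
        by_contra hc
        push Not at hc
        have h5 : Real.exp (Γ t) * (damp b t * D t - k * F t ^ ((q + 1) / 2)) <
            Real.exp (Γ t) * (-(k / 2 * F t ^ ((q + 1) / 2))) :=
          mul_lt_mul_of_pos_left (by linarith) (by linarith)
        have h6 : k * F t ^ ((q + 1) / 2) ≤ Real.exp (Γ t) * (k / 2 * F t ^ ((q + 1) / 2)) := by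
          have := mul_le_mul_of_nonneg_right hΓ2
            (show 0 ≤ k / 2 * F t ^ ((q + 1) / 2) by
              have := hFq.trans hle; positivity)
          linarith
        have h7 := mul_le_mul_of_nonneg_left hle hk0.le
        change _ ≤ Real.exp (Γ t) * (damp b t * D t - k * F t ^ ((q + 1) / 2)) at e
        linarith
      have e3 := velocity_ge hb (hsub htI).1 (by have := hFq.trans hle; positivity) e2
      rw [hMi] at e3
      refine (le_of_eq ?_).trans e3
      field_simp
    have hfin := integral_le_of_superlinear (J := F) (J' := D) (κ := fun _ => k / (2 * M))
      (p := (q + 1) / 2) (by linarith) htm2 (h.ac_fst.mono ?_) (hFpos tm ⟨htm1, htm2⟩)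
      (fun t ht => hFmono ⟨ht₀.trans htm1, htm2⟩ (hsub (hsub' ht)) ht.1) ?_ continuousOn_const ?_
    · rw [intervalIntegral.integral_const, smul_eq_mul] at hfin
      have e1 : F tm ^ (1 - (q + 1) / 2) ≤ f₀⁻¹ := by
        rw [hf₀, ← Real.rpow_neg hFt.le, show 1 - (q + 1) / 2 = -((q - 1) / 2) by ring]
        exact Real.rpow_le_rpow_of_nonpos hFt (hFge tm ⟨htm1, htm2⟩) (by linarith)
      have e2 : ((q + 1) / 2 - 1) * ((S - tm) * (k / (2 * M))) * f₀ ≤ 1 := by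
        exact (mul_le_mul_of_nonneg_right (hfin.trans e1) hf₀0.le).trans_eq
          (inv_mul_cancel₀ hf₀0.ne')
      have e3 : ((q + 1) / 2 - 1) * ((S - tm) * (k / (2 * M))) * f₀ =
          (q - 1) / (8 * M) * ((S - t₀) * k * f₀) := by
        rw [htm]; field_simp; ring
      rw [e3] at e2
      have e4 : (S - t₀) * k * f₀ ≤ 8 * M / (q - 1) := by
        have hq1 : 0 < q - 1 := by linarith
        rw [le_div_iff₀ hq1]
        have := mul_le_mul_of_nonneg_left e2 (show 0 ≤ 8 * M by positivity)
        refine le_trans (le_of_eq ?_) (this.trans_eq (mul_one _))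
        field_simp
      have e5 : ((S - t₀) * k * f₀) ^ 2 ≤ (8 * M / (q - 1)) ^ 2 := by
        have := sub_nonneg.2 htS
        exact pow_le_pow_left₀ (by positivity) e4 2
      have e6 : B = k ^ 2 * (M ^ 2 * (q + 1) / 2) := by rw [hk2]; field_simp
      calc (S - t₀) ^ 2 * B * f₀ ^ 2 = ((S - t₀) * k * f₀) ^ 2 * (M ^ 2 * (q + 1) / 2) := by
            rw [e6]; ring
        _ ≤ _ := by gcongr
    · refine Subset.trans ?_ hsubu
      rw [uIcc_of_le htm2, uIcc_of_le htS]; exact hsub'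
    · filter_upwards [h.deriv_fst] with t h1 ht using h1 (hsub (hsub' ht))
    · exact Filter.Eventually.of_forall fun t ht => hvel t ht

end DampedODE

end

end BlowUpAE

namespace BlowUpAE

noncomputable section

open Set

/-! ### Coefficients of the Laplace–Beltrami operator -/

section Metric

variable {n : ℕ} {g : E n → Matrix (Fin n) (Fin n) ℝ}

theorem contDiff_det {A : E n → Matrix (Fin n) (Fin n) ℝ}
    (hA : ∀ j k, ContDiff ℝ 2 (fun x => A x j k)) : ContDiff ℝ 2 (fun x => (A x).det) := by
  simp only [Matrix.det_apply, Units.smul_def, zsmul_eq_mul]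
  exact ContDiff.sum fun σ _ => contDiff_const.mul (contDiff_prod fun i _ => hA _ _)

theorem contDiff_volDensity (hp : ∀ x, (g x).PosDef)
    (hg : ∀ j k, ContDiff ℝ 2 (fun x => g x j k)) : ContDiff ℝ 2 (volDensity g) :=
  (contDiff_det hg).sqrt fun x => (hp x).det_pos.ne'

theorem volDensity_pos (hp : ∀ x, (g x).PosDef) (x : E n) : 0 < volDensity g x :=
  Real.sqrt_pos.2 (hp x).det_pos

theorem continuous_volDensity (hp : ∀ x, (g x).PosDef)
    (hg : ∀ j k, ContDiff ℝ 2 (fun x => g x j k)) : Continuous (volDensity g) :=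
  (contDiff_volDensity hp hg).continuous

theorem contDiff_inv_apply (hp : ∀ x, (g x).PosDef)
    (hg : ∀ j k, ContDiff ℝ 2 (fun x => g x j k)) (j k : Fin n) :
    ContDiff ℝ 2 (fun x => (g x)⁻¹ j k) := by
  -- Cramer's rule: the entries of the inverse are quotients of polynomials in the entries of g,
  -- with nonvanishing denominator.
  have : (fun x => (g x)⁻¹ j k) =
      fun x => ((g x).det)⁻¹ * ((g x).updateRow k (Pi.single j 1)).det := by
    funext x
    rw [Matrix.inv_def, Matrix.smul_apply, Matrix.adjugate_apply, Ring.inverse_eq_inv', smul_eq_mul]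
  rw [this]
  refine ((contDiff_det hg).inv fun x => (hp x).det_pos.ne').mul (contDiff_det fun i l => ?_)
  by_cases hi : i = k
  · subst hi
    simp only [Matrix.updateRow_self]
    exact contDiff_const
  · simp only [Matrix.updateRow_ne hi]
    exact hg i l

/-- The first order coefficients of the Laplace–Beltrami operator. -/
def driftCoeff (g : E n → Matrix (Fin n) (Fin n) ℝ) (k : Fin n) (x : E n) : ℝ :=
  (volDensity g x)⁻¹ * ∑ j, partialDeriv j (fun y => volDensity g y * (g y)⁻¹ j k) x

theorem contDiff_partialDeriv {f : E n → ℝ} {m : WithTop ℕ∞} {l : WithTop ℕ∞} (hf : ContDiff ℝ l f)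
    (hm : m + 1 ≤ l) (j : Fin n) : ContDiff ℝ m (partialDeriv j f) :=
  (hf.fderiv_right hm).clm_apply contDiff_const

theorem continuous_driftCoeff (hp : ∀ x, (g x).PosDef)
    (hg : ∀ j k, ContDiff ℝ 2 (fun x => g x j k)) (k : Fin n) : Continuous (driftCoeff g k) := by
  refine ((continuous_volDensity hp hg).inv₀ fun x => (volDensity_pos hp x).ne').mul
    (continuous_finsetSum _ fun j _ => ?_)
  exact (contDiff_partialDeriv (m := 1)
    ((contDiff_volDensity hp hg).mul (contDiff_inv_apply hp hg j k)) (by norm_num) j).continuous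

theorem partialDeriv_sum {ι : Type*} {s : Finset ι} {f : ι → E n → ℝ} {x : E n}
    (h : ∀ i ∈ s, DifferentiableAt ℝ (f i) x) (j : Fin n) :
    partialDeriv j (fun y => ∑ i ∈ s, f i y) x = ∑ i ∈ s, partialDeriv j (f i) x := by
  simp only [partialDeriv]
  rw [fderiv_fun_sum h]
  simp

theorem partialDeriv_mul {f h : E n → ℝ} {x : E n} (hf : DifferentiableAt ℝ f x)
    (hh : DifferentiableAt ℝ h x) (j : Fin n) :
    partialDeriv j (fun y => f y * h y) x = f x * partialDeriv j h x + h x * partialDeriv j f x := by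
  simp only [partialDeriv]
  rw [fderiv_fun_mul hf hh]
  simp

/-- The nondivergence form is what the maximum principle and the mollification need: continuous
coefficients stand outside the derivatives of f. -/
theorem laplaceBeltrami_eq (hp : ∀ x, (g x).PosDef)
    (hg : ∀ j k, ContDiff ℝ 2 (fun x => g x j k)) {f : E n → ℝ} (hf : ContDiff ℝ 2 f) (x : E n) :
    laplaceBeltrami g f x = ∑ k, driftCoeff g k x * partialDeriv k f x +
      ∑ j, ∑ k, (g x)⁻¹ j k * partialDeriv j (partialDeriv k f) x := by
  have hA : ∀ j k, ContDiff ℝ 2 (fun y => volDensity g y * (g y)⁻¹ j k) := fun j k =>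
    (contDiff_volDensity hp hg).mul (contDiff_inv_apply hp hg j k)
  have hdf : ∀ k, DifferentiableAt ℝ (partialDeriv k f) x := fun k =>
    (contDiff_partialDeriv (m := 1) hf (by norm_num) k).differentiable (by norm_num) x
  have hv := (volDensity_pos hp x).ne'
  have h1 : ∀ j, partialDeriv j
      (fun y => volDensity g y * ∑ k, (g y)⁻¹ j k * partialDeriv k f y) x =
      ∑ k, (volDensity g x * (g x)⁻¹ j k * partialDeriv j (partialDeriv k f) x +
        partialDeriv k f x * partialDeriv j (fun y => volDensity g y * (g y)⁻¹ j k) x) := by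
    intro j
    have : (fun y => volDensity g y * ∑ k, (g y)⁻¹ j k * partialDeriv k f y) =
        fun y => ∑ k, (volDensity g y * (g y)⁻¹ j k) * partialDeriv k f y := by
      funext y; rw [Finset.mul_sum]; exact Finset.sum_congr rfl fun k _ => by ring
    rw [this, partialDeriv_sum]
    · refine Finset.sum_congr rfl fun k _ => ?_
      rw [partialDeriv_mul ((hA j k).differentiable (by norm_num) x) (hdf k)]
    · exact fun k _ => ((hA j k).differentiable (by norm_num) x).mul (hdf k)
  simp only [laplaceBeltrami, h1, driftCoeff, Finset.sum_add_distrib, mul_add]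
  rw [add_comm]
  congr 1
  · rw [Finset.sum_comm, Finset.mul_sum]
    refine Finset.sum_congr rfl fun k _ => ?_
    rw [← Finset.mul_sum]; ring
  · rw [Finset.mul_sum]
    refine Finset.sum_congr rfl fun j _ => ?_
    rw [Finset.mul_sum]
    refine Finset.sum_congr rfl fun k _ => ?_
    field_simp

theorem laplaceBeltrami_congr {f h : E n → ℝ} {x : E n} (hfh : f =ᶠ[nhds x] h) :
    laplaceBeltrami g f x = laplaceBeltrami g h x := by
  unfold laplaceBeltrami
  congr 1
  refine Finset.sum_congr rfl fun j _ => ?_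
  unfold partialDeriv
  congr 1
  refine Filter.EventuallyEq.fderiv_eq ?_
  filter_upwards [hfh.fderiv (𝕜 := ℝ)] with y hy
  rw [hy]

theorem laplaceBeltrami_const (c : ℝ) (x : E n) : laplaceBeltrami g (fun _ => c) x = 0 := by
  simp [laplaceBeltrami, partialDeriv]

theorem continuous_laplaceBeltrami (hp : ∀ x, (g x).PosDef)
    (hg : ∀ j k, ContDiff ℝ 2 (fun x => g x j k)) {f : E n → ℝ} (hf : ContDiff ℝ 2 f) :
    Continuous (laplaceBeltrami g f) := by
  rw [funext (laplaceBeltrami_eq hp hg hf)]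
  refine Continuous.add (continuous_finsetSum _ fun k _ => ?_)
    (continuous_finsetSum _ fun j _ => continuous_finsetSum _ fun k _ => ?_)
  · exact (continuous_driftCoeff hp hg k).mul
      (contDiff_partialDeriv (m := 1) hf (by norm_num) k).continuous
  · exact (contDiff_inv_apply hp hg j k).continuous.mul
      (contDiff_partialDeriv (m := 0) (contDiff_partialDeriv (m := 1) hf (by norm_num) k)
        (by norm_num) j).continuous

theorem laplaceBeltrami_eq_zero_of_notMem {f : E n → ℝ} {x : E n} (hx : x ∉ tsupport f) :
    laplaceBeltrami g f x = 0 := by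
  rw [laplaceBeltrami_congr (notMem_tsupport_iff_eventuallyEq.1 hx)]
  exact laplaceBeltrami_const 0 x

end Metric

/-! ### Mollification -/

section Mollify

variable {n : ℕ}

/-- A sequence of bump functions that shrinks to the origin. -/
def shrinkBump (n : ℕ) (i : ℕ) : ContDiffBump (0 : E n) where
  rIn := 1 / (2 * ((i : ℝ) + 1))
  rOut := 1 / ((i : ℝ) + 1)
  rIn_pos := by positivity
  rIn_lt_rOut := by
    rw [div_lt_div_iff_of_pos_left one_pos (by positivity) (by positivity)]
    have : (0 : ℝ) ≤ i := i.cast_nonneg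
    linarith

/-- The mollification of `f` at scale `1 / (i + 1)`. -/
def mollify (i : ℕ) (f : E n → ℝ) : E n → ℝ :=
  convolution ((shrinkBump n i).normed volume) f (ContinuousLinearMap.lsmul ℝ ℝ) volume

theorem tendsto_mollify {f : E n → ℝ} (hf : Continuous f) (x : E n) :
    Filter.Tendsto (fun i => mollify i f x) Filter.atTop (nhds (f x)) :=
  ContDiffBump.convolution_tendsto_right_of_continuous
    (show Filter.Tendsto (fun i : ℕ => 1 / ((i : ℝ) + 1)) Filter.atTop (nhds 0) from
      tendsto_one_div_add_atTop_nhds_zero_nat) hf x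

theorem abs_mollify_le {f : E n → ℝ} (hf : Continuous f) {C : ℝ} (hC : ∀ x, |f x| ≤ C) (i : ℕ)
    (x : E n) : |mollify i f x| ≤ 3 * C := by
  have h := (shrinkBump n i).dist_normed_convolution_le (μ := volume) (x₀ := x) (ε := 2 * C)
    hf.aestronglyMeasurable (fun y _ => by
      rw [Real.dist_eq]
      calc |f y - f x| ≤ |f y| + |f x| := abs_sub _ _
        _ ≤ 2 * C := by linarith [hC x, hC y])
  rw [Real.dist_eq] at h
  have h2 : |mollify i f x| ≤ |mollify i f x - f x| + |f x| := by
    calc |mollify i f x| = |(mollify i f x - f x) + f x| := by ring_nf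
      _ ≤ _ := abs_add_le _ _
  have := hC x
  -- The oscillation of f is at most 2C; together with |f| ≤ C this gives the crude factor 3.
  have h3 : |mollify i f x - f x| ≤ 2 * C := h
  linarith

theorem contDiff_mollify {f : E n → ℝ} (hf : Continuous f) (i : ℕ) : ContDiff ℝ ∞ (mollify i f) :=
  (shrinkBump n i).hasCompactSupport_normed.contDiff_convolution_left _
    (shrinkBump n i).contDiff_normed hf.locallyIntegrable

theorem partialDeriv_mollify {f : E n → ℝ} (hf : ContDiff ℝ 1 f) (hfc : HasCompactSupport f)
    (i : ℕ) (j : Fin n) : partialDeriv j (mollify i f) = mollify i (partialDeriv j f) := by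
  funext x
  have hloc : LocallyIntegrable ((shrinkBump n i).normed volume) (volume : Measure (E n)) :=
    (shrinkBump n i).continuous_normed.locallyIntegrable
  have h := hfc.hasFDerivAt_convolution_right (ContinuousLinearMap.lsmul ℝ ℝ) hloc hf x
  unfold partialDeriv
  rw [show fderiv ℝ (mollify i f) x = _ from h.fderiv,
    convolution_precompR_apply (ContinuousLinearMap.lsmul ℝ ℝ) hloc (hfc.fderiv ℝ)
    (hf.continuous_fderiv one_ne_zero)]
  rfl

theorem tsupport_mollify_subset {f : E n → ℝ} {R : ℝ}
    (hR : tsupport f ⊆ Metric.closedBall 0 R) (i : ℕ) :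
    tsupport (mollify i f) ⊆ Metric.closedBall 0 (R + 1) := by
  refine closure_minimal ?_ Metric.isClosed_closedBall
  refine (support_convolution_subset _).trans ?_
  rintro _ ⟨y, hy, z, hz, rfl⟩
  rw [(shrinkBump n i).support_normed_eq, mem_ball_zero_iff] at hy
  have hz' := hR (subset_tsupport f hz)
  rw [mem_closedBall_zero_iff] at hz' ⊢
  have h1 : (shrinkBump n i).rOut ≤ 1 := by
    change 1 / ((i : ℝ) + 1) ≤ 1
    rw [div_le_one (by positivity)]
    have : (0 : ℝ) ≤ i := i.cast_nonneg
    linarith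
  linarith [norm_add_le y z]

theorem isTest_mollify {f : E n → ℝ} (hf : Continuous f) (hfc : HasCompactSupport f) (i : ℕ) :
    IsTest (mollify i f) :=
  ⟨contDiff_mollify hf i, HasCompactSupport.convolution _
    (shrinkBump n i).hasCompactSupport_normed hfc⟩

theorem exists_abs_le {f : E n → ℝ} (hf : Continuous f) (hfc : HasCompactSupport f) :
    ∃ C, ∀ x, |f x| ≤ C := hfc.exists_bound_of_continuous hf

variable {g : E n → Matrix (Fin n) (Fin n) ℝ}

/-- Mollification commutes with partial derivatives and the coefficients are left unmollified, so no
commutator appears and convergence and bounds reduce to those of mollified continuous functions. -/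
theorem laplaceBeltrami_mollify (hp : ∀ x, (g x).PosDef)
    (hg : ∀ j k, ContDiff ℝ 2 (fun x => g x j k)) {f : E n → ℝ} (hf : ContDiff ℝ 2 f)
    (hfc : HasCompactSupport f) (i : ℕ) (x : E n) :
    laplaceBeltrami g (mollify i f) x = ∑ k, driftCoeff g k x * mollify i (partialDeriv k f) x +
      ∑ j, ∑ k, (g x)⁻¹ j k * mollify i (partialDeriv j (partialDeriv k f)) x := by
  rw [laplaceBeltrami_eq hp hg (contDiff_infty.1 (contDiff_mollify hf.continuous i) 2)]
  have hf1 : ContDiff ℝ 1 f := hf.of_le (by norm_num)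
  simp only [partialDeriv_mollify hf1 hfc]
  congr 1
  refine Finset.sum_congr rfl fun j _ => Finset.sum_congr rfl fun k _ => ?_
  rw [partialDeriv_mollify (contDiff_partialDeriv (m := 1) hf (by norm_num) k)
    (hfc.fderiv_apply (𝕜 := ℝ) _)]

theorem tendsto_laplaceBeltrami_mollify (hp : ∀ x, (g x).PosDef)
    (hg : ∀ j k, ContDiff ℝ 2 (fun x => g x j k)) {f : E n → ℝ} (hf : ContDiff ℝ 2 f)
    (hfc : HasCompactSupport f) (x : E n) :
    Filter.Tendsto (fun i => laplaceBeltrami g (mollify i f) x) Filter.atTop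
      (nhds (laplaceBeltrami g f x)) := by
  simp only [laplaceBeltrami_mollify hp hg hf hfc]
  rw [laplaceBeltrami_eq hp hg hf]
  have h1 : ∀ k, Continuous (partialDeriv k f) := fun k =>
    (contDiff_partialDeriv (m := 1) hf (by norm_num) k).continuous
  have h2 : ∀ j k, Continuous (partialDeriv j (partialDeriv k f)) := fun j k =>
    (contDiff_partialDeriv (m := 0) (contDiff_partialDeriv (m := 1) hf (by norm_num) k)
        (by norm_num) j).continuous
  exact (tendsto_finsetSum _ fun k _ => (tendsto_mollify (h1 k) x).const_mul _).add
    (tendsto_finsetSum _ fun j _ => tendsto_finsetSum _ fun k _ =>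
      (tendsto_mollify (h2 j k) x).const_mul _)

/-- Supplies the majorant for dominated convergence. The coefficients are bounded on one compact
ball, which contains the supports of all mollifications because their scale is at most 1. -/
theorem exists_bound_laplaceBeltrami_mollify (hp : ∀ x, (g x).PosDef)
    (hg : ∀ j k, ContDiff ℝ 2 (fun x => g x j k)) {f : E n → ℝ} (hf : ContDiff ℝ 2 f)
    (hfc : HasCompactSupport f) :
    ∃ C : ℝ, ∀ i x, |laplaceBeltrami g (mollify i f) x| ≤ C := by
  obtain ⟨R, hR⟩ := hfc.isCompact.isBounded.subset_closedBall 0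
  have h1 : ∀ k, Continuous (partialDeriv k f) := fun k =>
    (contDiff_partialDeriv (m := 1) hf (by norm_num) k).continuous
  have h2 : ∀ j k, Continuous (partialDeriv j (partialDeriv k f)) := fun j k =>
    (contDiff_partialDeriv (m := 0) (contDiff_partialDeriv (m := 1) hf (by norm_num) k)
        (by norm_num) j).continuous
  have h1c : ∀ k, HasCompactSupport (partialDeriv k f) := fun k => hfc.fderiv_apply (𝕜 := ℝ) _
  choose C1 hC1 using fun k => exists_abs_le (h1 k) (h1c k)
  choose C2 hC2 using fun j k => exists_abs_le (h2 j k) ((h1c k).fderiv_apply (𝕜 := ℝ) _)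
  have hcont : Continuous fun x => ∑ k, |driftCoeff g k x| * (3 * C1 k) +
      ∑ j, ∑ k, |(g x)⁻¹ j k| * (3 * C2 j k) := by
    refine Continuous.add (continuous_finsetSum _ fun k _ => ?_)
      (continuous_finsetSum _ fun j _ => continuous_finsetSum _ fun k _ => ?_)
    · exact (continuous_driftCoeff hp hg k).abs.mul continuous_const
    · exact (contDiff_inv_apply hp hg j k).continuous.abs.mul continuous_const
  obtain ⟨C, hC⟩ := (isCompact_closedBall (0 : E n) (R + 1)).exists_bound_of_continuousOn
    hcont.continuousOn
  refine ⟨max C 0, fun i x => ?_⟩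
  by_cases hx : x ∈ Metric.closedBall (0 : E n) (R + 1)
  · refine le_max_of_le_left (le_trans ?_ ((le_abs_self _).trans (hC x hx)))
    rw [laplaceBeltrami_mollify hp hg hf hfc]
    refine (abs_add_le _ _).trans (add_le_add ?_ ?_)
    · refine (Finset.abs_sum_le_sum_abs _ _).trans (Finset.sum_le_sum fun k _ => ?_)
      rw [abs_mul]
      exact mul_le_mul_of_nonneg_left (abs_mollify_le (h1 k) (hC1 k) i x) (abs_nonneg _)
    · refine (Finset.abs_sum_le_sum_abs _ _).trans (Finset.sum_le_sum fun j _ => ?_)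
      refine (Finset.abs_sum_le_sum_abs _ _).trans (Finset.sum_le_sum fun k _ => ?_)
      rw [abs_mul]
      exact mul_le_mul_of_nonneg_left (abs_mollify_le (h2 j k) (hC2 j k) i x) (abs_nonneg _)
  · rw [laplaceBeltrami_eq_zero_of_notMem fun h => hx (tsupport_mollify_subset hR i h)]
    simp

end Mollify

end

end BlowUpAE

namespace BlowUpAE

noncomputable section

open Set

/-! ### Pairings with respect to the Riemannian volume -/

section Pairing

variable {n : ℕ} {g : E n → Matrix (Fin n) (Fin n) ℝ}

/-- The mass of `|f|` in a ball with respect to the Riemannian volume. -/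
def locMass (g : E n → Matrix (Fin n) (Fin n) ℝ) (R : ℝ) (f : E n → ℝ) : ℝ :=
  ∫ x in Metric.closedBall 0 R, |f x| * volDensity g x

theorem integrableOn_mul_volDensity (hv : Continuous (volDensity g)) {R : ℝ} {f : E n → ℝ}
    (hf : IntegrableOn f (Metric.closedBall 0 R)) :
    IntegrableOn (fun x => f x * volDensity g x) (Metric.closedBall 0 R) :=
  hf.mul_continuousOn hv.continuousOn (isCompact_closedBall 0 R)

theorem pairing_eq_setIntegral {R : ℝ} {f ψ : E n → ℝ}
    (hs : ∀ x, x ∉ Metric.closedBall (0 : E n) R → ψ x = 0) :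
    pairing g f ψ = ∫ x in Metric.closedBall 0 R, f x * ψ x * volDensity g x :=
  (setIntegral_eq_integral_of_forall_compl_eq_zero fun x hx => by rw [hs x hx]; ring).symm

theorem integrable_pairing (hv : Continuous (volDensity g)) {R : ℝ} {f ψ : E n → ℝ}
    (hψ : Continuous ψ) (hs : ∀ x, x ∉ Metric.closedBall (0 : E n) R → ψ x = 0)
    (hf : IntegrableOn f (Metric.closedBall 0 R)) :
    Integrable (fun x => f x * ψ x * volDensity g x) := by
  have h1 : IntegrableOn (fun x => f x * ψ x * volDensity g x) (Metric.closedBall 0 R) :=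
    integrableOn_mul_volDensity hv
      (hf.mul_continuousOn hψ.continuousOn (isCompact_closedBall 0 R))
  rw [← integrableOn_univ]
  refine h1.of_forall_sdiff_eq_zero MeasurableSet.univ fun x hx => ?_
  rw [hs x hx.2]; ring

theorem abs_pairing_le (hv : Continuous (volDensity g)) (hv0 : ∀ x, 0 ≤ volDensity g x)
    {R C : ℝ} {f ψ : E n → ℝ} (hψ : ∀ x, |ψ x| ≤ C)
    (hs : ∀ x, x ∉ Metric.closedBall (0 : E n) R → ψ x = 0)
    (hf : IntegrableOn f (Metric.closedBall 0 R)) : |pairing g f ψ| ≤ C * locMass g R f := by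
  rw [pairing_eq_setIntegral hs, locMass, ← integral_const_mul]
  have hm : IntegrableOn (fun x => C * (|f x| * volDensity g x)) (Metric.closedBall 0 R) :=
    (integrableOn_mul_volDensity hv hf.abs).const_mul C
  refine norm_integral_le_of_norm_le (f := fun x => f x * ψ x * volDensity g x) hm
    (Filter.Eventually.of_forall fun x => ?_)
  rw [Real.norm_eq_abs, abs_mul, abs_mul, abs_of_nonneg (hv0 x)]
  have := mul_le_mul_of_nonneg_right (hψ x) (mul_nonneg (abs_nonneg (f x)) (hv0 x))
  linarith

theorem tendsto_pairing (hv : Continuous (volDensity g)) (hv0 : ∀ x, 0 ≤ volDensity g x)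
    {R C : ℝ} {f ψ : E n → ℝ} {ψs : ℕ → E n → ℝ} (hψc : ∀ i, Continuous (ψs i))
    (hψ : ∀ i x, |ψs i x| ≤ C)
    (hs : ∀ i x, x ∉ Metric.closedBall (0 : E n) R → ψs i x = 0)
    (hlim : ∀ x, Filter.Tendsto (fun i => ψs i x) Filter.atTop (nhds (ψ x)))
    (hf : IntegrableOn f (Metric.closedBall 0 R)) :
    Filter.Tendsto (fun i => pairing g f (ψs i)) Filter.atTop (nhds (pairing g f ψ)) := by
  have hs0 : ∀ x, x ∉ Metric.closedBall (0 : E n) R → ψ x = 0 := fun x hx =>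
    tendsto_nhds_unique (hlim x) (by simp only [hs _ x hx]; exact tendsto_const_nhds)
  rw [pairing_eq_setIntegral hs0]
  simp only [fun i => pairing_eq_setIntegral (g := g) (f := f) (hs i)]
  refine tendsto_integral_of_dominated_convergence (fun x => C * (|f x| * volDensity g x))
    (fun i => ?_) ((integrableOn_mul_volDensity hv hf.abs).const_mul C) (fun i => ?_) ?_
  · exact (integrable_pairing hv (hψc i) (hs i) hf).aestronglyMeasurable.restrict
  · refine Filter.Eventually.of_forall fun x => ?_
    rw [Real.norm_eq_abs, abs_mul, abs_mul, abs_of_nonneg (hv0 x)]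
    have := mul_le_mul_of_nonneg_right (hψ i x) (mul_nonneg (abs_nonneg (f x)) (hv0 x))
    linarith
  · refine Filter.Eventually.of_forall fun x => ?_
    exact ((hlim x).const_mul _).mul_const _

end Pairing

/-! ### Integrability of weak solutions and the equation tested with smooth functions -/

namespace IsWeakSolution

variable {n : ℕ} {g : E n → Matrix (Fin n) (Fin n) ℝ} {b : ℝ → ℝ} {c₁ c₂ p q : ℝ}
  {f₀ f₁ : E n → ℝ} {T : EReal} {u v : ℝ → E n → ℝ}

theorem Icc_subset {S : ℝ} (hS : S ∈ timeInterval T) : Icc 0 S ⊆ timeInterval T :=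
  fun _ ht => ⟨ht.1, (EReal.coe_le_coe_iff.2 ht.2).trans_lt hS.2⟩

theorem timeInterval_mem_nhds {t : ℝ} (h0 : 0 < t) (ht : t ∈ timeInterval T) :
    timeInterval T ∈ nhds t := by
  have h1 : {s : ℝ | (s : EReal) < T} ∈ nhds t :=
    (isOpen_Iio.preimage continuous_coe_real_ereal).mem_nhds ht.2
  filter_upwards [lt_mem_nhds h0, h1] with s hs hs' using ⟨hs.le, hs'⟩

theorem exists_timeInterval_gt {t : ℝ} (ht : t ∈ timeInterval T) :
    ∃ s, t < s ∧ s ∈ timeInterval T := by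
  obtain ⟨s, hs1, hs2⟩ := EReal.lt_iff_exists_real_btwn.1 ht.2
  exact ⟨s, by exact_mod_cast hs1, ⟨ht.1.trans (by exact_mod_cast hs1.le), hs2⟩⟩

theorem uniqueDiffOn_timeInterval : UniqueDiffOn ℝ (timeInterval T) := by
  intro t ht
  obtain ⟨s, hs, hsT⟩ := exists_timeInterval_gt ht
  exact ((uniqueDiffOn_Icc (ht.1.trans_lt hs)) t ⟨ht.1, hs.le⟩).mono (Icc_subset hsT)

theorem integrableOn_pow (h : IsWeakSolution g b c₁ c₂ p q f₀ f₁ T u v) {t : ℝ}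
    (ht : t ∈ timeInterval T) (R : ℝ) :
    IntegrableOn (fun x => |u t x| ^ q) (Metric.closedBall 0 R) :=
  (h.powLocInt t ht).integrableOn_isCompact (isCompact_closedBall 0 R)

theorem abs_le_one_add_rpow {q : ℝ} (hq : 1 ≤ q) (x : ℝ) : |x| ≤ 1 + |x| ^ q := by
  rcases le_total |x| 1 with h | h
  · have := Real.rpow_nonneg (abs_nonneg x) q; linarith
  · have := Real.rpow_le_rpow_of_exponent_le h hq
    rw [Real.rpow_one] at this; linarith

theorem integrableOn (h : IsWeakSolution g b c₁ c₂ p q f₀ f₁ T u v) (hq : 1 ≤ q) {t : ℝ}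
    (ht : t ∈ timeInterval T) (R : ℝ) : IntegrableOn (u t) (Metric.closedBall 0 R) := by
  have hone : IntegrableOn (fun _ : E n => (1 : ℝ)) (Metric.closedBall 0 R) :=
    continuousOn_const.integrableOn_compact (isCompact_closedBall 0 R)
  refine Integrable.mono' (hone.add (h.integrableOn_pow ht R)) (h.meas t ht).restrict
    (Filter.Eventually.of_forall fun x => ?_)
  exact abs_le_one_add_rpow hq _

/-- A smooth cutoff to a ball. -/
def ballBump (n : ℕ) (R : ℝ) : ContDiffBump (0 : E n) where
  rIn := max R 0 + 1
  rOut := max R 0 + 2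
  rIn_pos := by positivity
  rIn_lt_rOut := by linarith

theorem isTest_ballBump (R : ℝ) : IsTest (ballBump n R) :=
  ⟨(ballBump n R).contDiff, (ballBump n R).hasCompactSupport⟩

theorem ballBump_eq_one {R : ℝ} {x : E n} (hx : ‖x‖ ≤ R + 1) : ballBump n R x = 1 := by
  refine (ballBump n R).one_of_mem_closedBall ?_
  rw [mem_closedBall_zero_iff]
  change ‖x‖ ≤ max R 0 + 1
  linarith [le_max_left R 0]

theorem ballBump_eq_zero {R : ℝ} (hR : 0 ≤ R) {x : E n}
    (hx : x ∉ Metric.closedBall (0 : E n) (R + 2)) : ballBump n R x = 0 := by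
  refine (ballBump n R).zero_of_le_dist ?_
  rw [mem_closedBall_zero_iff, not_le] at hx
  rw [dist_zero_right]
  change max R 0 + 2 ≤ ‖x‖
  rw [max_eq_left hR]; linarith

/-- Uniformity in time comes from the continuity of |u|^q as a distribution: its pairing with a bump
function equal to 1 on the ball is bounded on the compact time interval. -/
theorem exists_locMass_pow_le (h : IsWeakSolution g b c₁ c₂ p q f₀ f₁ T u v)
    (hv : Continuous (volDensity g)) (hv0 : ∀ x, 0 ≤ volDensity g x) {S : ℝ}
    (hS : S ∈ timeInterval T) {R : ℝ} (hR : 0 ≤ R) :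
    ∃ C, ∀ t ∈ Icc 0 S, locMass g R (fun x => |u t x| ^ q) ≤ C := by
  obtain ⟨C, hC⟩ := isCompact_Icc.exists_bound_of_continuousOn
    ((h.powCont _ (isTest_ballBump (n := n) R)).mono (Icc_subset hS))
  refine ⟨C, fun t ht => le_trans ?_ ((le_abs_self _).trans (hC t ht))⟩
  have hi := h.integrableOn_pow (Icc_subset hS ht) (R + 2)
  have hi2 := integrable_pairing hv (ballBump n R).continuous (fun x hx => ballBump_eq_zero hR hx) hi
  unfold pairing locMass
  rw [← integral_indicator measurableSet_closedBall]
  have hpw : ∀ x, 0 ≤ |u t x| ^ q := fun x => Real.rpow_nonneg (abs_nonneg _) _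
  refine integral_mono_of_nonneg (Filter.Eventually.of_forall fun x => ?_) hi2
    (Filter.Eventually.of_forall fun x => ?_)
  · exact indicator_nonneg (fun y _ => mul_nonneg (abs_nonneg _) (hv0 y)) x
  · by_cases hx : x ∈ Metric.closedBall (0 : E n) R
    · rw [indicator_of_mem hx]
      rw [mem_closedBall_zero_iff] at hx
      simp only [ballBump_eq_one (show ‖x‖ ≤ R + 1 by linarith), mul_one, abs_of_nonneg (hpw x),
        le_refl]
    · rw [indicator_of_notMem hx]
      exact mul_nonneg (mul_nonneg (hpw x) (ballBump n R).nonneg) (hv0 x)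

theorem exists_locMass_le (h : IsWeakSolution g b c₁ c₂ p q f₀ f₁ T u v) (hq : 1 ≤ q)
    (hv : Continuous (volDensity g)) (hv0 : ∀ x, 0 ≤ volDensity g x) {S : ℝ}
    (hS : S ∈ timeInterval T) {R : ℝ} (hR : 0 ≤ R) :
    ∃ C, ∀ t ∈ Icc 0 S, locMass g R (u t) ≤ C := by
  obtain ⟨C, hC⟩ := h.exists_locMass_pow_le hv hv0 hS hR
  have hone : IntegrableOn (volDensity g) (Metric.closedBall 0 R) :=
    hv.continuousOn.integrableOn_compact (isCompact_closedBall 0 R)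
  refine ⟨(∫ x in Metric.closedBall 0 R, volDensity g x) + C, fun t ht => ?_⟩
  have hi := h.integrableOn_pow (Icc_subset hS ht) R
  refine le_trans ?_ (add_le_add_right (hC t ht) _)
  unfold locMass
  rw [← integral_add hone (integrableOn_mul_volDensity hv hi.abs)]
  refine integral_mono (integrableOn_mul_volDensity hv (h.integrableOn hq (Icc_subset hS ht) R).abs)
    (hone.add (integrableOn_mul_volDensity hv hi.abs)) fun x => ?_
  have h1 := mul_le_mul_of_nonneg_right (abs_le_one_add_rpow hq (u t x)) (hv0 x)
  simp only [abs_of_nonneg (Real.rpow_nonneg (abs_nonneg (u t x)) q)]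
  linarith

theorem integrable_velocity_pow (h : IsWeakSolution g b c₁ c₂ p q f₀ f₁ T u v) (hp : 1 ≤ p)
    {S : ℝ} (hS : S ∈ timeInterval T) (R : ℝ) :
    Integrable (fun z : ℝ × E n => |v z.1 z.2| ^ p)
      ((volume.restrict (Icc 0 S)).prod (volume.restrict (Metric.closedBall 0 R))) := by
  have := (h.memLp S hS R).integrable_norm_rpow
    (by rw [Ne, ENNReal.ofReal_eq_zero, not_le]; linarith) ENNReal.ofReal_ne_top
  rw [ENNReal.toReal_ofReal (by linarith), Measure.volume_eq_prod, ← Measure.prod_restrict] at this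
  exact this

theorem integrable_velocity (h : IsWeakSolution g b c₁ c₂ p q f₀ f₁ T u v) (hp : 1 ≤ p)
    {S : ℝ} (hS : S ∈ timeInterval T) (R : ℝ) :
    Integrable (fun z : ℝ × E n => v z.1 z.2)
      ((volume.restrict (Icc 0 S)).prod (volume.restrict (Metric.closedBall 0 R))) := by
  have : IsFiniteMeasure (volume.restrict (Metric.closedBall (0 : E n) R)) :=
    ⟨by rw [Measure.restrict_apply_univ]; exact (isCompact_closedBall 0 R).measure_lt_top⟩
  have hm := h.memLp S hS R
  rw [Measure.volume_eq_prod, ← Measure.prod_restrict] at hm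
  exact hm.integrable (by rw [← ENNReal.ofReal_one]; exact ENNReal.ofReal_le_ofReal hp)

theorem ae_integrableOn_velocity (h : IsWeakSolution g b c₁ c₂ p q f₀ f₁ T u v) (hp : 1 ≤ p)
    {S : ℝ} (hS : S ∈ timeInterval T) (R : ℝ) :
    ∀ᵐ t, t ∈ Icc 0 S → IntegrableOn (v t) (Metric.closedBall 0 R) := by
  rw [← ae_restrict_iff' measurableSet_Icc]
  exact (h.integrable_velocity hp hS R).prod_right_ae

theorem ae_integrableOn_velocity_pow (h : IsWeakSolution g b c₁ c₂ p q f₀ f₁ T u v) (hp : 1 ≤ p)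
    {S : ℝ} (hS : S ∈ timeInterval T) (R : ℝ) :
    ∀ᵐ t, t ∈ Icc 0 S → IntegrableOn (fun x => |v t x| ^ p) (Metric.closedBall 0 R) := by
  rw [← ae_restrict_iff' measurableSet_Icc]
  exact (h.integrable_velocity_pow hp hS R).prod_right_ae

theorem integrable_locMass_velocity_pow (h : IsWeakSolution g b c₁ c₂ p q f₀ f₁ T u v)
    (hp : 1 ≤ p) (hv : Continuous (volDensity g)) {S : ℝ} (hS : S ∈ timeInterval T) (R : ℝ) :
    IntegrableOn (fun t => locMass g R (fun x => |v t x| ^ p)) (Icc 0 S) := by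
  have h1 := h.integrable_velocity_pow hp hS R
  obtain ⟨C, hC⟩ := (isCompact_closedBall (0 : E n) R).exists_bound_of_continuousOn hv.continuousOn
  have h2 : Integrable (fun z : ℝ × E n => |v z.1 z.2| ^ p * volDensity g z.2)
      ((volume.restrict (Icc 0 S)).prod (volume.restrict (Metric.closedBall 0 R))) := by
    refine h1.mul_bdd (c := C) (hv.comp continuous_snd).aestronglyMeasurable ?_
    rw [Measure.prod_restrict]
    refine (ae_restrict_iff' (measurableSet_Icc.prod measurableSet_closedBall)).2
      (Filter.Eventually.of_forall fun z hz => hC z.2 hz.2)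
  have h3 := h2.integral_prod_left
  refine h3.congr (Filter.Eventually.of_forall fun t => ?_)
  simp only [locMass, abs_of_nonneg (Real.rpow_nonneg (abs_nonneg _) p)]

/-- The forcing of the ordinary differential equation obtained by testing with `ψ`. -/
def source (g : E n → Matrix (Fin n) (Fin n) ℝ) (c₁ c₂ p q : ℝ) (u v : ℝ → E n → ℝ)
    (ψ : E n → ℝ) (t : ℝ) : ℝ :=
  c₁ * pairing g (fun x => |v t x| ^ p) ψ + c₂ * pairing g (fun x => |u t x| ^ q) ψ

/-- The forcing together with the elliptic term. -/
def totalSource (g : E n → Matrix (Fin n) (Fin n) ℝ) (c₁ c₂ p q : ℝ) (u v : ℝ → E n → ℝ)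
    (ψ : E n → ℝ) (t : ℝ) : ℝ :=
  pairing g (u t) (laplaceBeltrami g ψ) + source g c₁ c₂ p q u v ψ t

/-- The velocity reconstructed from the initial velocity `D₀` and the forcing `Q`. -/
def velocityOf (b : ℝ → ℝ) (D₀ : ℝ) (Q : ℝ → ℝ) (t : ℝ) : ℝ :=
  (damp b t)⁻¹ * (D₀ + ∫ s in (0 : ℝ)..t, damp b s * Q s)

/-- The integrated form of the equation tested with `ψ`. -/
structure TestedIdentity (g : E n → Matrix (Fin n) (Fin n) ℝ) (b : ℝ → ℝ) (c₁ c₂ p q : ℝ)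
    (f₁ : E n → ℝ) (u v : ℝ → E n → ℝ) (S : ℝ) (ψ : E n → ℝ) : Prop where
  integrable : IntegrableOn (totalSource g c₁ c₂ p q u v ψ) (Icc 0 S)
  position : ∀ t ∈ Icc 0 S, pairing g (u t) ψ = pairing g (u 0) ψ +
    ∫ s in (0 : ℝ)..t, velocityOf b (pairing g f₁ ψ) (totalSource g c₁ c₂ p q u v ψ) s
  velocity : ∀ᵐ t, t ∈ Icc 0 S →
    velocityOf b (pairing g f₁ ψ) (totalSource g c₁ c₂ p q u v ψ) t = pairing g (v t) ψ

/-- For a smooth test function the pairing is C² in time. With the integrating factor exp(∫b) the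
equation reads (exp(∫b) D)' = exp(∫b) Q almost everywhere, and it is integrated by absolute
continuity. -/
theorem testedIdentity_of_isTest (h : IsWeakSolution g b c₁ c₂ p q f₀ f₁ T u v)
    (hb : IntegrableOn b (Ioi 0)) {S : ℝ} (hS : S ∈ timeInterval T) {ψ : E n → ℝ}
    (hψ : IsTest ψ) : TestedIdentity g b c₁ c₂ p q f₁ u v S ψ := by
  set I := timeInterval T with hI
  have hsub : Icc 0 S ⊆ I := Icc_subset hS
  have hU : UniqueDiffOn ℝ I := uniqueDiffOn_timeInterval
  set F : ℝ → ℝ := fun t => pairing g (u t) ψ with hF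
  have hC : ContDiffOn ℝ 2 F I := h.contDiff ψ hψ
  set D := derivWithin F I with hD
  have hDC : ContDiffOn ℝ 1 D I := ((contDiffOn_succ_iff_derivWithin (n := 1) hU).1 hC).2.2
  have hDac : AbsolutelyContinuousOnInterval D 0 S := by
    refine (hDC.mono ?_).absolutelyContinuousOnInterval
    rw [uIcc_of_le hS.1]; exact hsub
  have hD'c : ContinuousOn (derivWithin D I) I := hDC.continuousOn_derivWithin hU le_rfl
  have hDd : ∀ᵐ t : ℝ, t ∈ Icc 0 S → HasDerivAt D (derivWithin D I t) t := by
    -- At t = 0 only a one-sided derivative exists; the single point is discarded.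
    have : ∀ᵐ t : ℝ, t ≠ 0 := by simp [ae_iff]
    filter_upwards [this] with t ht0 ht
    exact ((hDC.differentiableOn one_ne_zero t (hsub ht)).hasDerivWithinAt).hasDerivAt
      (timeInterval_mem_nhds (lt_of_le_of_ne ht.1 (Ne.symm ht0)) (hsub ht))
  have heq : ∀ᵐ t : ℝ, t ∈ Icc 0 S → derivWithin D I t + b t * D t =
      totalSource g c₁ c₂ p q u v ψ t := by
    filter_upwards [h.equation ψ hψ] with t h1 ht
    have := h1 (hsub ht)
    rw [iteratedDerivWithin_succ, iteratedDerivWithin_one] at this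
    simp only [totalSource, source]
    linarith
  have hbS : IntegrableOn b (Icc 0 S) := by
    rw [integrableOn_Icc_iff_integrableOn_Ioc]
    exact hb.mono_set Ioc_subset_Ioi_self
  -- The total source inherits its integrability from the equation, being almost everywhere equal to
  -- D' + bD.
  have hint : IntegrableOn (totalSource g c₁ c₂ p q u v ψ) (Icc 0 S) := by
    have h1 : IntegrableOn (derivWithin D I) (Icc 0 S) :=
      (hD'c.mono hsub).integrableOn_compact isCompact_Icc
    have h2 : IntegrableOn (fun t => b t * D t) (Icc 0 S) :=
      hbS.mul_continuousOn (hDC.continuousOn.mono hsub) isCompact_Icc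
    refine (h1.add h2).congr ?_
    exact (ae_restrict_iff' measurableSet_Icc).2 heq
  have hvel : ∀ t ∈ Icc 0 S,
      velocityOf b (pairing g f₁ ψ) (totalSource g c₁ c₂ p q u v ψ) t = D t := by
    intro t ht
    have hac : AbsolutelyContinuousOnInterval (fun t => damp b t * D t) 0 t := by
      refine ((ac_damp hb hS.1).fun_mul hDac).mono ?_
      rw [uIcc_of_le ht.1, uIcc_of_le hS.1]; exact Icc_subset_Icc le_rfl ht.2
    have hi := hac.integral_deriv_eq_sub
    have hcongr : (∫ s in (0 : ℝ)..t, damp b s * totalSource g c₁ c₂ p q u v ψ s) =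
        ∫ s in (0 : ℝ)..t, deriv (fun t => damp b t * D t) s := by
      refine intervalIntegral.integral_congr_ae ?_
      filter_upwards [heq, hDd, ae_hasDerivAt_damp hb hS.1] with s h1 h2 h3 hs
      rw [uIoc_of_le ht.1] at hs
      have hs' : s ∈ Icc 0 S := ⟨hs.1.le, hs.2.trans ht.2⟩
      rw [((h3 hs').fun_mul (h2 hs')).deriv, ← h1 hs']
      ring
    have hD0 : D 0 = pairing g f₁ ψ := h.initialVelocity ψ hψ
    rw [velocityOf, hcongr, hi, damp_zero, hD0]
    have := (damp_pos b t).ne'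
    field_simp
    ring
  refine ⟨hint, fun t ht => ?_, ?_⟩
  · have hFac : AbsolutelyContinuousOnInterval F 0 t := by
      refine ((hC.of_le (by norm_num)).mono ?_).absolutelyContinuousOnInterval
      rw [uIcc_of_le ht.1]; exact (Icc_subset_Icc le_rfl ht.2).trans hsub
    have hi := hFac.integral_deriv_eq_sub
    have hcongr : (∫ s in (0 : ℝ)..t,
        velocityOf b (pairing g f₁ ψ) (totalSource g c₁ c₂ p q u v ψ) s) =
        ∫ s in (0 : ℝ)..t, deriv F s := by
      refine intervalIntegral.integral_congr_ae (Filter.Eventually.of_forall fun s hs => ?_)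
      rw [uIoc_of_le ht.1] at hs
      have hs' : s ∈ Icc 0 S := ⟨hs.1.le, hs.2.trans ht.2⟩
      rw [hvel s hs', hD, derivWithin_of_mem_nhds (timeInterval_mem_nhds hs.1 (hsub hs'))]
    rw [hcongr, hi]
    simp [hF]
  · filter_upwards [h.timeDeriv ψ hψ] with t h1 ht
    rw [hvel t ht]
    exact h1 (hsub ht)

end IsWeakSolution

end

end BlowUpAE

namespace BlowUpAE

noncomputable section

open Set

/-! ### Extension of the tested equation to C² test functions -/

namespace IsWeakSolution

variable {n : ℕ} {g : E n → Matrix (Fin n) (Fin n) ℝ} {b : ℝ → ℝ} {c₁ c₂ p q : ℝ}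
  {f₀ f₁ : E n → ℝ} {T : EReal} {u v : ℝ → E n → ℝ}

theorem continuousOn_velocityOf (hb : IntegrableOn b (Ioi 0)) {S : ℝ} (hS : 0 ≤ S) (D₀ : ℝ)
    {Q : ℝ → ℝ} (hQ : IntegrableOn Q (Icc 0 S)) : ContinuousOn (velocityOf b D₀ Q) (Icc 0 S) := by
  have hdc : ContinuousOn (damp b) (Icc 0 S) := by
    have := (ac_damp hb hS).continuousOn; rwa [uIcc_of_le hS] at this
  have hi : IntegrableOn (fun s => damp b s * Q s) (Icc 0 S) :=
    hQ.continuousOn_mul hdc isCompact_Icc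
  have h2 : ContinuousOn (fun t => ∫ s in (0 : ℝ)..t, damp b s * Q s) (Icc 0 S) :=
    intervalIntegral.continuousOn_primitive_interval (by rwa [uIcc_of_le hS]) |>.mono
      (by rw [uIcc_of_le hS])
  exact (hdc.inv₀ fun t _ => (damp_pos b t).ne').mul (continuousOn_const.add h2)

theorem inv_damp_le (hb : IntegrableOn b (Ioi 0)) {t : ℝ} (ht : 0 ≤ t) :
    (damp b t)⁻¹ ≤ Real.exp (dampMass b) := by
  rw [inv_le_comm₀ (damp_pos b t) (Real.exp_pos _), ← Real.exp_neg]
  exact le_damp hb ht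

/-- The integrated identity involves ψ only through ψ and its Laplacian, undifferentiated in time.
Both converge pointwise and boundedly, with supports in a fixed ball, along mollifications;
dominated convergence in x and then in t passes to the limit. -/
theorem testedIdentity_of_contDiff (h : IsWeakSolution g b c₁ c₂ p q f₀ f₁ T u v)
    (hgp : ∀ x, (g x).PosDef) (hgc : ∀ j k, ContDiff ℝ 2 (fun x => g x j k))
    (hb : IntegrableOn b (Ioi 0)) (hp : 1 ≤ p) (hq : 1 ≤ q) (hf₁ : Continuous f₁) {S : ℝ}
    (hS : S ∈ timeInterval T) {ψ : E n → ℝ} (hψ : ContDiff ℝ 2 ψ) (hψc : HasCompactSupport ψ) :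
    TestedIdentity g b c₁ c₂ p q f₁ u v S ψ := by
  have hv := continuous_volDensity hgp hgc
  have hv0 : ∀ x, 0 ≤ volDensity g x := fun x => (volDensity_pos hgp x).le
  obtain ⟨R₀, hR₀⟩ := hψc.isCompact.isBounded.subset_closedBall 0
  set R := max R₀ 0 + 1 with hR
  have hR0 : 0 ≤ R := by positivity
  have hsupp : tsupport ψ ⊆ Metric.closedBall 0 (max R₀ 0) :=
    hR₀.trans (Metric.closedBall_subset_closedBall (le_max_left _ _))
  set ψs : ℕ → E n → ℝ := fun i => mollify i ψ with hψs
  have htest : ∀ i, IsTest (ψs i) := fun i => isTest_mollify hψ.continuous hψc i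
  have hid := fun i => h.testedIdentity_of_isTest hb hS (htest i)
  obtain ⟨C₀, hC₀⟩ := exists_abs_le hψ.continuous hψc
  obtain ⟨C₂, hC₂⟩ := exists_bound_laplaceBeltrami_mollify hgp hgc hψ hψc
  have hψsC : ∀ i x, |ψs i x| ≤ 3 * C₀ := fun i x => abs_mollify_le hψ.continuous hC₀ i x
  have hC₀0 : 0 ≤ 3 * C₀ := (abs_nonneg _).trans (hψsC 0 0)
  have hC₂0 : 0 ≤ C₂ := (abs_nonneg _).trans (hC₂ 0 0)
  have hψsS : ∀ i x, x ∉ Metric.closedBall (0 : E n) R → ψs i x = 0 := fun i x hx =>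
    image_eq_zero_of_notMem_tsupport fun hm => hx (tsupport_mollify_subset hsupp i hm)
  have hLS : ∀ i x, x ∉ Metric.closedBall (0 : E n) R → laplaceBeltrami g (ψs i) x = 0 :=
    fun i x hx => laplaceBeltrami_eq_zero_of_notMem
      fun hm => hx (tsupport_mollify_subset hsupp i hm)
  have hLc : ∀ i, Continuous (laplaceBeltrami g (ψs i)) := fun i =>
    continuous_laplaceBeltrami hgp hgc (contDiff_infty.1 (htest i).1 2)
  have hψsc : ∀ i, Continuous (ψs i) := fun i => (htest i).1.continuous
  have hlim : ∀ x, Filter.Tendsto (fun i => ψs i x) Filter.atTop (nhds (ψ x)) :=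
    tendsto_mollify hψ.continuous
  have hpair : ∀ f : E n → ℝ, IntegrableOn f (Metric.closedBall 0 R) →
      Filter.Tendsto (fun i => pairing g f (ψs i)) Filter.atTop (nhds (pairing g f ψ)) :=
    fun f hf => tendsto_pairing hv hv0 hψsc hψsC hψsS hlim hf
  have hpairL : ∀ f : E n → ℝ, IntegrableOn f (Metric.closedBall 0 R) →
      Filter.Tendsto (fun i => pairing g f (laplaceBeltrami g (ψs i))) Filter.atTop
        (nhds (pairing g f (laplaceBeltrami g ψ))) :=
    fun f hf => tendsto_pairing hv hv0 hLc hC₂ hLS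
      (tendsto_laplaceBeltrami_mollify hgp hgc hψ hψc) hf
  obtain ⟨A, hA⟩ := h.exists_locMass_le hq hv hv0 hS hR0
  obtain ⟨A', hA'⟩ := h.exists_locMass_pow_le hv hv0 hS hR0
  set Q : ℝ → ℝ := totalSource g c₁ c₂ p q u v ψ with hQ
  set Qs : ℕ → ℝ → ℝ := fun i => totalSource g c₁ c₂ p q u v (ψs i) with hQs
  -- The majorant in time: the terms with u and |u|^q are uniformly bounded on [0, S], while the one
  -- with |v|^p is only integrable in t.
  set bd : ℝ → ℝ := fun t => (C₂ * A + |c₂| * (3 * C₀ * A')) +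
    |c₁| * (3 * C₀) * locMass g R (fun x => |v t x| ^ p) with hbd
  have hbdi : IntegrableOn bd (Icc 0 S) :=
    (continuousOn_const.integrableOn_compact isCompact_Icc).add
      ((h.integrable_locMass_velocity_pow hp hv hS R).const_mul _)
  have hQlim : ∀ᵐ t, t ∈ Icc 0 S → Filter.Tendsto (fun i => Qs i t) Filter.atTop (nhds (Q t)) := by
    filter_upwards [h.ae_integrableOn_velocity_pow hp hS R] with t h1 ht
    exact (hpairL _ (h.integrableOn hq (Icc_subset hS ht) R)).add
      (((hpair _ (h1 ht)).const_mul _).add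
        ((hpair _ (h.integrableOn_pow (Icc_subset hS ht) R)).const_mul _))
  have hQbd : ∀ i, ∀ᵐ t, t ∈ Icc 0 S → |Qs i t| ≤ bd t := by
    intro i
    filter_upwards [h.ae_integrableOn_velocity_pow hp hS R] with t h1 ht
    have e1 := abs_pairing_le hv hv0 (hC₂ i) (hLS i) (h.integrableOn hq (Icc_subset hS ht) R)
    have e2 := abs_pairing_le hv hv0 (hψsC i) (hψsS i) (h1 ht)
    have e3 := abs_pairing_le hv hv0 (hψsC i) (hψsS i)
      (h.integrableOn_pow (Icc_subset hS ht) R)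
    have e1' := e1.trans (mul_le_mul_of_nonneg_left (hA t ht) hC₂0)
    have e3' := e3.trans (mul_le_mul_of_nonneg_left (hA' t ht) hC₀0)
    simp only [hQs, totalSource, source, hbd]
    refine (abs_add_le _ _).trans ?_
    refine (add_le_add_right (abs_add_le _ _) _).trans ?_
    rw [abs_mul, abs_mul]
    have e4 := mul_le_mul_of_nonneg_left e2 (abs_nonneg c₁)
    have e5 := mul_le_mul_of_nonneg_left e3' (abs_nonneg c₂)
    linarith
  -- Measurability of the limiting source is obtained as that of an almost everywhere limit.
  have hQint : IntegrableOn Q (Icc 0 S) := by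
    refine Integrable.mono' hbdi
      (aestronglyMeasurable_of_tendsto_ae Filter.atTop (fun i => (hid i).integrable.aestronglyMeasurable)
        ((ae_restrict_iff' measurableSet_Icc).2 hQlim)) ?_
    rw [ae_restrict_iff' measurableSet_Icc]
    filter_upwards [hQlim, ae_all_iff.2 hQbd] with t h1 h2 ht
    exact le_of_tendsto (h1 ht).norm (Filter.Eventually.of_forall fun i => h2 i ht)
  have hdc : ContinuousOn (damp b) (Icc 0 S) := by
    have := (ac_damp hb hS.1).continuousOn; rwa [uIcc_of_le hS.1] at this
  set M := Real.exp (dampMass b) with hM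
  have hM0 : 0 < M := Real.exp_pos _
  have hbdi' : IntegrableOn (fun s => M * bd s) (Icc 0 S) := hbdi.const_mul M
  have hintlim : ∀ t ∈ Icc 0 S, Filter.Tendsto (fun i => ∫ s in (0 : ℝ)..t, damp b s * Qs i s)
      Filter.atTop (nhds (∫ s in (0 : ℝ)..t, damp b s * Q s)) := by
    intro t ht
    have hsub : Ioc 0 t ⊆ Icc 0 S := fun s hs => ⟨hs.1.le, hs.2.trans ht.2⟩
    refine intervalIntegral.tendsto_integral_filter_of_dominated_convergence (fun s => M * bd s)
      (Filter.Eventually.of_forall fun i => ?_) (Filter.Eventually.of_forall fun i => ?_) ?_ ?_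
    · rw [uIoc_of_le ht.1]
      exact (((hid i).integrable.continuousOn_mul hdc isCompact_Icc).mono_set
        hsub).aestronglyMeasurable
    · filter_upwards [hQbd i] with s h1 hs
      rw [uIoc_of_le ht.1] at hs
      rw [Real.norm_eq_abs, abs_mul, abs_of_pos (damp_pos b s)]
      exact mul_le_mul (damp_le hb hs.1.le) (h1 (hsub hs)) (abs_nonneg _) hM0.le
    · rw [intervalIntegrable_iff, uIoc_of_le ht.1]
      exact hbdi'.mono_set hsub
    · filter_upwards [hQlim] with s h1 hs
      rw [uIoc_of_le ht.1] at hs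
      exact (h1 (hsub hs)).const_mul _
  have hf₁i : IntegrableOn f₁ (Metric.closedBall 0 R) :=
    hf₁.continuousOn.integrableOn_compact (isCompact_closedBall 0 R)
  have hvlim : ∀ t ∈ Icc 0 S, Filter.Tendsto
      (fun i => velocityOf b (pairing g f₁ (ψs i)) (Qs i) t) Filter.atTop
      (nhds (velocityOf b (pairing g f₁ ψ) Q t)) := fun t ht =>
    ((hpair f₁ hf₁i).add (hintlim t ht)).const_mul _
  set B := M * (3 * C₀ * locMass g R f₁ + ∫ s in Icc 0 S, M * bd s) with hB
  have hbd0 : ∀ᵐ s, s ∈ Icc 0 S → 0 ≤ M * bd s := by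
    filter_upwards [hQbd 0] with s h1 hs
    exact mul_nonneg hM0.le ((abs_nonneg _).trans (h1 hs))
  have hvbd : ∀ i, ∀ t ∈ Icc 0 S, |velocityOf b (pairing g f₁ (ψs i)) (Qs i) t| ≤ B := by
    intro i t ht
    have hsub : Ioc 0 t ⊆ Icc 0 S := fun s hs => ⟨hs.1.le, hs.2.trans ht.2⟩
    rw [velocityOf, abs_mul, abs_of_pos (inv_pos.2 (damp_pos b t))]
    refine mul_le_mul (inv_damp_le hb ht.1) ((abs_add_le _ _).trans (add_le_add ?_ ?_))
      (abs_nonneg _) hM0.le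
    · exact abs_pairing_le hv hv0 (hψsC i) (hψsS i) hf₁i
    · rw [intervalIntegral.integral_of_le ht.1]
      refine le_trans (norm_integral_le_of_norm_le (f := fun s => damp b s * Qs i s)
        (hbdi'.mono_set hsub) ?_)
        (setIntegral_mono_set hbdi' ?_ hsub.eventuallyLE)
      · rw [ae_restrict_iff' measurableSet_Ioc]
        filter_upwards [hQbd i] with s h1 hs
        rw [Real.norm_eq_abs, abs_mul, abs_of_pos (damp_pos b s)]
        exact mul_le_mul (damp_le hb hs.1.le) (h1 (hsub hs)) (abs_nonneg _) hM0.le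
      · rw [Filter.EventuallyLE, ae_restrict_iff' measurableSet_Icc]
        exact hbd0
  refine ⟨hQint, fun t ht => ?_, ?_⟩
  · have hsub : Ioc 0 t ⊆ Icc 0 S := fun s hs => ⟨hs.1.le, hs.2.trans ht.2⟩
    have h1 : Filter.Tendsto (fun i => ∫ s in (0 : ℝ)..t,
        velocityOf b (pairing g f₁ (ψs i)) (Qs i) s) Filter.atTop
        (nhds (∫ s in (0 : ℝ)..t, velocityOf b (pairing g f₁ ψ) Q s)) := by
      refine intervalIntegral.tendsto_integral_filter_of_dominated_convergence (fun _ => B)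
        (Filter.Eventually.of_forall fun i => ?_) (Filter.Eventually.of_forall fun i => ?_)
        (by simp) ?_
      · rw [uIoc_of_le ht.1]
        exact ((continuousOn_velocityOf hb hS.1 _ (hid i).integrable).mono
          hsub).aestronglyMeasurable measurableSet_Ioc
      · refine Filter.Eventually.of_forall fun s hs => ?_
        rw [uIoc_of_le ht.1] at hs
        exact hvbd i s (hsub hs)
      · refine Filter.Eventually.of_forall fun s hs => ?_
        rw [uIoc_of_le ht.1] at hs
        exact hvlim s (hsub hs)
    have h2 := hpair _ (h.integrableOn hq (Icc_subset hS ht) R)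
    have h3 := (hpair _ (h.integrableOn hq (Icc_subset hS ⟨le_rfl, hS.1⟩) R)).add h1
    refine tendsto_nhds_unique h2 (h3.congr fun i => ?_)
    exact ((hid i).position t ht).symm
  · filter_upwards [h.ae_integrableOn_velocity hp hS R,
      ae_all_iff.2 fun i => (hid i).velocity] with t h1 h2 ht
    refine tendsto_nhds_unique (hvlim t ht) ((hpair _ (h1 ht)).congr fun i => ?_)
    exact (h2 i ht).symm

/-- The position is represented by the primitive of the reconstructed velocity rather than by the
pairing itself. The two agree on [0, S], while the primitive is defined for all times and so has
two-sided derivatives almost everywhere. -/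
theorem TestedIdentity.dampedODE {S : ℝ} {ψ : E n → ℝ}
    (h : TestedIdentity g b c₁ c₂ p q f₁ u v S ψ) (hb : IntegrableOn b (Ioi 0)) (hS : 0 ≤ S)
    {μ : ℝ} (hμ : ∀ t ∈ Icc 0 S, pairing g (u t) (laplaceBeltrami g ψ) = μ * pairing g (u t) ψ)
    (hN : ∀ t ∈ Icc 0 S, 0 ≤ source g c₁ c₂ p q u v ψ t) :
    DampedODE b μ (source g c₁ c₂ p q u v ψ)
      (fun t => pairing g (u 0) ψ +
        ∫ s in (0 : ℝ)..t, velocityOf b (pairing g f₁ ψ) (totalSource g c₁ c₂ p q u v ψ) s)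
      (velocityOf b (pairing g f₁ ψ) (totalSource g c₁ c₂ p q u v ψ)) S := by
  set Q := totalSource g c₁ c₂ p q u v ψ with hQ
  set D := velocityOf b (pairing g f₁ ψ) Q with hD
  have hDc : ContinuousOn D (Icc 0 S) := continuousOn_velocityOf hb hS _ h.integrable
  have hDi : IntervalIntegrable D volume 0 S := by
    apply ContinuousOn.intervalIntegrable; rwa [uIcc_of_le hS]
  have hdc : ContinuousOn (damp b) (Icc 0 S) := by
    have := (ac_damp hb hS).continuousOn; rwa [uIcc_of_le hS] at this
  have hmQ : IntervalIntegrable (fun s => damp b s * Q s) volume 0 S := by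
    rw [intervalIntegrable_iff_integrableOn_Icc_of_le hS]
    exact h.integrable.continuousOn_mul hdc isCompact_Icc
  have hinvac : AbsolutelyContinuousOnInterval (fun t => (damp b t)⁻¹) 0 S := by
    refine ac_comp (F := fun x => x⁻¹) (U := Ioi 0) (ac_damp hb hS) ?_ fun t _ => damp_pos b t
    intro x hx
    exact (contDiffAt_inv ℝ (ne_of_gt hx)).contDiffWithinAt
  have hconst : ∀ c : ℝ, AbsolutelyContinuousOnInterval (fun _ => c) 0 S := fun c =>
    ac_of_contDiff contDiff_const _ _
  refine ⟨(hconst _).fun_add (ac_primitive hDi),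
    hinvac.fun_mul ((hconst _).fun_add (ac_primitive hmQ)), ?_, ?_, ?_⟩
  · filter_upwards [ae_hasDerivAt_primitive hS hDi] with t h1 ht
    exact (h1 ht).const_add _
  · filter_upwards [ae_hasDerivAt_primitive hS hmQ, ae_hasDerivAt_damp hb hS] with t h1 h2 ht
    have hd := (damp_pos b t).ne'
    refine (((h2 ht).fun_inv hd).fun_mul ((h1 ht).const_add (pairing g f₁ ψ))).congr_deriv ?_
    rw [← h.position t ht, ← hμ t ht]
    have e1 : pairing g (u t) (laplaceBeltrami g ψ) + source g c₁ c₂ p q u v ψ t = Q t := rfl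
    rw [show ∀ a b c : ℝ, a - b + c = (a + c) - b from fun a b c => by ring, e1]
    simp only [hD, velocityOf]
    field_simp
    ring
  · exact Filter.Eventually.of_forall hN

end IsWeakSolution

end

end BlowUpAE

namespace BlowUpAE

noncomputable section

open Set

/-! ### The strong maximum principle -/

section MaximumPrinciple

variable {n : ℕ} {g : E n → Matrix (Fin n) (Fin n) ℝ}

open scoped MatrixOrder in
theorem exists_sq_factor {A : Matrix (Fin n) (Fin n) ℝ} (hA : A.PosDef) :
    ∃ B : Matrix (Fin n) (Fin n) ℝ, ∀ j k, A j k = ∑ i, B i j * B i k := by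
  obtain ⟨B, hB⟩ := CStarAlgebra.nonneg_iff_eq_star_mul_self.mp hA.posSemidef.nonneg
  refine ⟨B, fun j k => ?_⟩
  rw [hB, Matrix.mul_apply]
  rfl

theorem fderiv_eq_sum_partialDeriv (f : E n → ℝ) (x w : E n) :
    fderiv ℝ f x w = ∑ k, w k * partialDeriv k f x := by
  have hw : w = ∑ k, w k • EuclideanSpace.single k (1 : ℝ) := by
    have := (EuclideanSpace.basisFun (Fin n) ℝ).sum_repr w
    simpa using this.symm
  conv_lhs => rw [hw]
  rw [map_sum]
  simp [partialDeriv]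

/-- The second derivative test along a line: a negative second derivative would make the point a
strict maximum candidate as well, so the function would be locally constant there and its second
derivative zero. -/
theorem secondDeriv_nonneg_of_isLocalMin {f : E n → ℝ} (hf : ContDiff ℝ 2 f) {x : E n}
    (hx : IsLocalMin f x) (w : Fin n → ℝ) :
    0 ≤ ∑ j, ∑ k, w j * w k * partialDeriv j (partialDeriv k f) x := by
  set w' : E n := WithLp.toLp 2 w with hw'
  set γ : ℝ → E n := fun s => x + s • w' with hγ
  have hγ0 : γ 0 = x := by simp [hγ]
  have hγd : ∀ s, HasDerivAt γ w' s := fun s =>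
    (((hasDerivAt_id s).smul_const w').const_add x).congr_deriv (one_smul ℝ w')
  have hγc : Continuous γ := by fun_prop
  have h1 : ∀ s, HasDerivAt (fun s => f (γ s)) (∑ k, w k * partialDeriv k f (γ s)) s := by
    intro s
    have := ((hf.differentiable (by norm_num)) (γ s)).hasFDerivAt.comp_hasDerivAt s (hγd s)
    rw [fderiv_eq_sum_partialDeriv] at this
    exact this
  have hd1 : deriv (fun s => f (γ s)) = fun s => ∑ k, w k * partialDeriv k f (γ s) :=
    funext fun s => (h1 s).deriv
  have h2 : HasDerivAt (fun s => ∑ k, w k * partialDeriv k f (γ s))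
      (∑ k, w k * ∑ j, w j * partialDeriv j (partialDeriv k f) x) 0 := by
    refine HasDerivAt.fun_sum fun k _ => HasDerivAt.const_mul _ ?_
    have hk := ((contDiff_partialDeriv (m := 1) hf (by norm_num) k).differentiable
      (by norm_num)) (γ 0)
    have := hk.hasFDerivAt.comp_hasDerivAt 0 (hγd 0)
    rw [fderiv_eq_sum_partialDeriv, hγ0] at this
    exact this
  have hval : ∑ k, w k * ∑ j, w j * partialDeriv j (partialDeriv k f) x =
      ∑ j, ∑ k, w j * w k * partialDeriv j (partialDeriv k f) x := by
    rw [Finset.sum_comm]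
    refine Finset.sum_congr rfl fun k _ => ?_
    rw [Finset.mul_sum]
    exact Finset.sum_congr rfl fun j _ => by ring
  rw [← hval]
  by_contra hneg
  push Not at hneg
  have hmin : IsLocalMin (fun s => f (γ s)) 0 := by
    have := hγc.tendsto 0
    rw [hγ0] at this
    filter_upwards [this.eventually hx] with s hs
    rwa [hγ0]
  have hdd : deriv (deriv (fun s => f (γ s))) 0 < 0 := by
    rw [hd1, h2.deriv]; exact hneg
  have hmax := isLocalMax_of_deriv_deriv_neg hdd hmin.deriv_eq_zero
    ((h1 0).continuousAt)
  have hconst : (fun s => f (γ s)) =ᶠ[nhds 0] fun _ => f (γ 0) := by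
    filter_upwards [hmin, hmax] with s h3 h4 using le_antisymm h4 h3
  have h5 := hconst.deriv.deriv_eq
  rw [h5] at hdd
  simp at hdd

/-- First derivatives vanish at the minimum. Writing the inverse matrix as BᵀB turns the principal
part into a sum of second derivatives along the rows of B. -/
theorem laplaceBeltrami_nonneg_of_isLocalMin (hp : ∀ x, (g x).PosDef)
    (hg : ∀ j k, ContDiff ℝ 2 (fun x => g x j k)) {f : E n → ℝ} (hf : ContDiff ℝ 2 f) {x : E n}
    (hx : IsLocalMin f x) : 0 ≤ laplaceBeltrami g f x := by
  rw [laplaceBeltrami_eq hp hg hf]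
  have h0 : ∀ k, partialDeriv k f x = 0 := fun k => by
    unfold partialDeriv; rw [hx.fderiv_eq_zero]; rfl
  simp only [h0, mul_zero, Finset.sum_const_zero, zero_add]
  obtain ⟨B, hB⟩ := exists_sq_factor (hp x).inv
  have : ∑ j, ∑ k, (g x)⁻¹ j k * partialDeriv j (partialDeriv k f) x =
      ∑ i, ∑ j, ∑ k, B i j * B i k * partialDeriv j (partialDeriv k f) x := by
    rw [Finset.sum_comm]
    simp only [hB, Finset.sum_mul]
    rw [Finset.sum_comm]
    rw [Finset.sum_comm (s := Finset.univ (α := Fin n)) (t := Finset.univ (α := Fin n))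
      (f := fun i j => ∑ k, B i j * B i k * partialDeriv j (partialDeriv k f) x)]
    exact Finset.sum_congr rfl fun j _ => Finset.sum_comm
  rw [this]
  exact Finset.sum_nonneg fun i _ => secondDeriv_nonneg_of_isLocalMin hf hx (B i)

/-- The Gaussian `exp (-α |x - y|²)`. -/
def gaussian (α : ℝ) (y x : E n) : ℝ := Real.exp (-α * ‖x - y‖ ^ 2)

theorem contDiff_gaussian (α : ℝ) (y : E n) : ContDiff ℝ 2 (gaussian α y) :=
  (contDiff_const.mul ((contDiff_id.sub contDiff_const).norm_sq ℝ)).exp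

theorem partialDeriv_gaussian (α : ℝ) (y : E n) (k : Fin n) :
    partialDeriv k (gaussian α y) = fun x => (-2 * α * (x k - y k)) * gaussian α y x := by
  funext x
  have h1 : HasFDerivAt (fun x : E n => ‖x - y‖ ^ 2) (2 • innerSL ℝ (x - y)) x := by
    simpa using (((hasFDerivAt_id x).sub_const y)).norm_sq
  have h2 := (h1.const_mul (-α)).exp
  unfold partialDeriv
  rw [show fderiv ℝ (gaussian α y) x = _ from h2.fderiv]
  simp [gaussian, EuclideanSpace.inner_single_right]
  ring

theorem partialDeriv_coord (c : ℝ) (y : E n) (j k : Fin n) (x : E n) :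
    partialDeriv j (fun x : E n => c * (x k - y k)) x = c * (if j = k then 1 else 0) := by
  have h1 : HasFDerivAt (fun x : E n => c * (x k - y k)) (c • EuclideanSpace.proj (𝕜 := ℝ) k) x :=
    (((EuclideanSpace.proj (𝕜 := ℝ) k).hasFDerivAt (x := x)).sub_const (y k)).const_mul c
  unfold partialDeriv
  rw [h1.fderiv]
  simp [eq_comm]

theorem partialDeriv_partialDeriv_gaussian (α : ℝ) (y : E n) (j k : Fin n) (x : E n) :
    partialDeriv j (partialDeriv k (gaussian α y)) x =
      gaussian α y x * (4 * α ^ 2 * ((x j - y j) * (x k - y k)) -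
        2 * α * (if j = k then 1 else 0)) := by
  rw [partialDeriv_gaussian, partialDeriv_mul _ ((contDiff_gaussian α y).differentiable
    (by norm_num) x), partialDeriv_coord, partialDeriv_gaussian]
  · ring
  · exact (((EuclideanSpace.proj (𝕜 := ℝ) k).differentiableAt (x := x)).sub_const (y k)).const_mul _

theorem laplaceBeltrami_gaussian (hp : ∀ x, (g x).PosDef)
    (hg : ∀ j k, ContDiff ℝ 2 (fun x => g x j k)) (α : ℝ) (y x : E n) :
    laplaceBeltrami g (gaussian α y) x = gaussian α y x *
      (4 * α ^ 2 * ∑ j, ∑ k, (g x)⁻¹ j k * ((x j - y j) * (x k - y k)) -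
        2 * α * (∑ j, (g x)⁻¹ j j + ∑ k, driftCoeff g k x * (x k - y k))) := by
  rw [laplaceBeltrami_eq hp hg (contDiff_gaussian α y)]
  simp only [partialDeriv_partialDeriv_gaussian]
  simp only [partialDeriv_gaussian]
  have h1 : ∀ j, ∑ k, (g x)⁻¹ j k * (gaussian α y x * (4 * α ^ 2 * ((x j - y j) * (x k - y k)) -
        2 * α * (if j = k then 1 else 0))) =
      gaussian α y x * (4 * α ^ 2) * ∑ k, (g x)⁻¹ j k * ((x j - y j) * (x k - y k)) -
        gaussian α y x * (2 * α) * (g x)⁻¹ j j := by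
    intro j
    have : ∑ k, (g x)⁻¹ j k * (if j = k then (1 : ℝ) else 0) = (g x)⁻¹ j j := by simp
    rw [← this, Finset.mul_sum, Finset.mul_sum, ← Finset.sum_sub_distrib]
    exact Finset.sum_congr rfl fun k _ => by ring
  have h2 : ∑ k, driftCoeff g k x * (-2 * α * (x k - y k) * gaussian α y x) =
      -(gaussian α y x * (2 * α)) * ∑ k, driftCoeff g k x * (x k - y k) := by
    rw [Finset.mul_sum]
    exact Finset.sum_congr rfl fun k _ => by ring
  simp only [h1, h2, Finset.sum_sub_distrib, ← Finset.mul_sum]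
  ring

theorem laplaceBeltrami_sub_mul (hp : ∀ x, (g x).PosDef)
    (hg : ∀ j k, ContDiff ℝ 2 (fun x => g x j k)) {f h : E n → ℝ} (hf : ContDiff ℝ 2 f)
    (hh : ContDiff ℝ 2 h) (c d : ℝ) (x : E n) :
    laplaceBeltrami g (fun x => f x - c * (h x - d)) x =
      laplaceBeltrami g f x - c * laplaceBeltrami g h x := by
  have hc : ContDiff ℝ 2 (fun x => f x - c * (h x - d)) :=
    hf.sub (contDiff_const.mul (hh.sub contDiff_const))
  have hpd : ∀ (f h : E n → ℝ) (d : ℝ), Differentiable ℝ f → Differentiable ℝ h → ∀ k,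
      partialDeriv k (fun x => f x - c * (h x - d)) =
      fun x => partialDeriv k f x - c * (partialDeriv k h x - 0) := by
    intro f h d hf hh k
    funext x
    have := (hf x).hasFDerivAt.sub (((hh x).hasFDerivAt.sub_const d).const_mul c)
    unfold partialDeriv
    rw [show fderiv ℝ (fun x => f x - c * (h x - d)) x = _ from this.fderiv]
    simp
  have h2 : ∀ {f : E n → ℝ}, ContDiff ℝ 2 f → ∀ k, Differentiable ℝ (partialDeriv k f) :=
    fun hf k => (contDiff_partialDeriv (m := 1) hf (by norm_num) k).differentiable (by norm_num)
  rw [laplaceBeltrami_eq hp hg hc, laplaceBeltrami_eq hp hg hf, laplaceBeltrami_eq hp hg hh]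
  have e0 := hpd f h d (hf.differentiable (by norm_num)) (hh.differentiable (by norm_num))
  have e00 : ∀ k j, partialDeriv j (fun x => partialDeriv k f x - c * (partialDeriv k h x - 0)) =
      fun x => partialDeriv j (partialDeriv k f) x -
        c * (partialDeriv j (partialDeriv k h) x - 0) := fun k => hpd _ _ 0 (h2 hf k) (h2 hh k)
  simp only [e0, e00]
  simp only [sub_zero, mul_sub, Finset.sum_sub_distrib, mul_add, Finset.mul_sum]
  have e1 : ∀ k, driftCoeff g k x * (c * partialDeriv k h x) =
      c * (driftCoeff g k x * partialDeriv k h x) := fun k => by ring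
  have e2 : ∀ j k, (g x)⁻¹ j k * (c * partialDeriv j (partialDeriv k h) x) =
      c * ((g x)⁻¹ j k * partialDeriv j (partialDeriv k h) x) := fun j k => by ring
  simp only [e1, e2]
  ring

/-- The strong maximum principle for nonnegative solutions of `Δ_g φ = μ φ`. -/
theorem pos_of_nonneg_of_eigenfunction (hp : ∀ x, (g x).PosDef)
    (hg : ∀ j k, ContDiff ℝ 2 (fun x => g x j k)) {φ : E n → ℝ} (hφ : ContDiff ℝ 2 φ) {μ : ℝ}
    (hμ : 0 ≤ μ) (heq : ∀ x, laplaceBeltrami g φ x = μ * φ x) (h0 : ∀ x, 0 ≤ φ x) (hne : φ ≠ 0)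
    (x : E n) : 0 < φ x := by
  by_contra hx
  have hZne : {x | φ x = 0}.Nonempty := ⟨x, le_antisymm (not_lt.1 hx) (h0 x)⟩
  have hZc : IsClosed {x | φ x = 0} := isClosed_eq hφ.continuous continuous_const
  obtain ⟨y, hy⟩ : ∃ y, φ y ≠ 0 := by
    by_contra hc; push Not at hc; exact hne (funext hc)
  -- Hopf's boundary point argument: y is a point where φ is nonzero and z a nearest zero, so φ > 0
  -- in the open ball about y whose boundary passes through z.
  obtain ⟨z, hz, hzd⟩ := hZc.exists_infDist_eq_dist hZne y
  set d := dist y z with hd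
  have hd0 : 0 < d := dist_pos.2 fun h => hy (by rw [h]; exact hz)
  have hball : ∀ x, dist x y < d → 0 < φ x := by
    intro x hxd
    refine lt_of_le_of_ne (h0 x) fun hc => ?_
    have := Metric.infDist_le_dist_of_mem (x := y) (show x ∈ {x | φ x = 0} from hc.symm)
    rw [hzd, dist_comm y x] at this
    linarith
  set A : Set (E n) := {x | d / 2 ≤ ‖x - y‖ ∧ ‖x - y‖ ≤ d} with hA
  have hnc : Continuous fun x : E n => ‖x - y‖ := by fun_prop
  have hAc : IsCompact A := by
    refine (isCompact_closedBall y d).of_isClosed_subset ?_ fun x hx => ?_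
    · exact (isClosed_le continuous_const hnc).inter (isClosed_le hnc continuous_const)
    · rw [mem_closedBall_iff_norm]; exact hx.2
  have hzA : z ∈ A := by
    have : ‖z - y‖ = d := by rw [← dist_eq_norm, dist_comm]
    exact ⟨by linarith, this.le⟩
  have hquadc : Continuous fun x : E n =>
      ∑ j, ∑ k, (g x)⁻¹ j k * ((x j - y j) * (x k - y k)) :=
    continuous_finsetSum _ fun j _ => continuous_finsetSum _ fun k _ =>
      (contDiff_inv_apply hp hg j k).continuous.mul (by fun_prop)
  have hquad : ∀ x ∈ A, 0 < ∑ j, ∑ k, (g x)⁻¹ j k * ((x j - y j) * (x k - y k)) := by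
    intro x hx
    have hne' : (fun j => x j - y j) ≠ (0 : Fin n → ℝ) := by
      intro hc
      have : x - y = 0 := by ext j; exact congrFun hc j
      have h1 := hx.1
      rw [this, norm_zero] at h1
      linarith
    have := (hp x).inv.dotProduct_mulVec_pos hne'
    refine this.trans_eq ?_
    simp only [dotProduct, Matrix.mulVec, Finset.mul_sum, Pi.star_apply, star_trivial]
    exact Finset.sum_congr rfl fun j _ => Finset.sum_congr rfl fun k _ => by ring
  obtain ⟨x₁, hx₁, hmin₁⟩ := hAc.exists_isMinOn ⟨z, hzA⟩ hquadc.continuousOn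
  set θ := ∑ j, ∑ k, (g x₁)⁻¹ j k * ((x₁ j - y j) * (x₁ k - y k)) with hθ
  have hθ0 : 0 < θ := hquad x₁ hx₁
  have hlowc : Continuous fun x : E n => ∑ j, (g x)⁻¹ j j + ∑ k, driftCoeff g k x * (x k - y k) :=
    (continuous_finsetSum _ fun j _ => (contDiff_inv_apply hp hg j j).continuous).add
      (continuous_finsetSum _ fun k _ => (continuous_driftCoeff hp hg k).mul (by fun_prop))
  obtain ⟨C, hC⟩ := hAc.exists_bound_of_continuousOn hlowc.continuousOn
  have hC0 : 0 ≤ C := (norm_nonneg _).trans (hC z hzA)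
  -- With θ the minimum of the quadratic form on the annulus and C a bound for the lower order
  -- terms, α is large enough that 4α²θ dominates 2αC + μ, making the Gaussian a strict subsolution.
  set α := 1 + (2 * C + μ) / (4 * θ) with hα
  have hα1 : 1 ≤ α := by
    have : 0 ≤ (2 * C + μ) / (4 * θ) := by positivity
    linarith
  have hαθ : 2 * C + μ < 4 * α * θ := by
    have : 4 * α * θ = 4 * θ + (2 * C + μ) := by rw [hα]; field_simp
    linarith
  have hbar : ∀ x ∈ A, μ * gaussian α y x < laplaceBeltrami g (gaussian α y) x := by
    intro x hx
    rw [laplaceBeltrami_gaussian hp hg, mul_comm]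
    refine mul_lt_mul_of_pos_left ?_ (Real.exp_pos _)
    have h1 : θ ≤ ∑ j, ∑ k, (g x)⁻¹ j k * ((x j - y j) * (x k - y k)) := hmin₁ hx
    have h2 := (le_abs_self _).trans (hC x hx)
    have h3 : 4 * α ^ 2 * θ ≤
        4 * α ^ 2 * ∑ j, ∑ k, (g x)⁻¹ j k * ((x j - y j) * (x k - y k)) := by gcongr
    have h4 : 2 * α * (∑ j, (g x)⁻¹ j j + ∑ k, driftCoeff g k x * (x k - y k)) ≤ 2 * α * C := by
      gcongr
    have h5 : α * (2 * C + μ) < α * (4 * α * θ) := mul_lt_mul_of_pos_left hαθ (by linarith)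
    nlinarith
  set G₀ := Real.exp (-α * d ^ 2) with hG₀
  set Sin : Set (E n) := {x | ‖x - y‖ = d / 2} with hSin
  have hSinA : Sin ⊆ A := fun x hx => ⟨le_of_eq hx.symm, by
    have : ‖x - y‖ = d / 2 := hx
    linarith⟩
  have hSinc : IsCompact Sin :=
    hAc.of_isClosed_subset (isClosed_eq hnc continuous_const) hSinA
  obtain ⟨m, hm0, hm⟩ : ∃ m, 0 < m ∧ ∀ x ∈ Sin, m ≤ φ x := by
    rcases Sin.eq_empty_or_nonempty with he | hne
    · exact ⟨1, one_pos, fun x hx => by rw [he] at hx; exact hx.elim⟩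
    · obtain ⟨x₂, hx₂, h2⟩ := hSinc.exists_isMinOn hne hφ.continuous.continuousOn
      refine ⟨φ x₂, hball x₂ ?_, fun x hx => h2 hx⟩
      rw [dist_eq_norm, show ‖x₂ - y‖ = d / 2 from hx₂]; linarith
  -- The barrier m (gaussian - G₀) vanishes on the outer sphere and is at most m ≤ φ on the inner
  -- one. A negative minimum of f would thus be interior to the annulus, where f is a strict
  -- supersolution.
  set f : E n → ℝ := fun x => φ x - m * (gaussian α y x - G₀) with hf
  have hfC : ContDiff ℝ 2 f :=
    hφ.sub (contDiff_const.mul ((contDiff_gaussian α y).sub contDiff_const))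
  have hgle : ∀ x, gaussian α y x ≤ 1 := fun x => by
    unfold gaussian; rw [Real.exp_le_one_iff]
    have : 0 ≤ α * ‖x - y‖ ^ 2 := by positivity
    linarith
  have hG0 : 0 < G₀ := Real.exp_pos _
  have hfnn : ∀ x ∈ A, 0 ≤ f x := by
    obtain ⟨x₃, hx₃, hmin⟩ := hAc.exists_isMinOn ⟨z, hzA⟩ hfC.continuous.continuousOn
    have h3 : 0 ≤ f x₃ := by
      by_contra hneg
      push Not at hneg
      have hne1 : ‖x₃ - y‖ ≠ d / 2 := by
        intro hc
        have e1 := hm x₃ hc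
        have e2 : m * (gaussian α y x₃ - G₀) ≤ m * 1 :=
          mul_le_mul_of_nonneg_left (by linarith [hgle x₃]) hm0.le
        simp only [hf] at hneg
        linarith
      have hne2 : ‖x₃ - y‖ ≠ d := by
        intro hc
        have e1 : gaussian α y x₃ = G₀ := by unfold gaussian; rw [hc]
        simp only [hf, e1, sub_self, mul_zero, sub_zero] at hneg
        linarith [h0 x₃]
      have hnhds : A ∈ nhds x₃ := by
        have e1 := (hnc.continuousAt (x := x₃)).eventually
          (lt_mem_nhds (lt_of_le_of_ne hx₃.1 hne1.symm))
        have e2 := (hnc.continuousAt (x := x₃)).eventually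
          (gt_mem_nhds (lt_of_le_of_ne hx₃.2 hne2))
        filter_upwards [e1, e2] with x h1 h2 using ⟨h1.le, h2.le⟩
      have hloc : IsLocalMin f x₃ := hmin.isLocalMin hnhds
      have e1 := laplaceBeltrami_nonneg_of_isLocalMin hp hg hfC hloc
      rw [hf, laplaceBeltrami_sub_mul hp hg hφ (contDiff_gaussian α y), heq] at e1
      have e2 := mul_lt_mul_of_pos_left (hbar x₃ hx₃) hm0
      have e3 : μ * f x₃ ≤ 0 := mul_nonpos_of_nonneg_of_nonpos hμ hneg.le
      simp only [hf] at e3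
      have e4 : 0 ≤ μ * (m * G₀) := by positivity
      nlinarith
    exact fun x hx => h3.trans (hmin hx)
  have hzn : ‖z - y‖ = d := by rw [← dist_eq_norm, dist_comm]
  have hfz : f z = 0 := by
    have e1 : gaussian α y z = G₀ := by unfold gaussian; rw [hzn]
    have e2 : φ z = 0 := hz
    simp [hf, e1, e2]
  have hfd : HasFDerivAt f (fderiv ℝ f z) z := (hfC.differentiable (by norm_num) z).hasFDerivAt
  have hlocmin : IsLocalMinOn f A z := by
    refine IsMinOn.localize fun x hx => ?_
    change f z ≤ f x
    rw [hfz]; exact hfnn x hx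
  -- Moving from z halfway towards y stays in the annulus, so the derivative of f in this direction
  -- is nonnegative. But φ has a minimum at z, hence a vanishing differential there, and the
  -- Gaussian strictly increases in this direction.
  have hcone : (1 / 2 : ℝ) • (y - z) ∈ posTangentConeAt A z := by
    refine mem_posTangentConeAt_of_segment_subset ?_
    rintro _ ⟨s, t, hs, ht, hst, rfl⟩
    have e : s • z + t • (z + (1 / 2 : ℝ) • (y - z)) - y = (1 - t / 2) • (z - y) := by
      have : s = 1 - t := by linarith
      rw [this]; module
    have ht1 : t ≤ 1 := by linarith
    simp only [hA, Set.mem_ofPred_eq]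
    rw [e, norm_smul, hzn, Real.norm_of_nonneg (by linarith)]
    constructor <;> nlinarith
  have hnn := hlocmin.hasFDerivWithinAt_nonneg hfd.hasFDerivWithinAt hcone
  have hφmin : IsLocalMin φ z := Filter.Eventually.of_forall fun x => by
    have e2 : φ z = 0 := hz
    rw [e2]; exact h0 x
  have hφd : HasFDerivAt φ (0 : E n →L[ℝ] ℝ) z := by
    have := (hφ.differentiable (by norm_num) z).hasFDerivAt
    rwa [hφmin.fderiv_eq_zero] at this
  have hgd : HasFDerivAt (gaussian α y) (fderiv ℝ (gaussian α y) z) z :=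
    ((contDiff_gaussian α y).differentiable (by norm_num) z).hasFDerivAt
  have hf' : fderiv ℝ f z = 0 - m • fderiv ℝ (gaussian α y) z :=
    (hφd.sub ((hgd.sub_const G₀).const_mul m)).fderiv
  have hgv : fderiv ℝ (gaussian α y) z (y - z) = 2 * α * d ^ 2 * gaussian α y z := by
    rw [fderiv_eq_sum_partialDeriv]
    simp only [partialDeriv_gaussian]
    have : d ^ 2 = ∑ k, (z k - y k) ^ 2 := by
      rw [← hzn, EuclideanSpace.norm_sq_eq]
      exact Finset.sum_congr rfl fun k _ => by simp
    rw [this, Finset.mul_sum, Finset.sum_mul]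
    refine Finset.sum_congr rfl fun k _ => ?_
    simp only [PiLp.sub_apply]
    ring
  rw [hf', map_smul] at hnn
  simp only [zero_sub, neg_apply, smul_apply, hgv, smul_eq_mul] at hnn
  have : 0 < gaussian α y z := Real.exp_pos _
  have : 0 < m * (2 * α * d ^ 2 * gaussian α y z) := by positivity
  linarith

end MaximumPrinciple

end

end BlowUpAE

namespace BlowUpAE

noncomputable section

open Set

/-! ### Bounds for the metric and integrals over shells -/

section Cone

variable {n : ℕ} {g : E n → Matrix (Fin n) (Fin n) ℝ} {K : ℝ → ℝ}

theorem bracket_pos (r : ℝ) : 0 < bracket r := Real.sqrt_pos.2 (by positivity)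

theorem one_le_bracket (r : ℝ) : 1 ≤ bracket r := by
  rw [bracket, Real.one_le_sqrt]; nlinarith [sq_nonneg r]

theorem abs_le_bracket (r : ℝ) : |r| ≤ bracket r := by
  rw [bracket, ← Real.sqrt_sq_eq_abs]; exact Real.sqrt_le_sqrt (by linarith)

theorem bracket_rpow_le_one {r s : ℝ} (hs : s ≤ 0) : bracket r ^ s ≤ 1 :=
  Real.rpow_le_one_of_one_le_of_nonpos (one_le_bracket r) hs

namespace IsAsymptoticallyEuclidean

theorem continuousOn_radial (h : IsAsymptoticallyEuclidean K g) : ContinuousOn K (Ici 0) :=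
  h.radial_contDiff.continuousOn

theorem tendsto_radial (h : IsAsymptoticallyEuclidean K g) :
    Filter.Tendsto K Filter.atTop (nhds 1) := by
  obtain ⟨ρ, hρ, hK, -⟩ := h.decomposition
  obtain ⟨C, hC⟩ := hK 0 (by norm_num)
  simp only [iteratedDerivWithin_zero, Nat.cast_zero, neg_zero, zero_sub] at hC
  have hb : Filter.Tendsto bracket Filter.atTop Filter.atTop :=
    Filter.tendsto_atTop_mono (fun r => (le_abs_self r).trans (abs_le_bracket r)) Filter.tendsto_id
  have h1 : Filter.Tendsto (fun r => C * bracket r ^ (-ρ)) Filter.atTop (nhds (C * 0)) :=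
    ((tendsto_rpow_neg_atTop hρ).comp hb).const_mul C
  rw [mul_zero] at h1
  rw [tendsto_iff_norm_sub_tendsto_zero]
  refine squeeze_zero' (Filter.Eventually.of_forall fun _ => norm_nonneg _) ?_ h1
  filter_upwards [Filter.eventually_ge_atTop 0] with r hr using hC r hr

theorem exists_radial_bounds (h : IsAsymptoticallyEuclidean K g) :
    ∃ k₀ k₁ : ℝ, 0 < k₀ ∧ 0 < k₁ ∧ ∀ r, 0 ≤ r → k₀ ≤ K r ∧ K r ≤ k₁ := by
  have ht := h.tendsto_radial
  have h1 := ht.eventually (lt_mem_nhds (show (1 / 2 : ℝ) < 1 by norm_num))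
  have h2 := ht.eventually (gt_mem_nhds (show (1 : ℝ) < 2 by norm_num))
  obtain ⟨r₀, hr₀⟩ := Filter.eventually_atTop.1 (h1.and h2)
  set r₁ := max r₀ 0
  have hne : (Icc 0 r₁).Nonempty := ⟨0, le_rfl, le_max_right _ _⟩
  have hc : ContinuousOn K (Icc 0 r₁) := h.continuousOn_radial.mono fun r hr => hr.1
  obtain ⟨a, ha, hamin⟩ := isCompact_Icc.exists_isMinOn hne hc
  obtain ⟨c, hcm, hcmax⟩ := isCompact_Icc.exists_isMaxOn hne hc
  refine ⟨min (K a) (1 / 2), max (K c) 2, lt_min (h.radial_pos a ha.1) (by norm_num),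
    lt_max_of_lt_right (by norm_num), fun r hr => ?_⟩
  rcases le_total r r₁ with hle | hle
  · exact ⟨min_le_of_left_le (hamin ⟨hr, hle⟩), le_max_of_le_left (hcmax ⟨hr, hle⟩)⟩
  · have := hr₀ r ((le_max_left _ _).trans hle)
    exact ⟨min_le_of_right_le this.1.le, le_max_of_le_right this.2.le⟩

/-- The decomposition of g bounds its entries uniformly, and a determinant is bounded in terms of a
bound for its entries. -/
theorem exists_volDensity_le (h : IsAsymptoticallyEuclidean K g) :
    ∃ V : ℝ, 0 < V ∧ ∀ x, volDensity g x ≤ V := by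
  obtain ⟨k₀, k₁, hk₀, hk₁, hk⟩ := h.exists_radial_bounds
  obtain ⟨ρ, hρ, -, g₂, -, hg₂, hdec⟩ := h.decomposition
  obtain ⟨C, hC⟩ := hg₂ 0 (by norm_num)
  have hg₂b : ∀ j k x, |g₂ x j k| ≤ max C 0 := by
    intro j k x
    have h1 := hC j k x
    rw [norm_iteratedFDeriv_zero, Real.norm_eq_abs] at h1
    refine h1.trans ?_
    have h2 : bracket ‖x‖ ^ (-ρ - 1 - ((0 : ℕ) : ℝ)) ≤ 1 :=
      bracket_rpow_le_one (by push_cast; linarith)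
    have h3 : 0 ≤ bracket ‖x‖ ^ (-ρ - 1 - ((0 : ℕ) : ℝ)) :=
      Real.rpow_nonneg (bracket_pos _).le _
    calc C * bracket ‖x‖ ^ (-ρ - 1 - ((0 : ℕ) : ℝ))
        ≤ max C 0 * bracket ‖x‖ ^ (-ρ - 1 - ((0 : ℕ) : ℝ)) := by gcongr; exact le_max_left _ _
      _ ≤ max C 0 * 1 := by gcongr
      _ = max C 0 := mul_one _
  -- The polar form of the metric says nothing at the origin, which is treated separately.
  obtain ⟨G, hG⟩ : ∃ G, ∀ j k, |g 0 j k| ≤ G := by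
    refine ⟨∑ j, ∑ k, |g 0 j k|, fun j k => ?_⟩
    exact (Finset.single_le_sum (f := fun k => |g 0 j k|) (fun _ _ => abs_nonneg _)
      (Finset.mem_univ k)).trans (Finset.single_le_sum (f := fun j => ∑ k, |g 0 j k|)
      (fun _ _ => Finset.sum_nonneg fun _ _ => abs_nonneg _) (Finset.mem_univ j))
  set B := max G (k₁ ^ 2 + 2 + max C 0) with hB
  have hgb : ∀ x j k, |g x j k| ≤ B := by
    intro x j k
    rcases eq_or_ne x 0 with rfl | hx
    · exact le_max_of_le_left (hG j k)
    · refine le_max_of_le_right ?_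
      have hr : 0 < ‖x‖ := norm_pos_iff.2 hx
      have hq : ∀ j, |x j / ‖x‖| ≤ 1 := fun j => by
        rw [abs_div, abs_norm, div_le_one hr]
        simpa using PiLp.norm_apply_le x j
      have hqq : |x j / ‖x‖ * (x k / ‖x‖)| ≤ 1 := by
        rw [abs_mul]; exact mul_le_one₀ (hq j) (abs_nonneg _) (hq k)
      rw [hdec x hx j k]
      have e1 : |K ‖x‖ ^ 2 * (x j / ‖x‖ * (x k / ‖x‖))| ≤ k₁ ^ 2 := by
        have := hk ‖x‖ hr.le
        have h2 : K ‖x‖ ^ 2 ≤ k₁ ^ 2 := pow_le_pow_left₀ (hk₀.le.trans this.1) this.2 2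
        rw [abs_mul, abs_of_nonneg (sq_nonneg _)]
        calc K ‖x‖ ^ 2 * |x j / ‖x‖ * (x k / ‖x‖)| ≤ k₁ ^ 2 * 1 := by gcongr
          _ = _ := mul_one _
      have e2 : |(if j = k then (1 : ℝ) else 0) - x j / ‖x‖ * (x k / ‖x‖)| ≤ 2 := by
        refine (abs_sub _ _).trans ?_
        have : |if j = k then (1 : ℝ) else 0| ≤ 1 := by split_ifs <;> simp
        linarith
      refine (abs_add_le _ _).trans (add_le_add ((abs_add_le _ _).trans (add_le_add e1 e2))
        (hg₂b j k x))
  have hdet : ∀ x, (g x).det ≤ (Fintype.card (Fin n)).factorial • B ^ Fintype.card (Fin n) :=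
    fun x => (le_abs_self _).trans
      (Matrix.det_le (abv := AbsoluteValue.abs) fun i j => hgb x i j)
  refine ⟨Real.sqrt ((Fintype.card (Fin n)).factorial • B ^ Fintype.card (Fin n)) + 1,
    by positivity, fun x => ?_⟩
  have := Real.sqrt_le_sqrt (hdet x)
  unfold volDensity
  linarith

theorem intervalIntegrable_radial (h : IsAsymptoticallyEuclidean K g) {r s : ℝ} (hr : 0 ≤ r)
    (hs : 0 ≤ s) : IntervalIntegrable K volume r s :=
  (h.continuousOn_radial.mono fun x hx => by
    rw [mem_uIcc] at hx
    rcases hx with hx | hx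
    · exact hr.trans hx.1
    · exact hs.trans hx.1).intervalIntegrable

theorem arcLength_sub (h : IsAsymptoticallyEuclidean K g) {r s : ℝ} (hr : 0 ≤ r) (hs : 0 ≤ s) :
    arcLength K s - arcLength K r = ∫ τ in r..s, K τ :=
  intervalIntegral.integral_interval_sub_left (h.intervalIntegrable_radial le_rfl hs)
    (h.intervalIntegrable_radial le_rfl hr)

theorem le_arcLength_sub (h : IsAsymptoticallyEuclidean K g) {k₀ : ℝ}
    (hk : ∀ r, 0 ≤ r → k₀ ≤ K r) {r s : ℝ} (hr : 0 ≤ r) (hrs : r ≤ s) :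
    k₀ * (s - r) ≤ arcLength K s - arcLength K r := by
  rw [h.arcLength_sub hr (hr.trans hrs)]
  have := intervalIntegral.integral_mono_on hrs (f := fun _ => k₀) (by simp)
    (h.intervalIntegrable_radial hr (hr.trans hrs)) fun τ hτ => hk τ (hr.trans hτ.1)
  rw [intervalIntegral.integral_const, smul_eq_mul] at this
  linarith

theorem arcLength_sub_le (h : IsAsymptoticallyEuclidean K g) {k₁ : ℝ}
    (hk : ∀ r, 0 ≤ r → K r ≤ k₁) {r s : ℝ} (hr : 0 ≤ r) (hrs : r ≤ s) :
    arcLength K s - arcLength K r ≤ k₁ * (s - r) := by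
  rw [h.arcLength_sub hr (hr.trans hrs)]
  have := intervalIntegral.integral_mono_on hrs (g := fun _ => k₁)
    (h.intervalIntegrable_radial hr (hr.trans hrs)) (by simp) fun τ hτ => hk τ (hr.trans hτ.1)
  rw [intervalIntegral.integral_const, smul_eq_mul] at this
  linarith

theorem arcLength_zero : arcLength K 0 = 0 := by simp [arcLength]

theorem exists_arcLength_eq (h : IsAsymptoticallyEuclidean K g) {τ : ℝ} (hτ : 0 ≤ τ) :
    ∃ r, 0 ≤ r ∧ arcLength K r = τ := by
  obtain ⟨k₀, k₁, hk₀, hk₁, hk⟩ := h.exists_radial_bounds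
  have hr : 0 ≤ τ / k₀ := by positivity
  have hc : ContinuousOn (arcLength K) (Icc 0 (τ / k₀)) := by
    have := intervalIntegral.continuousOn_primitive_interval (f := K) (μ := volume)
      (a := 0) (b := τ / k₀) (by
        rw [uIcc_of_le hr, ← intervalIntegrable_iff_integrableOn_Icc_of_le hr]
        exact h.intervalIntegrable_radial le_rfl hr)
    rwa [uIcc_of_le hr] at this
  have h2 := h.le_arcLength_sub (fun r hr => (hk r hr).1) le_rfl hr
  rw [arcLength_zero, sub_zero, sub_zero, mul_div_cancel₀ _ hk₀.ne'] at h2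
  obtain ⟨r, hr, hrr⟩ := intermediate_value_Icc hr hc ⟨by rw [arcLength_zero]; exact hτ, h2⟩
  exact ⟨r, hr.1, hrr⟩

end IsAsymptoticallyEuclidean

theorem exists_one_add_rpow_le_exp (A : ℝ) {δ : ℝ} (hδ : 0 < δ) :
    ∃ C : ℝ, 0 < C ∧ ∀ x : ℝ, 0 ≤ x → (1 + x) ^ A ≤ C * Real.exp (δ * x) := by
  set N := |A| + 1 with hN
  have hN0 : 0 < N := by positivity
  set c := max 1 (N / δ) with hc
  have hc1 : 1 ≤ c := le_max_left _ _
  refine ⟨c ^ N, by positivity, fun x hx => ?_⟩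
  have h1 : 1 + x ≤ c * Real.exp (δ * x / N) := by
    have e1 : 1 + δ * x / N ≤ Real.exp (δ * x / N) := by
      have := Real.add_one_le_exp (δ * x / N); linarith
    have e2 : x ≤ c * (δ * x / N) := by
      have : N / δ * (δ * x / N) = x := by field_simp
      calc x = N / δ * (δ * x / N) := this.symm
        _ ≤ c * (δ * x / N) := by gcongr; exact le_max_right _ _
    calc 1 + x ≤ c * 1 + c * (δ * x / N) := by linarith
      _ = c * (1 + δ * x / N) := by ring
      _ ≤ _ := by gcongr
  calc (1 + x) ^ A ≤ (1 + x) ^ N :=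
        Real.rpow_le_rpow_of_exponent_le (by linarith) (by
          have := le_abs_self A; linarith)
    _ ≤ (c * Real.exp (δ * x / N)) ^ N := Real.rpow_le_rpow (by linarith) h1 hN0.le
    _ = c ^ N * Real.exp (δ * x) := by
        rw [Real.mul_rpow (by positivity) (Real.exp_pos _).le, ← Real.exp_mul]
        congr 2; field_simp

/-- Since 1 + R ≤ (1 + r)(1 + R - r), changing r to R in a power costs at most a power of 1 + R - r,
for either sign of the exponent, and any exponential absorbs it. -/
theorem exists_one_add_rpow_le (a : ℝ) {δ : ℝ} (hδ : 0 < δ) :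
    ∃ C : ℝ, 0 < C ∧ ∀ r R : ℝ, 0 ≤ r → r ≤ R →
      (1 + r) ^ a ≤ C * (1 + R) ^ a * Real.exp (δ * (R - r)) := by
  obtain ⟨C, hC, h⟩ := exists_one_add_rpow_le_exp |a| hδ
  refine ⟨C, hC, fun r R hr hrR => ?_⟩
  have h1 := h (R - r) (by linarith)
  have hr1 : 0 < 1 + r := by linarith
  have hR1 : 0 < 1 + R := by linarith
  have h2 : ((1 + r) / (1 + R)) ^ a ≤ (1 + (R - r)) ^ |a| := by
    rcases le_total 0 a with ha | ha
    · refine le_trans (Real.rpow_le_one (by positivity) ?_ ha)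
        (Real.one_le_rpow (by linarith) (abs_nonneg a))
      rw [div_le_one hR1]; linarith
    · have : ((1 + r) / (1 + R)) ^ a = ((1 + R) / (1 + r)) ^ |a| := by
        rw [abs_of_nonpos ha, Real.rpow_neg (by positivity), ← Real.inv_rpow (by positivity),
          inv_div]
      rw [this]
      refine Real.rpow_le_rpow (by positivity) ?_ (abs_nonneg a)
      rw [div_le_iff₀ hr1]
      nlinarith
  rw [Real.div_rpow hr1.le hR1.le] at h2
  have h3 := (div_le_iff₀ (Real.rpow_pos_of_pos hR1 a)).1 (h2.trans h1)
  linarith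

/-- A function concentrated near the sphere of radius `R`, normalized by the area of spheres, has
bounded mass in the ball. -/
theorem exists_shell_integral_le (hn : 1 ≤ n) {δ : ℝ} (hδ : 0 < δ) :
    ∃ C : ℝ, 0 < C ∧ ∀ R : ℝ, 0 ≤ R →
      ∫ x in Metric.closedBall (0 : E n) R,
        (1 + ‖x‖) ^ (-((n : ℝ) - 1)) * Real.exp (-δ * (R - ‖x‖)) ≤ C := by
  have : Nonempty (Fin n) := ⟨⟨0, hn⟩⟩
  set c := (volume : Measure (E n)).real (Metric.ball 0 1) with hc
  have hc0 : 0 ≤ c := measureReal_nonneg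
  refine ⟨n * c * (1 / δ) + 1, by positivity, fun R hR => ?_⟩
  set F : ℝ → ℝ := (Iic R).indicator
    (fun y => (1 + y) ^ (-((n : ℝ) - 1)) * Real.exp (-δ * (R - y))) with hF
  have h1 : ∫ x in Metric.closedBall (0 : E n) R,
      (1 + ‖x‖) ^ (-((n : ℝ) - 1)) * Real.exp (-δ * (R - ‖x‖)) = ∫ x : E n, F ‖x‖ := by
    rw [← integral_indicator measurableSet_closedBall]
    refine integral_congr_ae (Filter.Eventually.of_forall fun x => ?_)
    by_cases hx : ‖x‖ ≤ R
    · simp only [hF]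
      rw [indicator_of_mem (show x ∈ Metric.closedBall (0 : E n) R by simpa using hx),
        indicator_of_mem (show ‖x‖ ∈ Iic R from hx)]
    · simp only [hF]
      rw [indicator_of_notMem (show x ∉ Metric.closedBall (0 : E n) R by simpa using hx),
        indicator_of_notMem (show ‖x‖ ∉ Iic R from hx)]
  rw [h1, integral_fun_norm_addHaar volume F, finrank_euclideanSpace_fin, nsmul_eq_mul,
    smul_eq_mul, ← hc]
  have hexpi : IntegrableOn (fun y : ℝ => Real.exp (-δ * (R - y))) (Ioc 0 R) :=
    (Continuous.integrableOn_Icc (by fun_prop)).mono_set Ioc_subset_Icc_self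
  have h2 : ∫ y in Ioi (0 : ℝ), y ^ (n - 1) • F y ≤ ∫ y in Ioc 0 R, Real.exp (-δ * (R - y)) := by
    have e : ∀ y, y ^ (n - 1) • F y = (Iic R).indicator
        (fun y => y ^ (n - 1) * ((1 + y) ^ (-((n : ℝ) - 1)) * Real.exp (-δ * (R - y)))) y := by
      intro y
      by_cases hy : y ∈ Iic R
      · simp only [hF, indicator_of_mem hy, smul_eq_mul]
      · simp only [hF, indicator_of_notMem hy, smul_zero]
    simp only [e]
    rw [setIntegral_indicator measurableSet_Iic, Ioi_inter_Iic]
    refine integral_mono_of_nonneg ?_ hexpi ?_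
    · rw [Filter.EventuallyLE, ae_restrict_iff' measurableSet_Ioc]
      refine Filter.Eventually.of_forall fun y hy => ?_
      have := hy.1
      simp only [Pi.zero_apply]
      positivity
    · rw [Filter.EventuallyLE, ae_restrict_iff' measurableSet_Ioc]
      refine Filter.Eventually.of_forall fun y hy => ?_
      have hy0 := hy.1
      have e1 : y ^ (n - 1) * (1 + y) ^ (-((n : ℝ) - 1)) ≤ 1 := by
        rw [Real.rpow_neg (by linarith), ← div_eq_mul_inv, div_le_one (by positivity)]
        rw [← Real.rpow_natCast, Nat.cast_sub hn, Nat.cast_one]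
        refine Real.rpow_le_rpow hy0.le (by linarith) ?_
        have : (1 : ℝ) ≤ n := by exact_mod_cast hn
        linarith
      have e2 := mul_le_mul_of_nonneg_right e1 (Real.exp_pos (-δ * (R - y))).le
      change y ^ (n - 1) * ((1 + y) ^ (-((n : ℝ) - 1)) * Real.exp (-δ * (R - y))) ≤
        Real.exp (-δ * (R - y))
      linarith
  have h3 : ∫ y in Ioc 0 R, Real.exp (-δ * (R - y)) ≤ 1 / δ := by
    rw [← intervalIntegral.integral_of_le hR]
    have hd : ∀ y ∈ uIcc 0 R, HasDerivAt (fun y => Real.exp (-δ * (R - y)) / δ)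
        (Real.exp (-δ * (R - y))) y := by
      intro y _
      have := ((((hasDerivAt_id y).const_sub R).const_mul (-δ)).exp).div_const δ
      refine this.congr_deriv ?_
      change Real.exp (-δ * (R - y)) * (-δ * -1) / δ = _
      field_simp
    rw [intervalIntegral.integral_eq_sub_of_hasDerivAt hd
      (Continuous.intervalIntegrable (by fun_prop) _ _)]
    simp only [sub_self, mul_zero, Real.exp_zero]
    have := Real.exp_pos (-δ * (R - 0))
    have : 0 < Real.exp (-δ * (R - 0)) / δ := by positivity
    linarith
  have h4 : (n : ℝ) * (c * ∫ y in Ioi (0 : ℝ), y ^ (n - 1) • F y) ≤ n * (c * (1 / δ)) := by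
    have := h2.trans h3
    gcongr
  linarith

end Cone

end

end BlowUpAE

namespace BlowUpAE

noncomputable section

open Set IsWeakSolution

/-! ### Integrals of the weights over the propagation cone -/

section ConeIntegrals

variable {n : ℕ} {g : E n → Matrix (Fin n) (Fin n) ℝ} {K : ℝ → ℝ}

theorem ballBump_eq_zero_of_lt {r : ℝ} (hr : 0 ≤ r) {x : E n} (hx : r + 2 < ‖x‖) :
    ballBump n r x = 0 :=
  ballBump_eq_zero hr (by rw [mem_closedBall_zero_iff]; linarith)

/-- K lies between two positive constants, so for t ≥ 1 the radius of the cone is comparable with t.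
The upper bound allows a unit of slack in time because the cutoff radius used later is chosen from
countably many values. -/
theorem IsAsymptoticallyEuclidean.exists_radius_bounds (h : IsAsymptoticallyEuclidean K g)
    {R₁ : ℝ} (hR₁ : 0 ≤ R₁) (a : ℝ) :
    ∃ C : ℝ, 0 < C ∧ ∀ t r : ℝ, 1 ≤ t → 0 ≤ r → t + R₁ ≤ arcLength K r →
      arcLength K r ≤ t + 1 + R₁ → (3 + r) ^ a ≤ C * t ^ a := by
  obtain ⟨k₀, k₁, hk₀, hk₁, hk⟩ := h.exists_radial_bounds
  refine ⟨(3 + (2 + R₁) / k₀) ^ a + (k₁⁻¹) ^ a, by positivity, fun t r ht hr h1 h2 => ?_⟩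
  have e1 := h.le_arcLength_sub (fun r hr => (hk r hr).1) le_rfl hr
  have e2 := h.arcLength_sub_le (fun r hr => (hk r hr).2) le_rfl hr
  rw [IsAsymptoticallyEuclidean.arcLength_zero, sub_zero, sub_zero] at e1 e2
  have ht0 : 0 < t := by linarith
  have hup : 3 + r ≤ (3 + (2 + R₁) / k₀) * t := by
    have : r ≤ (2 + R₁) / k₀ * t := by
      rw [div_mul_eq_mul_div, le_div_iff₀ hk₀]
      nlinarith
    nlinarith
  have hlow : k₁⁻¹ * t ≤ 3 + r := by
    have : k₁⁻¹ * t ≤ r := by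
      rw [inv_mul_le_iff₀ hk₁]; linarith
    linarith
  have hta : 0 < t ^ a := Real.rpow_pos_of_pos ht0 a
  have p1 : 0 < (3 + (2 + R₁) / k₀) ^ a := by positivity
  have p2 : 0 < (k₁⁻¹) ^ a := by positivity
  rcases le_total 0 a with ha | ha
  · calc (3 + r) ^ a ≤ ((3 + (2 + R₁) / k₀) * t) ^ a :=
          Real.rpow_le_rpow (by positivity) hup ha
      _ = (3 + (2 + R₁) / k₀) ^ a * t ^ a := Real.mul_rpow (by positivity) ht0.le
      _ ≤ _ := by nlinarith
  · calc (3 + r) ^ a ≤ (k₁⁻¹ * t) ^ a :=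
          Real.rpow_le_rpow_of_nonpos (by positivity) hlow ha
      _ = (k₁⁻¹) ^ a * t ^ a := Real.mul_rpow (by positivity) ht0.le
      _ ≤ _ := by nlinarith

theorem le_bracket_mul {l r : ℝ} (hr : 0 ≤ r) :
    min 1 l / 2 * (1 + r) ≤ bracket (l * r) := by
  have h1 := one_le_bracket (l * r)
  have h2 := (le_abs_self _).trans (abs_le_bracket (l * r))
  have h3 : min 1 l ≤ 1 := min_le_left _ _
  have h4 : min 1 l * r ≤ l * r := mul_le_mul_of_nonneg_right (min_le_right _ _) hr
  linarith

/-- The bound on φ^s is a power (1 + ρ)^(-s(n-1)/2) times e^(sl arcLength ρ). As arcLength grows at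
least linearly, the exponential decays inwards from the edge R of the cone. Half of this decay
replaces (1 + ρ)^a by (1 + R)^a, with a = (n-1)(1-s/2); the other half, with the remaining (1 +
ρ)^(-(n-1)), is a shell integral bounded uniformly in R. -/
theorem IsAsymptoticallyEuclidean.exists_weight_integral_le (h : IsAsymptoticallyEuclidean K g)
    (hn : 1 ≤ n) {φ : E n → ℝ} {l c : ℝ} (hl : 0 < l) (hc : 0 < c)
    (hφ0 : ∀ x, 0 ≤ φ x) (hφ : ∀ x, φ x ≤ c * bracket (l * ‖x‖) ^ (-(((n : ℝ) - 1) / 2)) *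
      Real.exp (l * arcLength K ‖x‖)) {s : ℝ} (hs : 0 < s) {R₁ : ℝ} (hR₁ : 0 ≤ R₁) :
    ∃ C : ℝ, 0 < C ∧ ∀ t r : ℝ, 1 ≤ t → 0 ≤ r → t + R₁ ≤ arcLength K r →
      arcLength K r ≤ t + 1 + R₁ → ∫ x, φ x ^ s * ballBump n r x * volDensity g x ≤
        C * t ^ (((n : ℝ) - 1) * (1 - s / 2)) * Real.exp (s * l * t) := by
  obtain ⟨k₀, k₁, hk₀, hk₁, hk⟩ := h.exists_radial_bounds
  obtain ⟨V, hV, hVle⟩ := h.exists_volDensity_le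
  set m := s * (((n : ℝ) - 1) / 2) with hm
  set a := ((n : ℝ) - 1) * (1 - s / 2) with ha
  have hn1 : (1 : ℝ) ≤ n := by exact_mod_cast hn
  have hm0 : 0 ≤ m := mul_nonneg hs.le (by linarith)
  -- Half of the decay rate s l k₀.
  set δ := s * l * k₀ / 2 with hδ
  have hδ0 : 0 < δ := by positivity
  obtain ⟨C₁, hC₁, h1⟩ := exists_one_add_rpow_le a hδ0
  obtain ⟨C₂, hC₂, h2⟩ := exists_shell_integral_le (n := n) hn hδ0
  obtain ⟨C₃, hC₃, h3⟩ := h.exists_radius_bounds hR₁ a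
  set κ := min 1 l / 2 with hκ
  have hκ0 : 0 < κ := by have := lt_min one_pos hl; positivity
  set C₄ := c ^ s * κ ^ (-m) * C₁ * V with hC₄
  have hC₄0 : 0 < C₄ := by positivity
  refine ⟨C₄ * C₃ * Real.exp (s * l * (1 + R₁ + 2 * k₁)) * C₂, by positivity,
    fun t r ht hr hle hge => ?_⟩
  set R := r + 2 with hR
  have hR0 : 0 ≤ R := by linarith
  set P := C₄ * (1 + R) ^ a * Real.exp (s * l * arcLength K R) with hP
  have hP0 : 0 < P := by positivity
  have hpt : ∀ x : E n, φ x ^ s * ballBump n r x * volDensity g x ≤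
      (Metric.closedBall (0 : E n) R).indicator (fun x => P *
        ((1 + ‖x‖) ^ (-((n : ℝ) - 1)) * Real.exp (-δ * (R - ‖x‖)))) x := by
    intro x
    by_cases hx : x ∈ Metric.closedBall (0 : E n) R
    · rw [indicator_of_mem hx]
      rw [mem_closedBall_zero_iff] at hx
      set ρ := ‖x‖ with hρ
      have hρ0 : 0 ≤ ρ := norm_nonneg _
      have hbr := bracket_pos (l * ρ)
      have e1 : φ x ^ s ≤ c ^ s * bracket (l * ρ) ^ (-m) * Real.exp (s * l * arcLength K ρ) := by
        refine (Real.rpow_le_rpow (hφ0 x) (hφ x) hs.le).trans (le_of_eq ?_)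
        rw [Real.mul_rpow (by positivity) (Real.exp_pos _).le, Real.mul_rpow hc.le (by positivity),
          ← Real.rpow_mul hbr.le, ← Real.exp_mul]
        congr 2
        · congr 1; rw [hm]; ring
        · ring
      have e2 : bracket (l * ρ) ^ (-m) ≤ κ ^ (-m) * (1 + ρ) ^ (-m) := by
        rw [← Real.mul_rpow hκ0.le (by linarith)]
        exact Real.rpow_le_rpow_of_nonpos (by positivity) (le_bracket_mul hρ0) (by linarith)
      have e3 : (1 + ρ) ^ (-m) = (1 + ρ) ^ (-((n : ℝ) - 1)) * (1 + ρ) ^ a := by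
        rw [← Real.rpow_add (by linarith)]; congr 1; rw [ha, hm]; ring
      have e4 := h1 ρ R hρ0 hx
      have e5 : Real.exp (s * l * arcLength K ρ) ≤
          Real.exp (s * l * arcLength K R) * Real.exp (-(2 * δ) * (R - ρ)) := by
        rw [← Real.exp_add, Real.exp_le_exp]
        have := h.le_arcLength_sub (fun r hr => (hk r hr).1) hρ0 hx
        have := mul_le_mul_of_nonneg_left this (mul_pos hs hl).le
        have e : 2 * δ = s * l * k₀ := by rw [hδ]; ring
        rw [e]; nlinarith
      have hchi : ballBump n r x ≤ 1 := (ballBump n r).le_one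
      have hchi0 : 0 ≤ ballBump n r x := (ballBump n r).nonneg
      have hφs : 0 ≤ φ x ^ s := Real.rpow_nonneg (hφ0 x) s
      have hvx : 0 ≤ volDensity g x := Real.sqrt_nonneg _
      have e6 : Real.exp (δ * (R - ρ)) * Real.exp (-(2 * δ) * (R - ρ)) =
          Real.exp (-δ * (R - ρ)) := by rw [← Real.exp_add]; ring_nf
      calc φ x ^ s * ballBump n r x * volDensity g x
          ≤ φ x ^ s * 1 * V := by gcongr; exact hVle x
        _ = φ x ^ s * V := by ring
        _ ≤ (c ^ s * (κ ^ (-m) * ((1 + ρ) ^ (-((n : ℝ) - 1)) *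
              (C₁ * (1 + R) ^ a * Real.exp (δ * (R - ρ))))) *
              (Real.exp (s * l * arcLength K R) * Real.exp (-(2 * δ) * (R - ρ)))) * V := by
            refine mul_le_mul_of_nonneg_right (e1.trans ?_) hV.le
            rw [e3] at e2
            gcongr
            exact e2.trans (by gcongr)
        _ = P * ((1 + ρ) ^ (-((n : ℝ) - 1)) *
              (Real.exp (δ * (R - ρ)) * Real.exp (-(2 * δ) * (R - ρ)))) := by rw [hP, hC₄]; ring
        _ = _ := by rw [e6]
    · rw [indicator_of_notMem hx, ballBump_eq_zero hr hx]
      simp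
  have hcont : ContinuousOn (fun x : E n => P *
      ((1 + ‖x‖) ^ (-((n : ℝ) - 1)) * Real.exp (-δ * (R - ‖x‖)))) (Metric.closedBall 0 R) := by
    refine Continuous.continuousOn (continuous_const.mul (Continuous.mul ?_ (by fun_prop)))
    exact (continuous_const.add continuous_norm).rpow_const fun x => Or.inl
      (by positivity : (1 : ℝ) + ‖x‖ ≠ 0)
  have hmain : ∫ x, φ x ^ s * ballBump n r x * volDensity g x ≤ P * C₂ := by
    refine (integral_mono_of_nonneg (Filter.Eventually.of_forall fun x => ?_)
      ((integrable_indicator_iff measurableSet_closedBall).2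
        (hcont.integrableOn_compact (isCompact_closedBall 0 R)))
      (Filter.Eventually.of_forall hpt)).trans ?_
    · exact mul_nonneg (mul_nonneg (Real.rpow_nonneg (hφ0 x) s) (ballBump n r).nonneg)
        (Real.sqrt_nonneg _)
    · rw [integral_indicator measurableSet_closedBall, integral_const_mul]
      exact mul_le_mul_of_nonneg_left (h2 R hR0) hP0.le
  refine hmain.trans ?_
  have e7 : (1 + R) ^ a ≤ C₃ * t ^ a := by
    have := h3 t r ht hr hle hge
    rwa [show 1 + R = 3 + r by rw [hR]; ring]
  have e8 : Real.exp (s * l * arcLength K R) ≤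
      Real.exp (s * l * (1 + R₁ + 2 * k₁)) * Real.exp (s * l * t) := by
    rw [← Real.exp_add, Real.exp_le_exp]
    have := h.arcLength_sub_le (fun r hr => (hk r hr).2) hr (show r ≤ R by linarith)
    have h5 : arcLength K R ≤ t + 1 + R₁ + 2 * k₁ := by
      have : R - r = 2 := by rw [hR]; ring
      nlinarith
    have := mul_le_mul_of_nonneg_left h5 (mul_pos hs hl).le
    linarith
  calc P * C₂ ≤ C₄ * (C₃ * t ^ a) *
        (Real.exp (s * l * (1 + R₁ + 2 * k₁)) * Real.exp (s * l * t)) * C₂ := by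
        rw [hP]; gcongr
    _ = _ := by ring

theorem IsAsymptoticallyEuclidean.exists_volume_integral_le (h : IsAsymptoticallyEuclidean K g)
    {R₁ : ℝ} (hR₁ : 0 ≤ R₁) :
    ∃ C : ℝ, 0 < C ∧ ∀ t r : ℝ, 1 ≤ t → 0 ≤ r → t + R₁ ≤ arcLength K r →
      arcLength K r ≤ t + 1 + R₁ → ∫ x, ballBump n r x * volDensity g x ≤ C * t ^ (n : ℝ) := by
  obtain ⟨V, hV, hVle⟩ := h.exists_volDensity_le
  obtain ⟨C, hC, h1⟩ := h.exists_radius_bounds hR₁ (n : ℝ)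
  set c := (volume : Measure (E n)).real (Metric.ball 0 1) with hc
  have hc0 : 0 ≤ c := measureReal_nonneg
  refine ⟨V * c * C + 1, by positivity, fun t r ht hr hle hge => ?_⟩
  have hpt : ∀ x : E n, ballBump n r x * volDensity g x ≤
      (Metric.closedBall (0 : E n) (r + 2)).indicator (fun _ => V) x := by
    intro x
    by_cases hx : x ∈ Metric.closedBall (0 : E n) (r + 2)
    · rw [indicator_of_mem hx]
      have h2 : ballBump n r x ≤ 1 := (ballBump n r).le_one
      have h3 : 0 ≤ volDensity g x := Real.sqrt_nonneg _
      calc ballBump n r x * volDensity g x ≤ 1 * V := by gcongr; exact hVle x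
        _ = V := one_mul V
    · rw [indicator_of_notMem hx, ballBump_eq_zero hr hx, zero_mul]
  have hmain : ∫ x, ballBump n r x * volDensity g x ≤ V * ((r + 2) ^ n * c) := by
    refine (integral_mono_of_nonneg (Filter.Eventually.of_forall fun x => ?_)
      ((integrable_indicator_iff measurableSet_closedBall).2
        (continuousOn_const.integrableOn_compact (isCompact_closedBall 0 (r + 2))))
      (Filter.Eventually.of_forall hpt)).trans ?_
    · exact mul_nonneg (ballBump n r).nonneg (Real.sqrt_nonneg _)
    · rw [integral_indicator measurableSet_closedBall, setIntegral_const, smul_eq_mul]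
      have := Measure.addHaar_real_closedBall (volume : Measure (E n)) 0
        (show 0 ≤ r + 2 by linarith)
      rw [finrank_euclideanSpace_fin] at this
      rw [this, mul_comm]
  refine hmain.trans ?_
  have e1 : (r + 2) ^ n ≤ C * t ^ (n : ℝ) := by
    have h2 := h1 t r ht hr hle hge
    have h3 : (r + 2) ^ n ≤ (3 + r) ^ n := pow_le_pow_left₀ (by linarith) (by linarith) n
    rw [Real.rpow_natCast] at h2
    exact h3.trans h2
  have htn : 0 < t ^ (n : ℝ) := Real.rpow_pos_of_pos (by linarith) _
  calc V * ((r + 2) ^ n * c) ≤ V * ((C * t ^ (n : ℝ)) * c) := by gcongr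
    _ ≤ (V * c * C + 1) * t ^ (n : ℝ) := by nlinarith

end ConeIntegrals

/-! ### Hölder's inequality for pairings -/

section Holder

variable {n : ℕ} {g : E n → Matrix (Fin n) (Fin n) ℝ}

theorem pairing_nonneg (hv0 : ∀ x, 0 ≤ volDensity g x) {f ψ : E n → ℝ} (hf : ∀ x, 0 ≤ f x)
    (hψ : ∀ x, 0 ≤ ψ x) : 0 ≤ pairing g f ψ :=
  integral_nonneg fun x => mul_nonneg (mul_nonneg (hf x) (hψ x)) (hv0 x)

theorem pairing_mono (hv : Continuous (volDensity g)) (hv0 : ∀ x, 0 ≤ volDensity g x)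
    {f ψ ψ' : E n → ℝ} {R : ℝ} (hf : ∀ x, 0 ≤ f x)
    (hfi : IntegrableOn f (Metric.closedBall 0 R)) (hψ : Continuous ψ) (hψ' : Continuous ψ')
    (hs : ∀ x, x ∉ Metric.closedBall (0 : E n) R → ψ x = 0)
    (hs' : ∀ x, x ∉ Metric.closedBall (0 : E n) R → ψ' x = 0) (hle : ∀ x, ψ x ≤ ψ' x) :
    pairing g f ψ ≤ pairing g f ψ' :=
  integral_mono (integrable_pairing hv hψ hs hfi) (integrable_pairing hv hψ' hs' hfi) fun x =>
    mul_le_mul_of_nonneg_right (mul_le_mul_of_nonneg_left (hle x) (hf x)) (hv0 x)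

/-- Hölder with respect to the measure ψ dv_g: f carries the exponent p and w the conjugate
exponent. Choosing which factor of the test weight plays w and which plays ψ yields all the
nonlinear estimates. -/
theorem abs_pairing_rpow_le (hv : Continuous (volDensity g)) (hv0 : ∀ x, 0 ≤ volDensity g x)
    {p R : ℝ} (hp : 1 < p) {f w ψ : E n → ℝ} (hf : IntegrableOn f (Metric.closedBall 0 R))
    (hfp : IntegrableOn (fun x => |f x| ^ p) (Metric.closedBall 0 R))
    (hw : Continuous w) (hw0 : ∀ x, 0 ≤ w x) (hψ : Continuous ψ) (hψ0 : ∀ x, 0 ≤ ψ x)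
    (hs : ∀ x, x ∉ Metric.closedBall (0 : E n) R → ψ x = 0) :
    |pairing g f (fun x => w x * ψ x)| ^ p ≤ pairing g (fun x => |f x| ^ p) ψ *
      (∫ x, w x ^ (p / (p - 1)) * ψ x * volDensity g x) ^ (p - 1) := by
  have hp0 : 0 < p := by linarith
  have hp1 : 0 < p - 1 := by linarith
  set p' := p / (p - 1) with hp'
  have hpp : p.HolderConjugate p' := Real.HolderConjugate.conjExponent hp
  have hp'0 : 0 < p' := hpp.symm.pos
  set ν := volume.restrict (Metric.closedBall (0 : E n) R) with hν
  set m : E n → ℝ := fun x => ψ x * volDensity g x with hm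
  have hm0 : ∀ x, 0 ≤ m x := fun x => mul_nonneg (hψ0 x) (hv0 x)
  have hmc : Continuous m := hψ.mul hv
  set F : E n → ℝ := fun x => |f x| * m x ^ (1 / p) with hF
  set G : E n → ℝ := fun x => w x * m x ^ (1 / p') with hG
  have hF0 : ∀ x, 0 ≤ F x := fun x => mul_nonneg (abs_nonneg _) (Real.rpow_nonneg (hm0 x) _)
  have hG0 : ∀ x, 0 ≤ G x := fun x => mul_nonneg (hw0 x) (Real.rpow_nonneg (hm0 x) _)
  have hmp : Continuous fun x => m x ^ (1 / p) := hmc.rpow_const fun x => Or.inr (by positivity)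
  have hmp' : Continuous fun x => m x ^ (1 / p') := hmc.rpow_const fun x => Or.inr (by positivity)
  have hFp : ∀ x, F x ^ p = |f x| ^ p * ψ x * volDensity g x := fun x => by
    rw [hF]; simp only
    rw [Real.mul_rpow (abs_nonneg _) (Real.rpow_nonneg (hm0 x) _), ← Real.rpow_mul (hm0 x),
      one_div_mul_cancel hp0.ne', Real.rpow_one, hm]
    ring
  have hGp : ∀ x, G x ^ p' = w x ^ p' * ψ x * volDensity g x := fun x => by
    rw [hG]; simp only
    rw [Real.mul_rpow (hw0 x) (Real.rpow_nonneg (hm0 x) _), ← Real.rpow_mul (hm0 x),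
      one_div_mul_cancel hp'0.ne', Real.rpow_one, hm]
    ring
  have hFG : ∀ x, F x * G x = |f x * (w x * ψ x) * volDensity g x| := fun x => by
    have : m x ^ (1 / p) * m x ^ (1 / p') = m x := by
      rw [← Real.rpow_add_of_nonneg (hm0 x) (by positivity) (by positivity)]
      have : 1 / p + 1 / p' = 1 := by
        have := hpp.inv_add_inv_eq_one
        simpa [one_div] using this
      rw [this, Real.rpow_one]
    rw [abs_mul, abs_mul, abs_of_nonneg (hv0 x), abs_of_nonneg (mul_nonneg (hw0 x) (hψ0 x))]
    calc F x * G x = |f x| * w x * (m x ^ (1 / p) * m x ^ (1 / p')) := by simp only [hF, hG]; ring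
      _ = _ := by rw [this, hm]; ring
  have hFm : MemLp F (ENNReal.ofReal p) ν := by
    refine (integrable_norm_rpow_iff ?_ ?_ ENNReal.ofReal_ne_top).1 ?_
    · exact hf.aestronglyMeasurable.norm.mul hmp.aestronglyMeasurable
    · rw [Ne, ENNReal.ofReal_eq_zero, not_le]; exact hp0
    · rw [ENNReal.toReal_ofReal hp0.le]
      have := (integrable_pairing hv hψ hs hfp).restrict (s := Metric.closedBall (0 : E n) R)
      refine this.congr (Filter.Eventually.of_forall fun x => ?_)
      simp only
      rw [Real.norm_of_nonneg (hF0 x), hFp]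
  have hGm : MemLp G (ENNReal.ofReal p') ν := by
    refine (integrable_norm_rpow_iff ?_ ?_ ENNReal.ofReal_ne_top).1 ?_
    · exact hw.aestronglyMeasurable.mul hmp'.aestronglyMeasurable
    · rw [Ne, ENNReal.ofReal_eq_zero, not_le]; exact hp'0
    · rw [ENNReal.toReal_ofReal hp'0.le]
      have hc : Continuous fun x => ‖G x‖ ^ p' :=
        ((hw.mul hmp').norm).rpow_const fun x => Or.inr hp'0.le
      exact hc.continuousOn.integrableOn_compact (isCompact_closedBall 0 R)
  have hH := integral_mul_le_Lp_mul_Lq_of_nonneg hpp (Filter.Eventually.of_forall hF0)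
    (Filter.Eventually.of_forall hG0) hFm hGm
  have e1 : |pairing g f (fun x => w x * ψ x)| ≤ ∫ x, F x * G x ∂ν := by
    rw [pairing_eq_setIntegral (R := R) fun x hx => by rw [hs x hx, mul_zero]]
    refine (abs_integral_le_integral_abs).trans (le_of_eq ?_)
    exact integral_congr_ae (Filter.Eventually.of_forall fun x => (hFG x).symm)
  have e2 : ∫ x, F x ^ p ∂ν = pairing g (fun x => |f x| ^ p) ψ := by
    rw [pairing_eq_setIntegral hs]
    exact integral_congr_ae (Filter.Eventually.of_forall hFp)
  have e3 : ∫ x, G x ^ p' ∂ν = ∫ x, w x ^ p' * ψ x * volDensity g x := by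
    rw [← setIntegral_eq_integral_of_forall_compl_eq_zero
      (s := Metric.closedBall (0 : E n) R) (f := fun x => w x ^ p' * ψ x * volDensity g x)
      fun x hx => by rw [hs x hx]; ring]
    exact integral_congr_ae (Filter.Eventually.of_forall hGp)
  rw [e2, e3] at hH
  have hX : 0 ≤ pairing g (fun x => |f x| ^ p) ψ :=
    pairing_nonneg hv0 (fun x => Real.rpow_nonneg (abs_nonneg _) _) hψ0
  have hY : 0 ≤ ∫ x, w x ^ p' * ψ x * volDensity g x :=
    integral_nonneg fun x => mul_nonneg (mul_nonneg (Real.rpow_nonneg (hw0 x) _) (hψ0 x)) (hv0 x)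
  refine (Real.rpow_le_rpow (abs_nonneg _) (e1.trans hH) hp0.le).trans (le_of_eq ?_)
  rw [Real.mul_rpow (Real.rpow_nonneg hX _) (Real.rpow_nonneg hY _), ← Real.rpow_mul hX,
    ← Real.rpow_mul hY, one_div_mul_cancel hp0.ne', Real.rpow_one]
  congr 2
  rw [hp']; field_simp

end Holder

end

end BlowUpAE

namespace BlowUpAE

noncomputable section

open Set IsWeakSolution

/-! ### Cutoffs adapted to the propagation cone -/

section Radius

variable {n : ℕ} {g : E n → Matrix (Fin n) (Fin n) ℝ} {K : ℝ → ℝ}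

theorem IsAsymptoticallyEuclidean.arcLength_lt (h : IsAsymptoticallyEuclidean K g) {r s : ℝ}
    (hr : 0 ≤ r) (hrs : r < s) : arcLength K r < arcLength K s := by
  obtain ⟨k₀, k₁, hk₀, hk₁, hk⟩ := h.exists_radial_bounds
  have := h.le_arcLength_sub (fun r hr => (hk r hr).1) hr hrs.le
  have : 0 < k₀ * (s - r) := mul_pos hk₀ (by linarith)
  linarith

theorem IsAsymptoticallyEuclidean.le_of_arcLength_le (h : IsAsymptoticallyEuclidean K g) {r s : ℝ}
    (hs : 0 ≤ s) (hle : arcLength K r ≤ arcLength K s) : r ≤ s :=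
  not_lt.1 fun hlt => (h.arcLength_lt hs hlt).not_ge hle

end Radius

/-- The weight `w` cut off outside the ball of radius `r + 2`. -/
def cutoff {n : ℕ} (w : E n → ℝ) (r : ℝ) (x : E n) : ℝ := w x * ballBump n r x

section Cutoff

variable {n : ℕ} {g : E n → Matrix (Fin n) (Fin n) ℝ} {w : E n → ℝ}

theorem cutoff_eq {r : ℝ} {x : E n} (hx : ‖x‖ ≤ r + 1) : cutoff w r x = w x := by
  rw [cutoff, ballBump_eq_one hx, mul_one]

theorem cutoff_eq_zero {r : ℝ} (hr : 0 ≤ r) {x : E n}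
    (hx : x ∉ Metric.closedBall (0 : E n) (r + 2)) : cutoff w r x = 0 := by
  rw [cutoff, ballBump_eq_zero hr hx, mul_zero]

theorem cutoff_nonneg (hw : ∀ x, 0 ≤ w x) (r : ℝ) (x : E n) : 0 ≤ cutoff w r x :=
  mul_nonneg (hw x) (ballBump n r).nonneg

theorem contDiff_cutoff (hw : ContDiff ℝ 2 w) (r : ℝ) : ContDiff ℝ 2 (cutoff w r) :=
  hw.mul (ballBump n r).contDiff

theorem hasCompactSupport_cutoff (w : E n → ℝ) (r : ℝ) : HasCompactSupport (cutoff w r) :=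
  (ballBump n r).hasCompactSupport.mul_left

/-- The gap of 1 is needed because the smaller bump is supported in radius r + 2, while the larger
equals 1 only up to radius s + 1. -/
theorem cutoff_le_cutoff (hw : ∀ x, 0 ≤ w x) {r s : ℝ} (hr : 0 ≤ r) (hrs : r + 1 ≤ s) (x : E n) :
    cutoff w r x ≤ cutoff w s x := by
  refine mul_le_mul_of_nonneg_left ?_ (hw x)
  rcases le_or_gt ‖x‖ (s + 1) with h | h
  · rw [ballBump_eq_one h]; exact (ballBump n r).le_one
  · rw [ballBump_eq_zero_of_lt hr (by linarith)]; exact (ballBump n s).nonneg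

theorem pairing_congr_of_zero {f ψ ψ' : E n → ℝ} {r : ℝ} (hf : ∀ᵐ x, r < ‖x‖ → f x = 0)
    (hψ : ∀ x, ‖x‖ ≤ r → ψ x = ψ' x) : pairing g f ψ = pairing g f ψ' := by
  refine integral_congr_ae ?_
  filter_upwards [hf] with x hx
  rcases le_or_gt ‖x‖ r with h | h
  · rw [hψ x h]
  · rw [hx h]; ring

theorem laplaceBeltrami_cutoff {r : ℝ} {x : E n} (hx : ‖x‖ ≤ r) :
    laplaceBeltrami g (cutoff w r) x = laplaceBeltrami g w x := by
  refine laplaceBeltrami_congr ?_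
  have : ∀ᶠ y in nhds x, ‖y‖ < r + 1 :=
    continuous_norm.continuousAt.eventually_lt_const (by linarith)
  filter_upwards [this] with y hy using cutoff_eq hy.le

end Cutoff

/-! ### The equation tested with weights cut off outside the cone -/

namespace IsWeakSolution

variable {n : ℕ} {K : ℝ → ℝ} {g : E n → Matrix (Fin n) (Fin n) ℝ} {b : ℝ → ℝ} {c₁ c₂ p q : ℝ}
  {f₀ f₁ : E n → ℝ} {T : EReal} {u v : ℝ → E n → ℝ} {R₁ : ℝ}

/-- The time derivative of the pairing of the solution with `ψ`. -/
def testVelocity (g : E n → Matrix (Fin n) (Fin n) ℝ) (b : ℝ → ℝ) (c₁ c₂ p q : ℝ)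
    (f₁ : E n → ℝ) (u v : ℝ → E n → ℝ) (ψ : E n → ℝ) : ℝ → ℝ :=
  velocityOf b (pairing g f₁ ψ) (totalSource g c₁ c₂ p q u v ψ)

/-- The pairing of the solution with `ψ`, as the primitive of its time derivative. -/
def testPosition (g : E n → Matrix (Fin n) (Fin n) ℝ) (b : ℝ → ℝ) (c₁ c₂ p q : ℝ)
    (f₁ : E n → ℝ) (u v : ℝ → E n → ℝ) (ψ : E n → ℝ) (t : ℝ) : ℝ :=
  pairing g (u 0) ψ + ∫ s in (0 : ℝ)..t, testVelocity g b c₁ c₂ p q f₁ u v ψ s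

theorem testVelocity_zero (ψ : E n → ℝ) :
    testVelocity g b c₁ c₂ p q f₁ u v ψ 0 = pairing g f₁ ψ := by
  simp [testVelocity, velocityOf, damp_zero]

theorem testPosition_zero (ψ : E n → ℝ) :
    testPosition g b c₁ c₂ p q f₁ u v ψ 0 = pairing g (u 0) ψ := by
  simp [testPosition]

theorem source_nonneg (hv0 : ∀ x, 0 ≤ volDensity g x) (hc₁ : 0 ≤ c₁) (hc₂ : 0 ≤ c₂) {ψ : E n → ℝ}
    (hψ : ∀ x, 0 ≤ ψ x) (t : ℝ) : 0 ≤ source g c₁ c₂ p q u v ψ t :=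
  add_nonneg
    (mul_nonneg hc₁ (pairing_nonneg hv0 (fun _ => Real.rpow_nonneg (abs_nonneg _) _) hψ))
    (mul_nonneg hc₂ (pairing_nonneg hv0 (fun _ => Real.rpow_nonneg (abs_nonneg _) _) hψ))

theorem eq_zero_of_lt_norm (hg : IsAsymptoticallyEuclidean K g) (hfs : FiniteSpeed K R₁ T u)
    {t r : ℝ} (ht : t ∈ timeInterval T) (hr : 0 ≤ r) (hle : t + R₁ ≤ arcLength K r) :
    ∀ᵐ x : E n, r < ‖x‖ → u t x = 0 := by
  filter_upwards [hfs t ht] with x hx hrx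
  exact hx (hle.trans_lt (hg.arcLength_lt hr hrx))

theorem testedIdentity_cutoff (h : IsWeakSolution g b c₁ c₂ p q f₀ f₁ T u v)
    (hg : IsAsymptoticallyEuclidean K g)
    (hb : IntegrableOn b (Ioi 0)) (hp : 1 ≤ p) (hq : 1 ≤ q) (hf₁ : Continuous f₁) {S : ℝ}
    (hS : S ∈ timeInterval T) {w : E n → ℝ} (hw : ContDiff ℝ 2 w) (r : ℝ) :
    TestedIdentity g b c₁ c₂ p q f₁ u v S (cutoff w r) :=
  h.testedIdentity_of_contDiff hg.posDef hg.contDiff hb hp hq hf₁ hS (contDiff_cutoff hw r)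
    (hasCompactSupport_cutoff w r)

/-- On the support of u the cutoff equals 1 in a neighbourhood, so the cut off weight still behaves
as an eigenfunction when paired with u. -/
theorem dampedODE_cutoff (h : IsWeakSolution g b c₁ c₂ p q f₀ f₁ T u v)
    (hg : IsAsymptoticallyEuclidean K g) (hfs : FiniteSpeed K R₁ T u)
    (hb : IntegrableOn b (Ioi 0)) (hp : 1 ≤ p) (hq : 1 ≤ q) (hc₁ : 0 ≤ c₁) (hc₂ : 0 ≤ c₂)
    (hf₁ : Continuous f₁) {S : ℝ} (hS : S ∈ timeInterval T) {w : E n → ℝ} (hw : ContDiff ℝ 2 w)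
    (hw0 : ∀ x, 0 ≤ w x) {μ : ℝ} (hμ : ∀ x, laplaceBeltrami g w x = μ * w x) {r : ℝ} (hr : 0 ≤ r)
    (hle : S + R₁ ≤ arcLength K r) :
    DampedODE b μ (source g c₁ c₂ p q u v (cutoff w r))
      (testPosition g b c₁ c₂ p q f₁ u v (cutoff w r))
      (testVelocity g b c₁ c₂ p q f₁ u v (cutoff w r)) S := by
  refine (h.testedIdentity_cutoff hg hb hp hq hf₁ hS hw r).dampedODE hb hS.1 (fun t ht => ?_)
    fun t _ => source_nonneg (fun x => (volDensity_pos hg.posDef x).le) hc₁ hc₂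
      (cutoff_nonneg hw0 r) t
  have hz := eq_zero_of_lt_norm hg hfs (Icc_subset hS ht) hr (by linarith [ht.2])
  rw [pairing_congr_of_zero (ψ' := fun x => μ * cutoff w r x) hz fun x hx => by
    rw [laplaceBeltrami_cutoff hx, hμ, cutoff_eq (by linarith)]]
  unfold pairing
  rw [← integral_const_mul]
  exact integral_congr_ae (Filter.Eventually.of_forall fun x => by ring)

theorem testPosition_eq (h : IsWeakSolution g b c₁ c₂ p q f₀ f₁ T u v)
    (hg : IsAsymptoticallyEuclidean K g) (hfs : FiniteSpeed K R₁ T u)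
    (hb : IntegrableOn b (Ioi 0)) (hp : 1 ≤ p) (hq : 1 ≤ q)
    (hf₁ : Continuous f₁) {S : ℝ} (hS : S ∈ timeInterval T) {w : E n → ℝ} (hw : ContDiff ℝ 2 w)
    {t : ℝ} (ht : t ∈ Icc 0 S) {r s : ℝ} (hr : 0 ≤ r) (hrs : r ≤ s)
    (hle : t + R₁ ≤ arcLength K r) :
    testPosition g b c₁ c₂ p q f₁ u v (cutoff w s) t = pairing g (u t) (cutoff w r) := by
  have h1 := (h.testedIdentity_cutoff hg hb hp hq hf₁ hS hw s).position t ht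
  refine h1.symm.trans ?_
  refine pairing_congr_of_zero (eq_zero_of_lt_norm hg hfs (Icc_subset hS ht) hr hle) fun x hx => ?_
  rw [cutoff_eq (by linarith), cutoff_eq (by linarith)]

/-- The support condition is given for u only. It reaches v through the time derivative: up to time
τ the positions tested with the two cutoffs coincide, so their velocities agree almost everywhere,
and the smaller cutoff gives the pairing of v over the cone. -/
theorem ae_testVelocity_eq (h : IsWeakSolution g b c₁ c₂ p q f₀ f₁ T u v)
    (hg : IsAsymptoticallyEuclidean K g) (hfs : FiniteSpeed K R₁ T u)
    (hb : IntegrableOn b (Ioi 0)) (hp : 1 ≤ p) (hq : 1 ≤ q)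
    (hf₁ : Continuous f₁) {S : ℝ} (hS : S ∈ timeInterval T) {w : E n → ℝ} (hw : ContDiff ℝ 2 w)
    {τ : ℝ} (hτ : τ ∈ Icc 0 S) {r s : ℝ} (hr : 0 ≤ r) (hrs : r ≤ s)
    (hle : τ + R₁ ≤ arcLength K r) :
    ∀ᵐ t, t ∈ Icc 0 τ →
      testVelocity g b c₁ c₂ p q f₁ u v (cutoff w s) t = pairing g (v t) (cutoff w r) := by
  have hd : ∀ ρ, ∀ᵐ t, t ∈ Icc 0 τ → HasDerivAt (testPosition g b c₁ c₂ p q f₁ u v (cutoff w ρ))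
      (testVelocity g b c₁ c₂ p q f₁ u v (cutoff w ρ) t) t := by
    intro ρ
    have hi := (h.testedIdentity_cutoff hg hb hp hq hf₁ hS hw ρ).integrable
    have hc := (continuousOn_velocityOf hb hS.1 (pairing g f₁ (cutoff w ρ)) hi).mono
      (Icc_subset_Icc le_rfl hτ.2)
    have hint : IntervalIntegrable (testVelocity g b c₁ c₂ p q f₁ u v (cutoff w ρ)) volume 0 τ := by
      apply ContinuousOn.intervalIntegrable; rwa [uIcc_of_le hτ.1]
    filter_upwards [ae_hasDerivAt_primitive hτ.1 hint] with t ht1 ht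
    exact (ht1 ht).const_add _
  have hne : ∀ a : ℝ, ∀ᵐ t : ℝ, t ≠ a := fun a => by simp [ae_iff]
  filter_upwards [hd r, hd s, (h.testedIdentity_cutoff hg hb hp hq hf₁ hS hw r).velocity,
    hne 0, hne τ] with t h1 h2 h3 h0 hτ' ht
  have h4 := h3 (Icc_subset_Icc le_rfl hτ.2 ht)
  refine Eq.trans ?_ h4
  refine (h2 ht).unique ((h1 ht).congr_of_eventuallyEq ?_)
  have : Ioo 0 τ ∈ nhds t :=
    Ioo_mem_nhds (lt_of_le_of_ne ht.1 (Ne.symm h0)) (lt_of_le_of_ne ht.2 hτ')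
  filter_upwards [this] with t' ht'
  have hm : t' ∈ Icc 0 S := ⟨ht'.1.le, ht'.2.le.trans hτ.2⟩
  have hle' : t' + R₁ ≤ arcLength K r := by linarith [ht'.2]
  rw [h.testPosition_eq hg hfs hb hp hq hf₁ hS hw hm hr hrs hle',
    h.testPosition_eq hg hfs hb hp hq hf₁ hS hw hm hr le_rfl hle']

/-- The exceptional null set depends on the cutoff radius, so a radius adapted to each t cannot be
used directly. Countably many radii, one per integer time, suffice at the cost of enlarging the cone
by at most one unit of time. -/
theorem ae_exists_testVelocity_eq (h : IsWeakSolution g b c₁ c₂ p q f₀ f₁ T u v)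
    (hg : IsAsymptoticallyEuclidean K g) (hfs : FiniteSpeed K R₁ T u)
    (hb : IntegrableOn b (Ioi 0)) (hp : 1 ≤ p) (hq : 1 ≤ q)
    (hf₁ : Continuous f₁) {S : ℝ} (hS : S ∈ timeInterval T) {w : E n → ℝ} (hw : ContDiff ℝ 2 w)
    (hR₁ : 0 ≤ R₁) {s : ℝ} (hs : 0 ≤ s) (hle : S + R₁ ≤ arcLength K s) :
    ∀ᵐ t, t ∈ Icc 0 S → ∃ r, 0 ≤ r ∧ r ≤ s ∧ t + R₁ ≤ arcLength K r ∧
      arcLength K r ≤ t + 1 + R₁ ∧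
      testVelocity g b c₁ c₂ p q f₁ u v (cutoff w (s + 1)) t = pairing g (v t) (cutoff w r) := by
  have hτ : ∀ k : ℕ, min (k : ℝ) S ∈ Icc 0 S := fun k =>
    ⟨le_min (Nat.cast_nonneg k) hS.1, min_le_right _ _⟩
  have hex : ∀ k : ℕ, ∃ r, 0 ≤ r ∧ arcLength K r = min (k : ℝ) S + R₁ := fun k =>
    hg.exists_arcLength_eq (add_nonneg (hτ k).1 hR₁)
  choose ρ hρ0 hρ using hex
  have hρs : ∀ k, ρ k ≤ s := fun k => hg.le_of_arcLength_le hs (by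
    rw [hρ]; linarith [(hτ k).2])
  have hall : ∀ᵐ t, ∀ k : ℕ, t ∈ Icc 0 (min (k : ℝ) S) →
      testVelocity g b c₁ c₂ p q f₁ u v (cutoff w (s + 1)) t = pairing g (v t) (cutoff w (ρ k)) :=
    ae_all_iff.2 fun k => h.ae_testVelocity_eq hg hfs hb hp hq hf₁ hS hw (hτ k) (hρ0 k)
      (by linarith [hρs k]) (hρ k).ge
  filter_upwards [hall] with t h1 ht
  -- Rounding t up to an integer, truncated at S, selects the radius.
  have hk1 : t ≤ min ((⌈t⌉₊ : ℕ) : ℝ) S := le_min (Nat.le_ceil t) ht.2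
  have hk2 : min ((⌈t⌉₊ : ℕ) : ℝ) S ≤ t + 1 :=
    (min_le_left _ _).trans (Nat.ceil_lt_add_one ht.1).le
  exact ⟨ρ ⌈t⌉₊, hρ0 _, hρs _, by rw [hρ]; linarith, by rw [hρ]; linarith, h1 _ ⟨ht.1, hk1⟩⟩

end IsWeakSolution

end

end BlowUpAE

namespace BlowUpAE

noncomputable section

open Set IsWeakSolution

/-! ### Reduction to ordinary differential inequalities by Hölder's inequality -/

namespace IsWeakSolution

variable {n : ℕ} {K : ℝ → ℝ} {g : E n → Matrix (Fin n) (Fin n) ℝ} {b : ℝ → ℝ} {c₁ c₂ p q : ℝ}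
  {f₀ f₁ : E n → ℝ} {T : EReal} {u v : ℝ → E n → ℝ} {R₁ : ℝ}

/-- The dual integral must be taken over the small cone of radius r, where it has the right growth
in t, whereas the forcing is tested with the fixed cutoff at s + 1; nonnegativity of |f|^e permits
the enlargement. -/
theorem mul_abs_pairing_rpow_le (hg : IsAsymptoticallyEuclidean K g) {c e R r s B : ℝ}
    (hc : 0 ≤ c) (he : 1 < e) {f w χ : E n → ℝ} (hf : IntegrableOn f (Metric.closedBall 0 R))
    (hfp : IntegrableOn (fun x => |f x| ^ e) (Metric.closedBall 0 R))
    (hw : Continuous w) (hw0 : ∀ x, 0 ≤ w x) (hχ : Continuous χ) (hχ0 : ∀ x, 0 ≤ χ x)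
    (hr : 0 ≤ r) (hrs : r ≤ s) (hR : R = s + 3)
    (hB : ∫ x, w x ^ (e / (e - 1)) * cutoff χ r x * volDensity g x ≤ B) :
    c * |pairing g f (cutoff (fun x => w x * χ x) r)| ^ e ≤
      c * pairing g (fun x => |f x| ^ e) (cutoff χ (s + 1)) * B ^ (e - 1) := by
  have hv := continuous_volDensity hg.posDef hg.contDiff
  have hv0 : ∀ x, 0 ≤ volDensity g x := fun x => (volDensity_pos hg.posDef x).le
  have hcut : ∀ r, Continuous (cutoff χ r) := fun r => hχ.mul (ballBump n r).continuous
  have hz : ∀ x, x ∉ Metric.closedBall (0 : E n) R → cutoff χ r x = 0 := fun x hx =>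
    cutoff_eq_zero hr fun hx' => hx (Metric.closedBall_subset_closedBall (by linarith) hx')
  have hz' : ∀ x, x ∉ Metric.closedBall (0 : E n) R → cutoff χ (s + 1) x = 0 := fun x hx =>
    cutoff_eq_zero (by linarith) fun hx' =>
      hx (Metric.closedBall_subset_closedBall (by linarith) hx')
  have h1 := abs_pairing_rpow_le hv hv0 he hf hfp hw hw0 (hcut r) (cutoff_nonneg hχ0 r) hz
  have h2 := pairing_mono hv hv0 (fun x => Real.rpow_nonneg (abs_nonneg (f x)) e) hfp
    (hcut r) (hcut (s + 1)) hz hz' (cutoff_le_cutoff hχ0 hr (by linarith))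
  have hI : 0 ≤ ∫ x, w x ^ (e / (e - 1)) * cutoff χ r x * volDensity g x :=
    integral_nonneg fun x => mul_nonneg
      (mul_nonneg (Real.rpow_nonneg (hw0 x) _) (cutoff_nonneg hχ0 r x)) (hv0 x)
  have h3 := Real.rpow_le_rpow hI hB (show 0 ≤ e - 1 by linarith)
  have h4 : (fun x => w x * cutoff χ r x) = cutoff (fun x => w x * χ x) r := by
    funext x; simp only [cutoff]; ring
  rw [h4] at h1
  have h5 : 0 ≤ pairing g (fun x => |f x| ^ e) (cutoff χ (s + 1)) :=
    pairing_nonneg hv0 (fun _ => Real.rpow_nonneg (abs_nonneg _) _) (cutoff_nonneg hχ0 _)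
  rw [mul_assoc]
  exact mul_le_mul_of_nonneg_left
    (h1.trans (mul_le_mul h2 h3 (Real.rpow_nonneg hI _) h5)) hc

theorem ae_velocity_le_source (h : IsWeakSolution g b c₁ c₂ p q f₀ f₁ T u v)
    (hg : IsAsymptoticallyEuclidean K g) (hfs : FiniteSpeed K R₁ T u)
    (hb : IntegrableOn b (Ioi 0)) (hp : 1 < p) (hq : 1 ≤ q) (hc₁ : 0 ≤ c₁) (hc₂ : 0 ≤ c₂)
    (hf₁ : Continuous f₁) {S : ℝ} (hS : S ∈ timeInterval T) {w χ : E n → ℝ}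
    (hw : ContDiff ℝ 2 w) (hw0 : ∀ x, 0 ≤ w x) (hχ : ContDiff ℝ 2 χ) (hχ0 : ∀ x, 0 ≤ χ x)
    (hR₁ : 0 ≤ R₁) {s : ℝ} (hs : 0 ≤ s) (hle : S + R₁ ≤ arcLength K s) {B : ℝ → ℝ}
    (hB0 : ∀ t, 1 ≤ t → 0 ≤ B t)
    (hB : ∀ t r, 1 ≤ t → 0 ≤ r → t + R₁ ≤ arcLength K r → arcLength K r ≤ t + 1 + R₁ →
      ∫ x, w x ^ (p / (p - 1)) * cutoff χ r x * volDensity g x ≤ B t) :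
    ∀ᵐ t, t ∈ Icc 1 S →
      c₁ * |testVelocity g b c₁ c₂ p q f₁ u v (cutoff (fun x => w x * χ x) (s + 1)) t| ^ p ≤
        source g c₁ c₂ p q u v (cutoff χ (s + 1)) t * B t ^ (p - 1) := by
  have hv0 : ∀ x, 0 ≤ volDensity g x := fun x => (volDensity_pos hg.posDef x).le
  filter_upwards [h.ae_exists_testVelocity_eq hg hfs hb hp.le hq hf₁ hS (hw.mul hχ) hR₁ hs hle,
    h.ae_integrableOn_velocity hp.le hS (s + 3), h.ae_integrableOn_velocity_pow hp.le hS (s + 3)]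
    with t h1 h2 h3 ht
  have ht' : t ∈ Icc 0 S := ⟨by linarith [ht.1], ht.2⟩
  obtain ⟨r, hr0, hrs, hr1, hr2, hr3⟩ := h1 ht'
  rw [hr3]
  refine (mul_abs_pairing_rpow_le hg hc₁ hp (h2 ht') (h3 ht') hw.continuous hw0 hχ.continuous hχ0
    hr0 hrs rfl (hB t r ht.1 hr0 hr1 hr2)).trans ?_
  refine mul_le_mul_of_nonneg_right ?_ (Real.rpow_nonneg (hB0 t ht.1) _)
  exact le_add_of_nonneg_right (mul_nonneg hc₂
    (pairing_nonneg hv0 (fun _ => Real.rpow_nonneg (abs_nonneg _) _) (cutoff_nonneg hχ0 _)))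

theorem position_le_source (h : IsWeakSolution g b c₁ c₂ p q f₀ f₁ T u v)
    (hg : IsAsymptoticallyEuclidean K g) (hfs : FiniteSpeed K R₁ T u)
    (hb : IntegrableOn b (Ioi 0)) (hp : 1 ≤ p) (hq : 1 < q) (hc₁ : 0 ≤ c₁) (hc₂ : 0 ≤ c₂)
    (hf₁ : Continuous f₁) {S : ℝ} (hS : S ∈ timeInterval T) {w χ : E n → ℝ}
    (hw : ContDiff ℝ 2 w) (hw0 : ∀ x, 0 ≤ w x) (hχ : ContDiff ℝ 2 χ) (hχ0 : ∀ x, 0 ≤ χ x)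
    (hR₁ : 0 ≤ R₁) {s : ℝ} (hs : 0 ≤ s) (hle : S + R₁ ≤ arcLength K s) {B : ℝ → ℝ}
    (hB0 : ∀ t, 1 ≤ t → 0 ≤ B t)
    (hB : ∀ t r, 1 ≤ t → 0 ≤ r → t + R₁ ≤ arcLength K r → arcLength K r ≤ t + 1 + R₁ →
      ∫ x, w x ^ (q / (q - 1)) * cutoff χ r x * volDensity g x ≤ B t) {t : ℝ} (ht : t ∈ Icc 1 S) :
    c₂ * |testPosition g b c₁ c₂ p q f₁ u v (cutoff (fun x => w x * χ x) (s + 1)) t| ^ q ≤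
      source g c₁ c₂ p q u v (cutoff χ (s + 1)) t * B t ^ (q - 1) := by
  have hv0 : ∀ x, 0 ≤ volDensity g x := fun x => (volDensity_pos hg.posDef x).le
  have ht' : t ∈ Icc 0 S := ⟨by linarith [ht.1], ht.2⟩
  obtain ⟨r, hr0, hr⟩ := hg.exists_arcLength_eq (add_nonneg ht'.1 hR₁)
  have hrs : r ≤ s := hg.le_of_arcLength_le hs (by linarith [ht.2])
  rw [h.testPosition_eq hg hfs hb hp hq.le hf₁ hS (hw.mul hχ) ht' hr0
    (show r ≤ s + 1 by linarith) hr.ge]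
  refine (mul_abs_pairing_rpow_le hg hc₂ hq (h.integrableOn hq.le (Icc_subset hS ht') _)
    (h.integrableOn_pow (Icc_subset hS ht') _) hw.continuous hw0 hχ.continuous hχ0
    hr0 hrs rfl (hB t r ht.1 hr0 hr.ge (by linarith))).trans ?_
  refine mul_le_mul_of_nonneg_right ?_ (Real.rpow_nonneg (hB0 t ht.1) _)
  exact le_add_of_nonneg_left (mul_nonneg hc₁
    (pairing_nonneg hv0 (fun _ => Real.rpow_nonneg (abs_nonneg _) _) (cutoff_nonneg hχ0 _)))

end IsWeakSolution

/-- The system of ordinary differential inequalities obtained by testing the equation with a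
positive eigenfunction and with the constant function: `H`, `F` are the two pairings, `D`, `G`
their velocities, and `N`, `M` the corresponding forcings. -/
structure ReducedSystem (b : ℝ → ℝ) (d l A c₁ c₂ p q : ℝ) (N H D M F G : ℝ → ℝ) (S : ℝ) :
    Prop where
  eigen : DampedODE b (l ^ 2) N H D S
  const : DampedODE b 0 M F G S
  velocity_eigen : ∀ᵐ t, t ∈ Icc 1 S →
    c₁ * |D t| ^ p ≤ N t * (A * t ^ ((d - 1) / 2) * Real.exp (l * t)) ^ (p - 1)
  velocity_const : ∀ᵐ t, t ∈ Icc 1 S →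
    c₁ * |D t| ^ p ≤ M t * (A * t ^ ((d - 1) * (1 - p / (p - 1) / 2)) *
      Real.exp (p / (p - 1) * l * t)) ^ (p - 1)
  position_eigen : ∀ t ∈ Icc 1 S,
    c₂ * |H t| ^ q ≤ M t * (A * t ^ ((d - 1) * (1 - q / (q - 1) / 2)) *
      Real.exp (q / (q - 1) * l * t)) ^ (q - 1)
  position_const : ∀ t ∈ Icc 1 S, c₂ * |F t| ^ q ≤ M t * (A * t ^ d) ^ (q - 1)

/-- The four nonlinear inequalities are Hölder estimates with (dual weight, measure weight) equal to
(1, φ) and (φ, 1) for the velocity, (φ, 1) and (1, 1) for the position. The constant A does not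
depend on the solution or on S, nor on the size of the data. -/
theorem exists_reducedSystem {n : ℕ} (hn : 1 ≤ n) {K : ℝ → ℝ} {g : E n → Matrix (Fin n) (Fin n) ℝ}
    {b : ℝ → ℝ} {c₁ c₂ p q R₁ : ℝ} (hg : IsAsymptoticallyEuclidean K g)
    (hb : IntegrableOn b (Ioi 0)) (hp : 1 < p) (hq : 1 < q) (hc₁ : 0 ≤ c₁) (hc₂ : 0 ≤ c₂)
    (hR₁ : 0 ≤ R₁) {φ : E n → ℝ} {l c : ℝ} (hl : 0 < l) (hc : 0 < c) (hφC : ContDiff ℝ 2 φ)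
    (hφeq : ∀ x, laplaceBeltrami g φ x = l ^ 2 * φ x)
    (hφ0 : ∀ x, 0 ≤ φ x) (hφ : ∀ x, φ x ≤ c * bracket (l * ‖x‖) ^ (-(((n : ℝ) - 1) / 2)) *
      Real.exp (l * arcLength K ‖x‖)) :
    ∃ A : ℝ, 0 < A ∧ ∀ (f₀ f₁ : E n → ℝ) (T : EReal) (u v : ℝ → E n → ℝ), Continuous f₁ →
      (∀ x, R₁ < arcLength K ‖x‖ → f₀ x = 0) → (∀ x, R₁ < arcLength K ‖x‖ → f₁ x = 0) →
      IsWeakSolution g b c₁ c₂ p q f₀ f₁ T u v → FiniteSpeed K R₁ T u → ∀ S ∈ timeInterval T,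
      ∃ N H D M F G : ℝ → ℝ, ReducedSystem b n l A c₁ c₂ p q N H D M F G S ∧
        H 0 = pairing g f₀ φ ∧ D 0 = pairing g f₁ φ ∧ F 0 = pairing g f₀ (fun _ => 1) ∧
        G 0 = pairing g f₁ (fun _ => 1) := by
  have hp' : 0 < p / (p - 1) := div_pos (by linarith) (by linarith)
  have hq' : 0 < q / (q - 1) := div_pos (by linarith) (by linarith)
  obtain ⟨A₁, hA₁, h1⟩ := hg.exists_weight_integral_le hn hl hc hφ0 hφ one_pos hR₁
  obtain ⟨A₂, hA₂, h2⟩ := hg.exists_weight_integral_le hn hl hc hφ0 hφ hp' hR₁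
  obtain ⟨A₃, hA₃, h3⟩ := hg.exists_weight_integral_le hn hl hc hφ0 hφ hq' hR₁
  obtain ⟨A₄, hA₄, h4⟩ := hg.exists_volume_integral_le hR₁
  set A := A₁ + A₂ + A₃ + A₄ with hA
  refine ⟨A, by positivity, fun f₀ f₁ T u v hf₁ hs₀ hs₁ h hfs S hS => ?_⟩
  -- The edge of the cone at the final time S; the cutoff is placed one unit further out so that it
  -- dominates all smaller ones.
  obtain ⟨s, hs0, hs⟩ := hg.exists_arcLength_eq (add_nonneg hS.1 hR₁)
  have hs1 : S + R₁ ≤ arcLength K (s + 1) := hs ▸ (hg.arcLength_lt hs0 (by linarith)).le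
  have hone : ContDiff ℝ 2 (fun _ : E n => (1 : ℝ)) := contDiff_const
  have hone0 : ∀ x : E n, (0 : ℝ) ≤ (fun _ : E n => (1 : ℝ)) x := fun _ => zero_le_one
  have hmulone : (fun x => φ x * (fun _ : E n => (1 : ℝ)) x) = φ := by funext x; simp
  have honemul : (fun x => (fun _ : E n => (1 : ℝ)) x * φ x) = φ := by funext x; simp
  have honeone : (fun x => (fun _ : E n => (1 : ℝ)) x * (fun _ : E n => (1 : ℝ)) x) =
      fun _ => 1 := by funext x; simp
  have hsupp : ∀ (f w : E n → ℝ), (∀ x, R₁ < arcLength K ‖x‖ → f x = 0) →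
      pairing g f (cutoff w (s + 1)) = pairing g f w := fun f w hf =>
    pairing_congr_of_zero (r := s) (Filter.Eventually.of_forall fun x hx =>
      hf x ((show R₁ ≤ arcLength K s by linarith [hS.1]).trans_lt (hg.arcLength_lt hs0 hx)))
      fun x hx => cutoff_eq (by linarith)
  have hinit : ∀ ψ : E n → ℝ, pairing g (u 0) ψ = pairing g f₀ ψ := fun ψ => by
    refine integral_congr_ae ?_
    filter_upwards [h.initialValue] with x hx
    rw [hx]
  refine ⟨source g c₁ c₂ p q u v (cutoff φ (s + 1)),
    testPosition g b c₁ c₂ p q f₁ u v (cutoff φ (s + 1)),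
    testVelocity g b c₁ c₂ p q f₁ u v (cutoff φ (s + 1)),
    source g c₁ c₂ p q u v (cutoff (fun _ => 1) (s + 1)),
    testPosition g b c₁ c₂ p q f₁ u v (cutoff (fun _ => 1) (s + 1)),
    testVelocity g b c₁ c₂ p q f₁ u v (cutoff (fun _ => 1) (s + 1)), ⟨?_, ?_, ?_, ?_, ?_, ?_⟩,
    by rw [testPosition_zero, hinit, hsupp _ _ hs₀], by rw [testVelocity_zero, hsupp _ _ hs₁],
    by rw [testPosition_zero, hinit, hsupp _ _ hs₀], by rw [testVelocity_zero, hsupp _ _ hs₁]⟩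
  · exact h.dampedODE_cutoff hg hfs hb hp.le hq.le hc₁ hc₂ hf₁ hS hφC hφ0 hφeq (by linarith) hs1
  · exact h.dampedODE_cutoff hg hfs hb hp.le hq.le hc₁ hc₂ hf₁ hS hone hone0
      (fun x => by rw [laplaceBeltrami_const, zero_mul]) (by linarith) hs1
  · have := h.ae_velocity_le_source hg hfs hb hp hq.le hc₁ hc₂ hf₁ hS hone hone0 hφC hφ0 hR₁ hs0
      hs.ge (B := fun t => A * t ^ (((n : ℝ) - 1) / 2) * Real.exp (l * t))
      (fun t ht => by positivity) fun t r ht hr ha hb' => by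
        have e := h1 t r ht hr ha hb'
        simp only [Real.rpow_one, one_mul] at e
        simp only [Real.one_rpow, one_mul, cutoff]
        refine e.trans ?_
        rw [show ((n : ℝ) - 1) * (1 - 1 / 2) = ((n : ℝ) - 1) / 2 by ring]
        gcongr
        linarith
    rwa [honemul] at this
  · have := h.ae_velocity_le_source hg hfs hb hp hq.le hc₁ hc₂ hf₁ hS hφC hφ0 hone hone0 hR₁ hs0
      hs.ge (B := fun t => A * t ^ (((n : ℝ) - 1) * (1 - p / (p - 1) / 2)) *
        Real.exp (p / (p - 1) * l * t)) (fun t ht => by positivity) fun t r ht hr ha hb' => by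
        have e := h2 t r ht hr ha hb'
        simp only [one_mul, cutoff]
        refine e.trans ?_
        gcongr
        linarith
    rwa [hmulone] at this
  · have := fun t (ht : t ∈ Icc 1 S) =>
      h.position_le_source hg hfs hb hp.le hq hc₁ hc₂ hf₁ hS hφC hφ0 hone hone0 hR₁ hs0
      hs.ge (B := fun t => A * t ^ (((n : ℝ) - 1) * (1 - q / (q - 1) / 2)) *
        Real.exp (q / (q - 1) * l * t)) (fun t ht => by positivity) (fun t r ht hr ha hb' => by
        have e := h3 t r ht hr ha hb'
        simp only [one_mul, cutoff]
        refine e.trans ?_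
        gcongr
        linarith) ht
    rwa [hmulone] at this
  · have := fun t (ht : t ∈ Icc 1 S) =>
      h.position_le_source hg hfs hb hp.le hq hc₁ hc₂ hf₁ hS hone hone0 hone hone0 hR₁ hs0
      hs.ge (B := fun t => A * t ^ (n : ℝ)) (fun t ht => by positivity) (fun t r ht hr ha hb' => by
        have e := h4 t r ht hr ha hb'
        simp only [Real.one_rpow, one_mul, cutoff]
        refine e.trans ?_
        gcongr
        linarith) ht
    rwa [honeone] at this

end

end BlowUpAE

/-! ### Growth and blow-up of the reduced system -/

namespace BlowUpAE

noncomputable section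

open Set IsWeakSolution

/-- Solves a Hölder inequality for the forcing after inserting a lower bound with an explicit
exponential, so that the exponentials can cancel in each application. -/
theorem forcing_lower_bound {c A t a x e k y j N D : ℝ} (hc : 0 ≤ c) (hA : 0 < A) (ht : 0 < t)
    (he : 1 < e) (hk : 0 ≤ k) (hj : 0 ≤ j) (hD : k * Real.exp y * j ≤ D)
    (h : c * |D| ^ e ≤ N * (A * t ^ a * Real.exp x) ^ (e - 1)) :
    c * A ^ (1 - e) * k ^ e * t ^ (-(a * (e - 1))) * Real.exp (e * y - (e - 1) * x) * j ^ e ≤ N := by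
  have hP : 0 < (A * t ^ a * Real.exp x) ^ (e - 1) := by positivity
  have h1 : (k * Real.exp y * j) ^ e ≤ |D| ^ e :=
    Real.rpow_le_rpow (by positivity) (hD.trans (le_abs_self D)) (by linarith)
  have h2 := (mul_le_mul_of_nonneg_left h1 hc).trans h
  rw [← div_le_iff₀ hP] at h2
  refine le_trans (le_of_eq ?_) h2
  rw [eq_div_iff hP.ne', Real.mul_rpow (by positivity) (by positivity),
    Real.mul_rpow hA.le (by positivity), Real.mul_rpow (by positivity) hj,
    Real.mul_rpow hk (by positivity), ← Real.exp_mul, ← Real.exp_mul, ← Real.rpow_mul ht.le]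
  have e1 : A ^ (1 - e) * A ^ (e - 1) = 1 := by
    rw [← Real.rpow_add hA]; simp
  have e2 : t ^ (-(a * (e - 1))) * t ^ (a * (e - 1)) = 1 := by
    rw [← Real.rpow_add ht]; simp
  have e3 : Real.exp (e * y - (e - 1) * x) * Real.exp (x * (e - 1)) = Real.exp (y * e) := by
    rw [← Real.exp_add]; ring_nf
  calc _ = c * k ^ e * j ^ e * (A ^ (1 - e) * A ^ (e - 1)) *
        (t ^ (-(a * (e - 1))) * t ^ (a * (e - 1))) *
        (Real.exp (e * y - (e - 1) * x) * Real.exp (x * (e - 1))) := by ring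
    _ = _ := by rw [e1, e2, e3]; ring

namespace ReducedSystem

variable {b : ℝ → ℝ} {d l A c₁ c₂ p q : ℝ}

theorem exists_velocity_lower_bound (hb : IntegrableOn b (Ioi 0)) (hl : 0 < l) :
    ∃ t₀ k : ℝ, 1 ≤ t₀ ∧ 0 < k ∧ ∀ S N H D, DampedODE b (l ^ 2) N H D S → 0 ≤ H 0 → 0 ≤ D 0 →
      ∀ t, t₀ ≤ t → t ≤ S →
        k * Real.exp (l * t) * (D 0 + l * H 0 + ∫ s in (0 : ℝ)..t, Real.exp (-l * s) * N s) ≤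
          D t := by
  obtain ⟨t₀, ht₀, h⟩ := DampedODE.exists_velocity_bound hb hl
  refine ⟨t₀, Real.exp (-dampMass b) / 4, ht₀, by positivity,
    fun S N H D hode hH hD t h1 h2 => ?_⟩
  have hS : 0 ≤ S := by linarith
  have h3 := h S N H D hode hH hD t h1 h2
  have h4 := hode.lower_bound_sum hb hl hS hH hD (t := t) ⟨by linarith, h2⟩
  have h5 := mul_le_mul_of_nonneg_left h4
    (by positivity : 0 ≤ Real.exp (-dampMass b) / 4 * Real.exp (l * t))
  refine h5.trans (le_trans (le_of_eq ?_) h3)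
  have e1 : Real.exp (-dampMass b) * Real.exp (dampMass b) = 1 := by rw [← Real.exp_add]; simp
  have e2 : Real.exp (l * t) * Real.exp (-l * t) = 1 := by rw [← Real.exp_add]; simp
  calc _ = (Real.exp (-dampMass b) * Real.exp (dampMass b)) *
        (Real.exp (l * t) * Real.exp (-l * t)) * (D t + l * H t) / 4 := by ring
    _ = _ := by rw [e1, e2]; ring

/-- J, the initial growing mode plus the accumulated weighted source, satisfies J' ≥ κ₀
t^(-(d-1)(p-1)/2) J^p: the velocity is at least a multiple of e^(lt) J, and the exponentials in
Hölder's inequality cancel exactly. -/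
theorem exists_integral_bound (hb : IntegrableOn b (Ioi 0)) (hl : 0 < l) (hA : 0 < A)
    (hp : 1 < p) (hc₁ : 0 < c₁) :
    ∃ t₀ κ : ℝ, 1 ≤ t₀ ∧ 0 < κ ∧ ∀ S N H D M F G,
      ReducedSystem b d l A c₁ c₂ p q N H D M F G S → 0 ≤ H 0 → 0 ≤ D 0 → 0 < D 0 + l * H 0 →
      t₀ ≤ S →
      κ * ∫ s in t₀..S, s ^ (-((d - 1) / 2 * (p - 1))) ≤ (D 0 + l * H 0) ^ (1 - p) := by
  obtain ⟨t₀, k, ht₀, hk, hvel⟩ := exists_velocity_lower_bound hb hl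
  set κ₀ := c₁ * A ^ (1 - p) * k ^ p with hκ₀
  have hκ₀pos : 0 < κ₀ := by positivity
  refine ⟨t₀, (p - 1) * κ₀, ht₀, mul_pos (by linarith) hκ₀pos,
    fun S N H D M F G h hH hD hW htS => ?_⟩
  have hS : 0 ≤ S := by linarith
  have ht₀0 : 0 ≤ t₀ := by linarith
  set J : ℝ → ℝ := fun t => D 0 + l * H 0 + ∫ s in (0 : ℝ)..t, Real.exp (-l * s) * N s with hJ
  have hNi : IntervalIntegrable N volume 0 S := h.eigen.intervalIntegrable_source hb hS
  have heN : IntervalIntegrable (fun s => Real.exp (-l * s) * N s) volume 0 S :=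
    hNi.continuousOn_mul (Continuous.continuousOn (by fun_prop))
  have hJac0 : AbsolutelyContinuousOnInterval J 0 S := by
    have h1 : AbsolutelyContinuousOnInterval (fun _ : ℝ => D 0 + l * H 0) 0 S :=
      ac_of_contDiff contDiff_const 0 S
    exact h1.fun_add (ac_primitive heN)
  have hJd : ∀ᵐ t, t ∈ Icc 0 S → HasDerivAt J (Real.exp (-l * t) * N t) t := by
    filter_upwards [ae_hasDerivAt_primitive hS heN] with t h1 ht
    exact (h1 ht).const_add _
  have hJnn : ∀ᵐ t, t ∈ Icc 0 S → 0 ≤ Real.exp (-l * t) * N t := by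
    filter_upwards [h.eigen.source_nonneg] with t h1 ht
    exact mul_nonneg (Real.exp_pos _).le (h1 ht)
  have hJmono : MonotoneOn J (Icc 0 S) := ac_monotoneOn hJac0 hJd hJnn
  have hJ0 : J 0 = D 0 + l * H 0 := by simp [hJ]
  have hJW : ∀ t ∈ Icc 0 S, D 0 + l * H 0 ≤ J t := fun t ht =>
    hJ0 ▸ hJmono ⟨le_rfl, hS⟩ ht ht.1
  have hsub : Icc t₀ S ⊆ Icc 0 S := Icc_subset_Icc ht₀0 le_rfl
  have hmain := integral_le_of_superlinear (κ := fun t => κ₀ * t ^ (-((d - 1) / 2 * (p - 1))))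
    hp htS (hJac0.mono (by rw [uIcc_of_le htS, uIcc_of_le hS]; exact hsub))
    (hW.trans_le (hJW t₀ ⟨ht₀0, htS⟩))
    (fun t ht => hJmono ⟨ht₀0, htS⟩ (hsub ht) ht.1)
    (hJd.mono fun t h1 ht => h1 (hsub ht)) ?_ ?_
  · rw [intervalIntegral.integral_const_mul, ← mul_assoc] at hmain
    exact hmain.trans (Real.rpow_le_rpow_of_nonpos hW (hJW t₀ ⟨ht₀0, htS⟩) (by linarith))
  · refine continuousOn_const.mul (continuousOn_id.rpow_const fun t ht => Or.inl ?_)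
    have := ht.1
    exact (show (0 : ℝ) < t by linarith).ne'
  · filter_upwards [h.velocity_eigen] with t h1 ht
    have ht1 : t ∈ Icc 1 S := ⟨ht₀.trans ht.1, ht.2⟩
    have ht0 : 0 < t := by linarith [ht1.1]
    have hJt : 0 ≤ J t := hW.le.trans (hJW t (hsub ht))
    have h2 := forcing_lower_bound hc₁.le hA ht0 hp hk.le hJt
      (hvel S N H D h.eigen hH hD t ht.1 ht.2) (h1 ht1)
    have h3 := mul_le_mul_of_nonneg_left h2 (Real.exp_pos (-l * t)).le
    refine le_trans (le_of_eq ?_) h3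
    have e1 : Real.exp (-l * t) * Real.exp (p * (l * t) - (p - 1) * (l * t)) = 1 := by
      rw [← Real.exp_add, show -l * t + (p * (l * t) - (p - 1) * (l * t)) = 0 by ring,
        Real.exp_zero]
    calc _ = (Real.exp (-l * t) * Real.exp (p * (l * t) - (p - 1) * (l * t))) *
          (κ₀ * t ^ (-((d - 1) / 2 * (p - 1))) * J t ^ p) := by rw [e1]; ring
      _ = _ := by rw [hκ₀]; ring

/-- The velocity of H, at least a multiple of e^(lt) times its initial mode, feeds the forcing of F
through the conjugate power of φ. The dual integral grows like e^(plt) after raising to the power p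
- 1, which cancels the exponential of |D|^p and leaves t^((d-1)(1-p/2)); two integrations add 2 to
the exponent. -/
theorem exists_growth_of_velocity (hb : IntegrableOn b (Ioi 0)) (hl : 0 < l) (hA : 0 < A)
    (hp : 1 < p) (hc₁ : 0 < c₁) :
    ∃ t₁ κ : ℝ, 1 ≤ t₁ ∧ 0 < κ ∧ ∀ S N H D M F G,
      ReducedSystem b d l A c₁ c₂ p q N H D M F G S → 0 ≤ H 0 → 0 ≤ D 0 → 0 < D 0 + l * H 0 →
      0 ≤ F 0 → 0 ≤ G 0 → ∀ t, t₁ ≤ t → t ≤ S →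
      κ * (D 0 + l * H 0) ^ p * t ^ ((d - 1) * (1 - p / 2) + 2) ≤ F t := by
  obtain ⟨t₀, k, ht₀, hk, hvel⟩ := exists_velocity_lower_bound hb hl
  obtain ⟨c, hc, hgrow⟩ := DampedODE.exists_power_growth hb ((d - 1) * (1 - p / 2))
  refine ⟨4 * t₀, c * (c₁ * A ^ (1 - p) * k ^ p), by linarith, by positivity,
    fun S N H D M F G h hH hD hW hF hG t h1 h2 => ?_⟩
  have hS : 0 ≤ S := by linarith
  have := hgrow S M F G h.const hF hG (c₁ * A ^ (1 - p) * k ^ p * (D 0 + l * H 0) ^ p) t₀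
    (by positivity) (by linarith) ?_ t h1 h2
  · linarith
  filter_upwards [h.velocity_const] with t h1 ht
  have ht1 : t ∈ Icc 1 S := ⟨ht₀.trans ht.1, ht.2⟩
  have ht0 : 0 < t := by linarith [ht1.1]
  have hlow : k * Real.exp (l * t) * (D 0 + l * H 0) ≤ D t := by
    refine le_trans ?_ (hvel S N H D h.eigen hH hD t ht.1 ht.2)
    refine mul_le_mul_of_nonneg_left ?_ (by positivity)
    exact le_add_of_nonneg_right (h.eigen.source_integral_nonneg ⟨ht0.le, ht.2⟩)
  have h2 := forcing_lower_bound hc₁.le hA ht0 hp hk.le hW.le hlow (h1 ht1)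
  have hp1 : p - 1 ≠ 0 := by linarith
  rw [show -((d - 1) * (1 - p / (p - 1) / 2) * (p - 1)) = (d - 1) * (1 - p / 2) by
      field_simp; ring,
    show p * (l * t) - (p - 1) * (p / (p - 1) * l * t) = 0 by field_simp; ring,
    Real.exp_zero] at h2
  linarith

theorem exists_growth_of_position (hb : IntegrableOn b (Ioi 0)) (hl : 0 < l) (hA : 0 < A)
    (hq : 1 < q) (hc₂ : 0 < c₂) :
    ∃ t₁ κ : ℝ, 1 ≤ t₁ ∧ 0 < κ ∧ ∀ S N H D M F G,
      ReducedSystem b d l A c₁ c₂ p q N H D M F G S → 0 ≤ H 0 → 0 ≤ D 0 → 0 < D 0 + l * H 0 →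
      0 ≤ F 0 → 0 ≤ G 0 → ∀ t, t₁ ≤ t → t ≤ S →
      κ * (D 0 + l * H 0) ^ q * t ^ ((d - 1) * (1 - q / 2) + 2) ≤ F t := by
  obtain ⟨c, hc, hgrow⟩ := DampedODE.exists_power_growth hb ((d - 1) * (1 - q / 2))
  set k := (1 - Real.exp (-(2 * l))) / (2 * l) * Real.exp (-dampMass b) with hkdef
  have hk : 0 < k := by
    have : Real.exp (-(2 * l)) < 1 := by rw [Real.exp_lt_one_iff]; linarith
    have : 0 < 1 - Real.exp (-(2 * l)) := by linarith
    positivity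
  refine ⟨4, c * (c₂ * A ^ (1 - q) * k ^ q), by norm_num, by positivity,
    fun S N H D M F G h hH hD hW hF hG t h1 h2 => ?_⟩
  have hS : 0 ≤ S := by linarith
  have := hgrow S M F G h.const hF hG (c₂ * A ^ (1 - q) * k ^ q * (D 0 + l * H 0) ^ q) 1
    (by positivity) one_pos ?_ t (by linarith) h2
  · linarith
  refine Filter.Eventually.of_forall fun t ht => ?_
  have ht0 : 0 < t := by linarith [ht.1]
  have hlow : k * Real.exp (l * t) * (D 0 + l * H 0) ≤ H t := by
    have := h.eigen.exponential_growth_fst hb hl hS hH hD ht.1 ht.2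
    rw [hkdef]; linarith
  have h2 := forcing_lower_bound hc₂.le hA ht0 hq hk.le hW.le hlow (h.position_eigen t ht)
  have hq1 : q - 1 ≠ 0 := by linarith
  rw [show -((d - 1) * (1 - q / (q - 1) / 2) * (q - 1)) = (d - 1) * (1 - q / 2) by
      field_simp; ring,
    show q * (l * t) - (q - 1) * (q / (q - 1) * l * t) = 0 by field_simp; ring,
    Real.exp_zero] at h2
  linarith

/-- The blow-up criterion is started at S/2 with the a priori lower bound there. The coefficient
t^(-d(q-1)) of F^q decreases in time, so its value at the endpoint S may be used as the constant B.
-/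
theorem exists_bound_of_growth (hb : IntegrableOn b (Ioi 0)) (hA : 0 < A) (hq : 1 < q)
    (hc₂ : 0 < c₂) (hd : 0 ≤ d) {t₁ κ : ℝ} (ht₁ : 1 ≤ t₁) (hκ : 0 < κ) (a : ℝ) :
    ∃ C : ℝ, ∀ S N H D M F G, ReducedSystem b d l A c₁ c₂ p q N H D M F G S → 0 ≤ F 0 → 0 ≤ G 0 →
      ∀ X, 0 < X → (∀ t, t₁ ≤ t → t ≤ S → κ * X * t ^ a ≤ F t) → 2 * t₁ ≤ S →
      X ^ (q - 1) * S ^ (2 + (a - d) * (q - 1)) ≤ C := by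
  obtain ⟨C, hC, hbl⟩ := DampedODE.exists_blowup_bound hb hq
  set m := (1 / 4) * (c₂ * A ^ (1 - q)) * κ ^ (q - 1) * (1 / 2 : ℝ) ^ (a * (q - 1)) with hm
  have hm0 : 0 < m := by positivity
  refine ⟨C / m, fun S N H D M F G h hF hG X hX hgr hS2 => ?_⟩
  have hS : 0 < S := by linarith
  have hFh : κ * X * (S / 2) ^ a ≤ F (S / 2) := hgr (S / 2) (by linarith) (by linarith)
  have hFh0 : 0 < κ * X * (S / 2) ^ a := by positivity
  have hbd := hbl S M F G h.const hF hG (c₂ * A ^ (1 - q) * S ^ (-(d * (q - 1)))) (S / 2)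
    (by positivity) (by linarith) (by linarith) (hFh0.trans_le hFh) ?_
  · have h1 : (κ * X * (S / 2) ^ a) ^ (q - 1) ≤ F (S / 2) ^ (q - 1) :=
      Real.rpow_le_rpow hFh0.le hFh (by linarith)
    have h2 := (mul_le_mul_of_nonneg_left h1
      (by positivity : 0 ≤ (S - S / 2) ^ 2 * (c₂ * A ^ (1 - q) * S ^ (-(d * (q - 1)))))).trans hbd
    rw [le_div_iff₀ hm0]
    refine le_trans (le_of_eq ?_) h2
    rw [Real.mul_rpow (by positivity) (by positivity), Real.mul_rpow hκ.le hX.le,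
      ← Real.rpow_mul (by positivity), show S / 2 = 1 / 2 * S by ring,
      Real.mul_rpow (by norm_num) hS.le, hm,
      show 2 + (a - d) * (q - 1) = 2 + -(d * (q - 1)) + a * (q - 1) by ring,
      Real.rpow_add hS, Real.rpow_add hS, show S ^ (2 : ℝ) = S ^ 2 from Real.rpow_natCast S 2]
    ring
  · refine Filter.Eventually.of_forall fun t ht => ?_
    have ht1 : t ∈ Icc 1 S := ⟨by linarith [ht.1], ht.2⟩
    have ht0 : 0 < t := by linarith [ht1.1]
    have hF0 : 0 ≤ F t := h.const.nonneg_fst hb le_rfl hS.le hF hG t ⟨ht0.le, ht.2⟩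
    have hx : c₂ * |F t| ^ q ≤ M t * (A * t ^ d * Real.exp 0) ^ (q - 1) := by
      rw [Real.exp_zero, mul_one]; exact h.position_const t ht1
    have h2 := forcing_lower_bound (k := 1) (y := 0) (j := F t) hc₂.le hA ht0 hq zero_le_one hF0
      (by simp) hx
    simp only [Real.one_rpow, mul_zero, sub_zero, Real.exp_zero, mul_one] at h2
    refine le_trans ?_ h2
    have h3 : S ^ (-(d * (q - 1))) ≤ t ^ (-(d * (q - 1))) :=
      Real.rpow_le_rpow_of_nonpos ht0 ht.2
        (neg_nonpos.2 (mul_nonneg hd (by linarith)))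
    have h4 : 0 ≤ F t ^ q := Real.rpow_nonneg hF0 q
    gcongr

end ReducedSystem

/-- A bound for `ε ^ σ * S ^ θ` yields the lifespan estimate `S ≤ C₀ * ε ^ (-(σ / θ))`. -/
theorem exists_lifespan_constant {θ σ w : ℝ} (hθ : 0 < θ) (hσ : 0 ≤ σ) (hw : 0 < w) (t₁ C : ℝ) :
    ∃ C₀ : ℝ, 0 < C₀ ∧ ∀ ε S : ℝ, 0 < ε → ε < 1 → 0 ≤ S →
      (t₁ ≤ S → (ε * w) ^ σ * S ^ θ ≤ C) → S ≤ C₀ * ε ^ (-(σ / θ)) := by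
  set B := (max C 0 * w ^ (-σ)) ^ (1 / θ) with hB
  have hB0 : 0 ≤ B := by positivity
  refine ⟨max t₁ 0 + B + 1, by positivity, fun ε S hε hε1 hS h => ?_⟩
  -- For ε < 1 the right-hand side is at least C₀, so times S below the threshold t₁ are covered by
  -- enlarging C₀.
  have hε' : 1 ≤ ε ^ (-(σ / θ)) :=
    Real.one_le_rpow_of_pos_of_le_one_of_nonpos hε hε1.le (neg_nonpos.2 (by positivity))
  rcases lt_or_ge S t₁ with hlt | hge
  · have : S ≤ max t₁ 0 + B + 1 := by linarith [le_max_left t₁ 0]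
    have h0 : 0 ≤ max t₁ 0 + B + 1 := by positivity
    nlinarith
  · have h1 := h hge
    have h2 : S ^ θ ≤ max C 0 * w ^ (-σ) * ε ^ (-σ) := by
      have e : S ^ θ = (ε * w) ^ (-σ) * ((ε * w) ^ σ * S ^ θ) := by
        rw [← mul_assoc, ← Real.rpow_add (by positivity)]; simp
      rw [e, Real.mul_rpow hε.le hw.le (z := -σ)]
      have : (ε * w) ^ σ * S ^ θ ≤ max C 0 := h1.trans (le_max_left _ _)
      calc _ ≤ ε ^ (-σ) * w ^ (-σ) * max C 0 := by gcongr
        _ = _ := by ring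
    have h3 := Real.rpow_le_rpow (by positivity) h2 (show 0 ≤ 1 / θ by positivity)
    rw [← Real.rpow_mul hS, mul_one_div_cancel hθ.ne', Real.rpow_one,
      Real.mul_rpow (by positivity) (by positivity), ← hB, ← Real.rpow_mul hε.le,
      show -σ * (1 / θ) = -(σ / θ) by ring] at h3
    have : 0 ≤ (max t₁ 0 + 1) * ε ^ (-(σ / θ)) := by positivity
    linarith

theorem le_coe_of_forall_timeInterval {T : EReal} (hT : 0 < T) {B : ℝ}
    (h : ∀ S ∈ timeInterval T, S ≤ B) : T ≤ (B : EReal) := by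
  by_contra! hlt
  have h0 : (0 : EReal) ≤ (B : EReal) :=
    EReal.coe_nonneg.2 (h 0 ⟨le_rfl, by exact_mod_cast hT⟩)
  obtain ⟨S, h1, h2⟩ := EReal.lt_iff_exists_real_btwn.1 hlt
  have hBS : B < S := by exact_mod_cast h1
  have := h S ⟨(by exact_mod_cast h0 : (0 : ℝ) ≤ B).trans hBS.le, h2⟩
  linarith

end

end BlowUpAE

/-! ### Lifespan estimates in terms of ε -/

namespace BlowUpAE

noncomputable section

open Set IsWeakSolution

/-- A reduced system on `[0, S]` whose initial data are `ε` times fixed numbers. -/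
def HasReducedSystem (b : ℝ → ℝ) (d l A c₁ c₂ p q h₀ d₀ k₀ g₀ ε S : ℝ) : Prop :=
  ∃ N H D M F G : ℝ → ℝ, ReducedSystem b d l A c₁ c₂ p q N H D M F G S ∧
    H 0 = ε * h₀ ∧ D 0 = ε * d₀ ∧ F 0 = ε * k₀ ∧ G 0 = ε * g₀

namespace HasReducedSystem

variable {b : ℝ → ℝ} {d l A c₁ c₂ p q h₀ d₀ k₀ g₀ : ℝ}

theorem exists_integral_bound (hb : IntegrableOn b (Ioi 0)) (hl : 0 < l) (hA : 0 < A)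
    (hp : 1 < p) (hc₁ : 0 < c₁) (hh : 0 ≤ h₀) (hd₀ : 0 ≤ d₀) (hw : 0 < d₀ + l * h₀) :
    ∃ t₀ κ : ℝ, 1 ≤ t₀ ∧ 0 < κ ∧ ∀ ε S, 0 < ε →
      HasReducedSystem b d l A c₁ c₂ p q h₀ d₀ k₀ g₀ ε S → t₀ ≤ S →
      κ * ∫ s in t₀..S, s ^ (-((d - 1) / 2 * (p - 1))) ≤ (ε * (d₀ + l * h₀)) ^ (1 - p) := by
  obtain ⟨t₀, κ, ht₀, hκ, hmain⟩ := ReducedSystem.exists_integral_bound (c₂ := c₂) (q := q) (d := d)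
    hb hl hA hp hc₁
  refine ⟨t₀, κ, ht₀, hκ, fun ε S hε ⟨N, H, D, M, F, G, h, hH, hD, _, _⟩ hS => ?_⟩
  have e : D 0 + l * H 0 = ε * (d₀ + l * h₀) := by rw [hH, hD]; ring
  have := hmain S N H D M F G h (by rw [hH]; positivity) (by rw [hD]; positivity)
    (by rw [e]; positivity) hS
  rwa [e] at this

theorem exists_lifespan_glassey (hb : IntegrableOn b (Ioi 0)) (hl : 0 < l) (hA : 0 < A)
    (hp : 1 < p) (hc₁ : 0 < c₁) (hh : 0 ≤ h₀) (hd₀ : 0 ≤ d₀) (hw : 0 < d₀ + l * h₀)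
    (hθ : (d - 1) * (p - 1) < 2) :
    ∃ C₀ : ℝ, 0 < C₀ ∧ ∀ ε S : ℝ, 0 < ε → ε < 1 → 0 ≤ S →
      HasReducedSystem b d l A c₁ c₂ p q h₀ d₀ k₀ g₀ ε S →
      S ≤ C₀ * ε ^ (-(2 * (p - 1) / (2 - (d - 1) * (p - 1)))) := by
  obtain ⟨t₀, κ, ht₀, hκ, hmain⟩ := exists_integral_bound (d := d) (c₂ := c₂) (q := q) (k₀ := k₀)
    (g₀ := g₀) hb hl hA hp hc₁ hh hd₀ hw
  set w := d₀ + l * h₀ with hwdef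
  set θ := 1 - (d - 1) / 2 * (p - 1) with hθdef
  have hθ0 : 0 < θ := by rw [hθdef]; linarith
  obtain ⟨C₀, hC₀, hlife⟩ := exists_lifespan_constant hθ0 (show 0 ≤ p - 1 by linarith) hw t₀
    (θ / κ + w ^ (p - 1) * t₀ ^ θ)
  refine ⟨C₀, hC₀, fun ε S hε hε1 hS h => ?_⟩
  have hexp : 2 * (p - 1) / (2 - (d - 1) * (p - 1)) = (p - 1) / θ := by
    rw [show 2 - (d - 1) * (p - 1) = 2 * θ by rw [hθdef]; ring,
      mul_div_mul_left _ _ two_ne_zero]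
  rw [hexp]
  refine hlife ε S hε hε1 hS fun hle => ?_
  have h1 := hmain ε S hε h hle
  rw [integral_rpow (Or.inl (by linarith)),
    show -((d - 1) / 2 * (p - 1)) + 1 = θ by rw [hθdef]; ring] at h1
  have hX : 0 < (ε * w) ^ (p - 1) := by positivity
  have h2 := mul_le_mul_of_nonneg_left h1 hX.le
  rw [← Real.rpow_add (by positivity), show p - 1 + (1 - p) = 0 by ring, Real.rpow_zero] at h2
  have h3 : (ε * w) ^ (p - 1) * (S ^ θ - t₀ ^ θ) ≤ θ / κ := by
    rw [le_div_iff₀ hκ]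
    have e : (ε * w) ^ (p - 1) * (κ * ((S ^ θ - t₀ ^ θ) / θ)) * θ =
        (ε * w) ^ (p - 1) * (S ^ θ - t₀ ^ θ) * κ := by field_simp
    have := mul_le_mul_of_nonneg_right h2 hθ0.le
    rw [e] at this
    linarith
  -- The contribution of the lower limit t₀ is bounded uniformly in ε < 1.
  have h4 : (ε * w) ^ (p - 1) ≤ w ^ (p - 1) :=
    Real.rpow_le_rpow (by positivity) (mul_le_of_le_one_left hw.le hε1.le) (by linarith)
  have h5 : (ε * w) ^ (p - 1) * t₀ ^ θ ≤ w ^ (p - 1) * t₀ ^ θ := by gcongr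
  linarith

theorem exists_lifespan_glassey_critical (hb : IntegrableOn b (Ioi 0)) (hl : 0 < l) (hA : 0 < A)
    (hp : 1 < p) (hc₁ : 0 < c₁) (hh : 0 ≤ h₀) (hd₀ : 0 ≤ d₀) (hw : 0 < d₀ + l * h₀)
    (hθ : (d - 1) * (p - 1) = 2) :
    ∃ C₀ : ℝ, 0 < C₀ ∧ ∀ ε S : ℝ, 0 < ε → ε < 1 → 0 ≤ S →
      HasReducedSystem b d l A c₁ c₂ p q h₀ d₀ k₀ g₀ ε S →
      S ≤ Real.exp (C₀ * ε ^ (-(p - 1))) := by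
  obtain ⟨t₀, κ, ht₀, hκ, hmain⟩ := exists_integral_bound (d := d) (c₂ := c₂) (q := q) (k₀ := k₀)
    (g₀ := g₀) hb hl hA hp hc₁ hh hd₀ hw
  set w := d₀ + l * h₀ with hwdef
  have ht₀0 : 0 < t₀ := by linarith
  have hlog : 0 ≤ Real.log t₀ := Real.log_nonneg ht₀
  refine ⟨Real.log t₀ + κ⁻¹ * w ^ (1 - p) + 1, by positivity, fun ε S hε hε1 hS h => ?_⟩
  have hε' : 1 ≤ ε ^ (-(p - 1)) :=
    Real.one_le_rpow_of_pos_of_le_one_of_nonpos hε hε1.le (by linarith)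
  have hκw : 0 < κ⁻¹ * w ^ (1 - p) := by positivity
  have h0 : Real.log t₀ + κ⁻¹ * w ^ (1 - p) * ε ^ (-(p - 1)) ≤
      (Real.log t₀ + κ⁻¹ * w ^ (1 - p) + 1) * ε ^ (-(p - 1)) := by nlinarith
  refine le_trans ?_ (Real.exp_le_exp.2 h0)
  rw [Real.exp_add, Real.exp_log ht₀0]
  rcases le_or_gt S t₀ with hle | hlt
  · exact hle.trans (le_mul_of_one_le_right ht₀0.le (Real.one_le_exp (by positivity)))
  · have h1 := hmain ε S hε h hlt.le
    -- At the critical exponent the weight is 1/t and the integral is log(S/t₀), whence the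
    -- exponential lifespan.
    rw [show -((d - 1) / 2 * (p - 1)) = -1 by linarith] at h1
    simp only [Real.rpow_neg_one] at h1
    rw [integral_inv_of_pos ht₀0 (by linarith), Real.mul_rpow hε.le hw.le] at h1
    have h2 : Real.log (S / t₀) ≤ κ⁻¹ * w ^ (1 - p) * ε ^ (-(p - 1)) := by
      rw [mul_assoc, ← div_eq_inv_mul, le_div_iff₀ hκ, neg_sub]
      linarith
    have h3 := Real.exp_le_exp.2 h2
    rw [Real.exp_log (div_pos (ht₀0.trans hlt) ht₀0), div_le_iff₀ ht₀0] at h3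
    linarith

theorem exists_lifespan_of_growth (hb : IntegrableOn b (Ioi 0)) (hA : 0 < A)
    (hq : 1 < q) (hc₂ : 0 < c₂) (hd : 0 ≤ d) (hk₀ : 0 ≤ k₀) (hg₀ : 0 ≤ g₀) {s a w : ℝ}
    (hs : 0 ≤ s) (hw : 0 < w) (hθ : 0 < 2 + (a - d) * (q - 1)) {t₁ κ : ℝ} (ht₁ : 1 ≤ t₁)
    (hκ : 0 < κ)
    (hgr : ∀ ε S N H D M F G, 0 < ε → ReducedSystem b d l A c₁ c₂ p q N H D M F G S →
      H 0 = ε * h₀ → D 0 = ε * d₀ → F 0 = ε * k₀ → G 0 = ε * g₀ →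
      ∀ t, t₁ ≤ t → t ≤ S → κ * (ε * w) ^ s * t ^ a ≤ F t) :
    ∃ C₀ : ℝ, 0 < C₀ ∧ ∀ ε S : ℝ, 0 < ε → ε < 1 → 0 ≤ S →
      HasReducedSystem b d l A c₁ c₂ p q h₀ d₀ k₀ g₀ ε S →
      S ≤ C₀ * ε ^ (-(s * (q - 1) / (2 + (a - d) * (q - 1)))) := by
  obtain ⟨C, hC⟩ := ReducedSystem.exists_bound_of_growth (c₁ := c₁) (p := p) (l := l) hb hA hq hc₂ hd
    ht₁ hκ a
  obtain ⟨C₀, hC₀, hlife⟩ := exists_lifespan_constant hθ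
    (mul_nonneg hs (show 0 ≤ q - 1 by linarith)) hw (2 * t₁) C
  refine ⟨C₀, hC₀, fun ε S hε hε1 hS h => hlife ε S hε hε1 hS fun hle => ?_⟩
  obtain ⟨N, H, D, M, F, G, h, hH, hD, hF, hG⟩ := h
  have := hC S N H D M F G h (by rw [hF]; positivity) (by rw [hG]; positivity) ((ε * w) ^ s)
    (by positivity) (hgr ε S N H D M F G hε h hH hD hF hG) hle
  rwa [← Real.rpow_mul (by positivity)] at this

theorem exists_lifespan_combined (hb : IntegrableOn b (Ioi 0)) (hl : 0 < l) (hA : 0 < A)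
    (hp : 1 < p) (hq : 1 < q) (hc₁ : 0 < c₁) (hc₂ : 0 < c₂) (hd : 0 ≤ d) (hh : 0 ≤ h₀)
    (hd₀ : 0 ≤ d₀) (hk₀ : 0 ≤ k₀) (hg₀ : 0 ≤ g₀) (hw : 0 < d₀ + l * h₀)
    (hθ : (q - 1) * ((d - 1) * p - 2) < 4) :
    ∃ C₀ : ℝ, 0 < C₀ ∧ ∀ ε S : ℝ, 0 < ε → ε < 1 → 0 ≤ S →
      HasReducedSystem b d l A c₁ c₂ p q h₀ d₀ k₀ g₀ ε S →
      S ≤ C₀ * ε ^ (-(2 * p * (q - 1) / (2 * q + 2 - (d - 1) * p * (q - 1)))) := by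
  obtain ⟨t₁, κ, ht₁, hκ, hgr⟩ := ReducedSystem.exists_growth_of_velocity (c₂ := c₂) (q := q)
    (d := d) hb hl hA hp hc₁
  have e : 2 * q + 2 - (d - 1) * p * (q - 1) =
      2 * (2 + ((d - 1) * (1 - p / 2) + 2 - d) * (q - 1)) := by ring
  rw [e, mul_assoc 2 p, mul_div_mul_left _ _ two_ne_zero]
  refine exists_lifespan_of_growth hb hA hq hc₂ hd hk₀ hg₀ (by linarith) hw (by linarith) ht₁ hκ
    fun ε S N H D M F G hε h hH hD hF hG t h1 h2 => ?_
  have e : D 0 + l * H 0 = ε * (d₀ + l * h₀) := by rw [hH, hD]; ring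
  rw [← e]
  exact hgr S N H D M F G h (by rw [hH]; positivity) (by rw [hD]; positivity)
    (by rw [e]; positivity) (by rw [hF]; positivity) (by rw [hG]; positivity) t h1 h2

theorem exists_lifespan_strauss (hb : IntegrableOn b (Ioi 0)) (hl : 0 < l) (hA : 0 < A)
    (hq : 1 < q) (hc₂ : 0 < c₂) (hd : 0 ≤ d) (hh : 0 ≤ h₀)
    (hd₀ : 0 ≤ d₀) (hk₀ : 0 ≤ k₀) (hg₀ : 0 ≤ g₀) (hw : 0 < d₀ + l * h₀)
    (hθ : (d - 1) * q ^ 2 - (d + 1) * q - 2 < 0) :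
    ∃ C₀ : ℝ, 0 < C₀ ∧ ∀ ε S : ℝ, 0 < ε → ε < 1 → 0 ≤ S →
      HasReducedSystem b d l A c₁ c₂ p q h₀ d₀ k₀ g₀ ε S →
      S ≤ C₀ * ε ^ (2 * q * (q - 1) / ((d - 1) * q ^ 2 - (d + 1) * q - 2)) := by
  obtain ⟨t₁, κ, ht₁, hκ, hgr⟩ := ReducedSystem.exists_growth_of_position (c₁ := c₁) (p := p)
    (d := d) hb hl hA hq hc₂
  have e : (d - 1) * q ^ 2 - (d + 1) * q - 2 =
      2 * -(2 + ((d - 1) * (1 - q / 2) + 2 - d) * (q - 1)) := by ring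
  rw [e, mul_assoc 2 q, mul_div_mul_left _ _ two_ne_zero, div_neg]
  refine exists_lifespan_of_growth hb hA hq hc₂ hd hk₀ hg₀ (by linarith) hw (by linarith) ht₁ hκ
    fun ε S N H D M F G hε h hH hD hF hG t h1 h2 => ?_
  have e : D 0 + l * H 0 = ε * (d₀ + l * h₀) := by rw [hH, hD]; ring
  rw [← e]
  exact hgr S N H D M F G h (by rw [hH]; positivity) (by rw [hD]; positivity)
    (by rw [e]; positivity) (by rw [hF]; positivity) (by rw [hG]; positivity) t h1 h2

theorem exists_lifespan_plane (hb : IntegrableOn b (Ioi 0)) (hA : 0 < A)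
    (hq : 1 < q) (hq3 : q < 3) (hc₂ : 0 < c₂) (hk₀ : 0 ≤ k₀) (hg₀ : 0 < g₀) :
    ∃ C₀ : ℝ, 0 < C₀ ∧ ∀ ε S : ℝ, 0 < ε → ε < 1 → 0 ≤ S →
      HasReducedSystem b 2 l A c₁ c₂ p q h₀ d₀ k₀ g₀ ε S →
      S ≤ C₀ * ε ^ (-((q - 1) / (3 - q))) := by
  have h := exists_lifespan_of_growth (b := b) (d := 2) (l := l) (A := A) (c₁ := c₁) (p := p)
    (h₀ := h₀) (d₀ := d₀) (k₀ := k₀) (g₀ := g₀) (s := 1) (a := 1) (w := g₀) (t₁ := 1)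
    (κ := Real.exp (-dampMass b)) hb hA hq hc₂ zero_le_two hk₀ hg₀.le zero_le_one hg₀
    (by linarith) le_rfl (Real.exp_pos _)
    fun ε S N H D M F G hε h hH hD hF hG t h1 h2 => by
      have := h.const.linear_growth hb (by linarith) (by rw [hF]; positivity)
        (by rw [hG]; positivity) (t := t) ⟨by linarith, h2⟩
      rw [Real.rpow_one, Real.rpow_one, ← hG]
      exact this
  rwa [one_mul, show 2 + (1 - 2) * (q - 1) = 3 - q by ring] at h

end HasReducedSystem

/-! ### Positivity of the data, critical exponents and conclusion -/

theorem pairing_pos {n : ℕ} {g : E n → Matrix (Fin n) (Fin n) ℝ} (hp : ∀ x, (g x).PosDef)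
    (hg : ∀ j k, ContDiff ℝ 2 (fun x => g x j k)) {f w : E n → ℝ} (hf : Continuous f)
    (hfc : HasCompactSupport f) (hf0 : ∀ x, 0 ≤ f x) (hne : f ≠ 0) (hw : Continuous w)
    (hw0 : ∀ x, 0 < w x) : 0 < pairing g f w := by
  obtain ⟨x₀, hx₀⟩ := Function.ne_iff.1 hne
  refine Continuous.integral_pos_of_hasCompactSupport_nonneg_nonzero (x := x₀)
    ((hf.mul hw).mul (continuous_volDensity hp hg)) ((hfc.mul_right).mul_right)
    (fun x => mul_nonneg (mul_nonneg (hf0 x) (hw0 x).le) (volDensity_pos hp x).le) ?_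
  exact mul_ne_zero (mul_ne_zero hx₀ (hw0 x₀).ne') (volDensity_pos hp x₀).ne'

theorem pairing_const_mul {n : ℕ} {g : E n → Matrix (Fin n) (Fin n) ℝ} (ε : ℝ) (f w : E n → ℝ) :
    pairing g (fun x => ε * f x) w = ε * pairing g f w := by
  unfold pairing
  rw [← integral_const_mul]
  exact integral_congr_ae (Filter.Eventually.of_forall fun x => by ring)

theorem lt_glasseyExponent_iff {n : ℕ} (hn : 2 ≤ n) {p : ℝ} :
    p < glasseyExponent n ↔ ((n : ℝ) - 1) * (p - 1) < 2 := by
  have : (2 : ℝ) ≤ n := by exact_mod_cast hn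
  rw [glasseyExponent, ← sub_lt_iff_lt_add', lt_div_iff₀ (by linarith), mul_comm]

theorem eq_glasseyExponent_iff {n : ℕ} (hn : 2 ≤ n) {p : ℝ} :
    p = glasseyExponent n ↔ ((n : ℝ) - 1) * (p - 1) = 2 := by
  have : (2 : ℝ) ≤ n := by exact_mod_cast hn
  rw [glasseyExponent, ← sub_eq_iff_eq_add', eq_div_iff (by linarith), mul_comm]

/-- If the polynomial were nonnegative at q, then q((n-1)q - (n+1)) ≥ 2 would make the second factor
positive; both factors would then increase strictly from q to the root, where their product is
exactly 2. -/
theorem neg_of_lt_straussExponent {n : ℕ} (hn : 2 ≤ n) {q : ℝ} (hq0 : 0 < q)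
    (hq : q < straussExponent n) : ((n : ℝ) - 1) * q ^ 2 - ((n : ℝ) + 1) * q - 2 < 0 := by
  obtain ⟨h0, h1⟩ := (straussExponent_iff hn _).1 rfl
  set s := straussExponent n
  have h2 : (2 : ℝ) ≤ n := by exact_mod_cast hn
  by_contra! h
  have h3 : 0 < ((n : ℝ) - 1) * q - (n + 1) := by
    by_contra! h4
    nlinarith
  have h4 : ((n : ℝ) - 1) * q - (n + 1) < ((n : ℝ) - 1) * s - (n + 1) := by nlinarith
  nlinarith

/-- An implication with a constant depending on the premise has a constant in any case. -/
theorem exists_pos_of_imp {P : Prop} {Q : ℝ → Prop} (h : P → ∃ C, 0 < C ∧ Q C) :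
    ∃ C : ℝ, 0 < C ∧ (P → Q C) := by
  by_cases hP : P
  · obtain ⟨C, hC, hQ⟩ := h hP
    exact ⟨C, hC, fun _ => hQ⟩
  · exact ⟨1, one_pos, fun h => absurd h hP⟩

theorem exists_hasReducedSystem {n : ℕ} (hn : 1 ≤ n) {p q : ℝ} (hp : 1 < p) (hq : 1 < q)
    {c₁ c₂ : ℝ} (hc₁ : 0 ≤ c₁) (hc₂ : 0 ≤ c₂)
    {b : ℝ → ℝ} (hb : IntegrableOn b (Ioi 0)) {K : ℝ → ℝ} {g : E n → Matrix (Fin n) (Fin n) ℝ}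
    (hg : IsAsymptoticallyEuclidean K g) (hH : HypothesisH K g)
    {u₀ u₁ : E n → ℝ} (hu₀ : Continuous u₀) (hu₁ : Continuous u₁)
    (hu₀_nonneg : ∀ x, 0 ≤ u₀ x) (hu₁_nonneg : ∀ x, 0 ≤ u₁ x) {R₀ : ℝ} (hR₀ : 0 < R₀)
    (hu₀_supp : tsupport u₀ ⊆ Metric.closedBall 0 R₀)
    (hu₁_supp : tsupport u₁ ⊆ Metric.closedBall 0 R₀) (hdata : u₀ ≠ 0 ∨ u₁ ≠ 0)
    {R₁ : ℝ} (hR₁ : arcLength K R₀ ≤ R₁) :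
    ∃ l A h₀ d₀ k₀ g₀ : ℝ, 0 < l ∧ 0 < A ∧ 0 ≤ h₀ ∧ 0 ≤ d₀ ∧ 0 ≤ k₀ ∧ 0 ≤ g₀ ∧
      0 < d₀ + l * h₀ ∧ (u₁ ≠ 0 → 0 < g₀) ∧ ∀ (ε : ℝ) (T : EReal) (u v : ℝ → E n → ℝ),
        IsWeakSolution g b c₁ c₂ p q (fun x => ε * u₀ x) (fun x => ε * u₁ x) T u v →
        FiniteSpeed K R₁ T u → ∀ S ∈ timeInterval T,
          HasReducedSystem b n l A c₁ c₂ p q h₀ d₀ k₀ g₀ ε S := by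
  obtain ⟨l, c, φ, hl, hc, hφC, hφne, hφeq, hφ⟩ := hH
  have hφ0 : ∀ x, 0 ≤ φ x := fun x => (hφ x).1
  -- Strict positivity guarantees that nontrivial data, wherever supported, have a positive pairing
  -- with φ.
  have hφpos : ∀ x, 0 < φ x :=
    pos_of_nonneg_of_eigenfunction hg.posDef hg.contDiff hφC (sq_nonneg l) hφeq hφ0 hφne
  have hv0 : ∀ x, 0 ≤ volDensity g x := fun x => (volDensity_pos hg.posDef x).le
  have hR₁0 : 0 ≤ R₁ := by
    have := hg.arcLength_lt le_rfl hR₀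
    rw [IsAsymptoticallyEuclidean.arcLength_zero] at this
    linarith
  obtain ⟨A, hA, hred⟩ := exists_reducedSystem hn hg hb hp hq hc₁ hc₂ hR₁0 hl hc hφC hφeq hφ0
    fun x => (hφ x).2
  have hcomp : ∀ {f : E n → ℝ}, tsupport f ⊆ Metric.closedBall 0 R₀ → HasCompactSupport f :=
    fun hf => (isCompact_closedBall 0 R₀).of_isClosed_subset (isClosed_tsupport _) hf
  have hz : ∀ (ε : ℝ) {f : E n → ℝ}, tsupport f ⊆ Metric.closedBall 0 R₀ →
      ∀ x, R₁ < arcLength K ‖x‖ → ε * f x = 0 := by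
    intro ε f hf x hx
    suffices hx' : x ∉ tsupport f by rw [image_eq_zero_of_notMem_tsupport hx', mul_zero]
    intro hx'
    have h1 := hf hx'
    rw [mem_closedBall_zero_iff] at h1
    rcases h1.lt_or_eq with h2 | h2
    · linarith [hg.arcLength_lt (norm_nonneg x) h2]
    · rw [h2] at hx; linarith
  have hone : ∀ x : E n, (0 : ℝ) < (fun _ : E n => (1 : ℝ)) x := fun _ => one_pos
  have hh₀ := pairing_nonneg hv0 hu₀_nonneg hφ0
  have hd₀ := pairing_nonneg hv0 hu₁_nonneg hφ0
  refine ⟨l, A, pairing g u₀ φ, pairing g u₁ φ, pairing g u₀ (fun _ => 1),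
    pairing g u₁ (fun _ => 1), hl, hA, hh₀, hd₀, pairing_nonneg hv0 hu₀_nonneg fun x => (hone x).le,
    pairing_nonneg hv0 hu₁_nonneg fun x => (hone x).le, ?_, fun hne => ?_,
    fun ε T u v h hfs S hS => ?_⟩
  · rcases hdata with hne | hne
    · have := pairing_pos hg.posDef hg.contDiff hu₀ (hcomp hu₀_supp) hu₀_nonneg hne
        hφC.continuous hφpos
      positivity
    · have := pairing_pos hg.posDef hg.contDiff hu₁ (hcomp hu₁_supp) hu₁_nonneg hne
        hφC.continuous hφpos
      positivity
  · exact pairing_pos hg.posDef hg.contDiff hu₁ (hcomp hu₁_supp) hu₁_nonneg hne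
      continuous_const hone
  · obtain ⟨N, H, D, M, F, G, h1, h2, h3, h4, h5⟩ := hred (fun x => ε * u₀ x)
      (fun x => ε * u₁ x) T u v (continuous_const.mul hu₁) (hz ε hu₀_supp) (hz ε hu₁_supp) h hfs S hS
    simp only [pairing_const_mul] at h2 h3 h4 h5
    exact ⟨N, H, D, M, F, G, h1, h2, h3, h4, h5⟩

end

end BlowUpAE

theorem theorem1p1 (n : ℕ) (hn : 2 ≤ n) (p q : ℝ) (hp : 1 < p) (hq : 1 < q)
    (c₁ c₂ : ℝ) (hc₁ : 0 ≤ c₁) (hc₂ : 0 ≤ c₂)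
    (b : ℝ → ℝ) (hb : MeasureTheory.IntegrableOn b (Set.Ioi 0))
    (K : ℝ → ℝ) (g : E n → Matrix (Fin n) (Fin n) ℝ)
    (hg : IsAsymptoticallyEuclidean K g) (hH : HypothesisH K g)
    (u₀ u₁ : E n → ℝ) (hu₀ : ContDiff ℝ ∞ u₀) (hu₁ : ContDiff ℝ ∞ u₁)
    (hu₀_nonneg : ∀ x, 0 ≤ u₀ x) (hu₁_nonneg : ∀ x, 0 ≤ u₁ x)
    (R₀ : ℝ) (hR₀ : 0 < R₀)
    (hu₀_supp : tsupport u₀ ⊆ Metric.closedBall 0 R₀)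
    (hu₁_supp : tsupport u₁ ⊆ Metric.closedBall 0 R₀)
    (hdata : u₀ ≠ 0 ∨ u₁ ≠ 0)
    (R₁ : ℝ) (hR₁ : arcLength K R₀ ≤ R₁) :
    ∃ ε₀ > (0 : ℝ), ∃ C₀ > (0 : ℝ), ∀ ε : ℝ, 0 < ε → ε < ε₀ →
      ∀ (T : EReal) (u v : ℝ → E n → ℝ),
        IsWeakSolution g b c₁ c₂ p q (fun x => ε * u₀ x) (fun x => ε * u₁ x) T u v →
        FiniteSpeed K R₁ T u →
        (0 < c₁ → p < glasseyExponent n →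
          T ≤ ((C₀ * ε ^ (-(2 * (p - 1) / (2 - ((n : ℝ) - 1) * (p - 1)))) : ℝ) : EReal)) ∧
        (0 < c₁ → p = glasseyExponent n →
          T ≤ ((Real.exp (C₀ * ε ^ (-(p - 1))) : ℝ) : EReal)) ∧
        (0 < c₁ * c₂ → (q - 1) * (((n : ℝ) - 1) * p - 2) < 4 →
          T ≤ ((C₀ * ε ^ (-(2 * p * (q - 1) / (2 * q + 2 - ((n : ℝ) - 1) * p * (q - 1)))) : ℝ) :
            EReal)) ∧
        (0 < c₂ → q < straussExponent n →
          T ≤ ((C₀ * ε ^ (2 * q * (q - 1) /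
            (((n : ℝ) - 1) * q ^ 2 - ((n : ℝ) + 1) * q - 2)) : ℝ) : EReal)) ∧
        (0 < c₂ → n = 2 → q < 2 → u₁ ≠ 0 →
          T ≤ ((C₀ * ε ^ (-((q - 1) / (3 - q))) : ℝ) : EReal)) := by
  obtain ⟨l, A, h₀, d₀, k₀, g₀, hl, hA, hh₀, hd₀, hk₀, hg₀, hw, hg₀pos, hred⟩ :=
    exists_hasReducedSystem (by omega) hp hq hc₁ hc₂ hb hg hH hu₀.continuous hu₁.continuous
      hu₀_nonneg hu₁_nonneg hR₀ hu₀_supp hu₁_supp hdata hR₁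
  have hn0 : (0 : ℝ) ≤ n := Nat.cast_nonneg n
  obtain ⟨C₁, hC₁, h1⟩ := exists_pos_of_imp fun h : 0 < c₁ ∧ ((n : ℝ) - 1) * (p - 1) < 2 =>
    HasReducedSystem.exists_lifespan_glassey (c₂ := c₂) (q := q) (k₀ := k₀) (g₀ := g₀)
      hb hl hA hp h.1 hh₀ hd₀ hw h.2
  obtain ⟨C₂, hC₂, h2⟩ := exists_pos_of_imp fun h : 0 < c₁ ∧ ((n : ℝ) - 1) * (p - 1) = 2 =>
    HasReducedSystem.exists_lifespan_glassey_critical (c₂ := c₂) (q := q) (k₀ := k₀) (g₀ := g₀)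
      hb hl hA hp h.1 hh₀ hd₀ hw h.2
  obtain ⟨C₃, hC₃, h3⟩ := exists_pos_of_imp
    fun h : (0 < c₁ ∧ 0 < c₂) ∧ (q - 1) * (((n : ℝ) - 1) * p - 2) < 4 =>
    HasReducedSystem.exists_lifespan_combined hb hl hA hp hq h.1.1 h.1.2 hn0 hh₀ hd₀ hk₀ hg₀ hw h.2
  obtain ⟨C₄, hC₄, h4⟩ := exists_pos_of_imp
    fun h : 0 < c₂ ∧ ((n : ℝ) - 1) * q ^ 2 - ((n : ℝ) + 1) * q - 2 < 0 =>
    HasReducedSystem.exists_lifespan_strauss (c₁ := c₁) (p := p)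
      hb hl hA hq h.1 hn0 hh₀ hd₀ hk₀ hg₀ hw h.2
  obtain ⟨C₅, hC₅, h5⟩ := exists_pos_of_imp fun h : (0 < c₂ ∧ q < 3) ∧ 0 < g₀ =>
    HasReducedSystem.exists_lifespan_plane (c₁ := c₁) (p := p) (l := l) (h₀ := h₀) (d₀ := d₀)
      hb hA hq h.1.2 h.1.1 hk₀ h.2
  -- The bounds are increasing in the constant, so the sum serves all five cases; ε₀ = 1 is enough
  -- because only ε < 1 was used.
  refine ⟨1, one_pos, C₁ + C₂ + C₃ + C₄ + C₅, by positivity, fun ε hε hε1 T u v h hfs => ?_⟩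
  have hsys := hred ε T u v h hfs
  refine ⟨fun hc hlt => ?_, fun hc heq => ?_, fun hc hlt => ?_, fun hc hlt => ?_,
    fun hc hn2 hlt hne => ?_⟩ <;> refine le_coe_of_forall_timeInterval h.pos fun S hS => ?_
  · refine (h1 ⟨hc, (lt_glasseyExponent_iff hn).1 hlt⟩ ε S hε hε1 hS.1 (hsys S hS)).trans ?_
    gcongr
    linarith
  · refine (h2 ⟨hc, (eq_glasseyExponent_iff hn).1 heq⟩ ε S hε hε1 hS.1 (hsys S hS)).trans ?_
    gcongr
    linarith
  · have hc₁' : 0 < c₁ := hc₁.lt_of_ne' (left_ne_zero_of_mul hc.ne')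
    have hc₂' : 0 < c₂ := hc₂.lt_of_ne' (right_ne_zero_of_mul hc.ne')
    refine (h3 ⟨⟨hc₁', hc₂'⟩, hlt⟩ ε S hε hε1 hS.1 (hsys S hS)).trans ?_
    gcongr
    linarith
  · refine (h4 ⟨hc, neg_of_lt_straussExponent hn (by linarith) hlt⟩ ε S hε hε1 hS.1
      (hsys S hS)).trans ?_
    gcongr
    linarith
  · have hsys' := hsys S hS
    rw [hn2, Nat.cast_ofNat] at hsys'
    refine (h5 ⟨⟨hc, by linarith⟩, hg₀pos hne⟩ ε S hε hε1 hS.1 hsys').trans ?_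
    gcongr
    linarith
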